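/- **Conventions.** A *Picard groupoid* is a (not necessarily strict) symmetric monoidal groupoid $(\mathcal P,+,0)$ in which $x+(\cdot)\colon\mathcal P\to\mathcal P$ is an equivalence for every object $x$; a morphism of Picard groupoids is a symmetric monoidal functor. $\mathrm{isom}(\mathcal T)$ is the category of isomorphisms of $\mathcal T$. In any functor of several variables, variables that do not change are not displayed. In a symmetric monoidal category, $(a+b)+(c+d)\cong(a+c)+(b+d)$ denotes the canonical isomorphism. A *determinant functor* $D\colon\mathcal T\to\mathcal P$ from a triangulated category to a Picard groupoid is a functor $D\colon\mathrm{isom}(\mathcal T)\to\mathcal P$ with a morphism $D(\Delta)\colon D(z)+D(x)\to D(y)$ for each distinguished triangle $\Delta\colon x\to y\to z\to\Sigma x$, natural with respect to isomorphisms of distinguished triangles, such that: * (commutativity) for $\Delta_1\colon x\to x\oplus y\to y\xrightarrow{0}\Sigma x$ and $\Delta_2\colon y\to x\oplus y\to x\xrightarrow{0}\Sigma y$, the symmetry $D(x)+D(y)\cong D(y)+D(x)$ followed by $D(\Delta_1)$ equals $D(\Delta_2)$; * (octahedron) for each octahedron with distinguished triangles $\Delta_1\colon x\to y\to z'\to\Sigma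 x$, $\Delta_2\colon x\to z\to y'\to\Sigma x$, $\Delta_3\colon y\to z\to x'\to\Sigma y$, $\Delta_4\colon z'\to y'\to x'\to\Sigma z'$, the composites $D(\Delta_2)\circ(D(\Delta_4)+\mathrm{id})$ and $D(\Delta_3)\circ(\mathrm{id}+D(\Delta_1))\circ(\text{associativity})$ from $(D(x')+D(z'))+D(x)$ to $D(z)$ agree. A determinant functor $\det\colon\mathcal T\to V$ to a Picard groupoid is *universal* if for every determinant functor $D\colon\mathcal T\to\mathcal P$ to a Picard groupoid there is a pair $(f,\alpha)$, with $f\colon V\to\mathcal P$ a morphism of Picard groupoids and $\alpha\colon f\circ\det\Rightarrow D$ a natural transformation compatible with the additivity data (the composite $f(\det z)+f(\det x)\to f(\det z+\det x)\to f(\det y)\xrightarrow{\alpha_y}D(y)$ equals $D(\Delta)\circ(\alpha_z+\alpha_x)$ for every $\Delta$), such that for every other such pair $(f',\alpha')$ there is a unique monoidal natural transformation $\beta\colon f\Rightarrow f'$ with $\alpha'\circ(\beta*\det)=\alpha$. A *multi-determinant functor* $D\colon\mathcal T_0\times\dots\times\mathcal T_n\to\mathcal P$ is a functor $\mathrm{isom}(\mathcal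 T_0)\times\dots\times\mathrm{isom}(\mathcal T_n)\to\mathcal P$ which is a determinant functor in each variable, such that the additivity data $D(\Delta_i)$ of each variable are natural with respect to isomorphisms in the other variables, and such that for all $i\neq j$ and distinguished triangles $\Delta_i\colon x_i\to y_i\to z_i\to\Sigma x_i$, $\Delta_j\colon x_j\to y_j\to z_j\to\Sigma x_j$ the two morphisms $$(D(z_i,z_j)+D(x_i,z_j))+(D(z_i,x_j)+D(x_i,x_j))\longrightarrow D(y_i,y_j),$$ namely $D(\Delta_j)\circ(D(\Delta_i)+D(\Delta_i))$ and $D(\Delta_i)\circ(D(\Delta_j)+D(\Delta_j))$ precomposed with $(a+b)+(c+d)\cong(a+c)+(b+d)$, agree. A *multiexact functor* $d\colon V_0\times\dots\times V_n\to\mathcal P$ of Picard groupoids is a functor which is symmetric monoidal in each variable, whose monoidality constraints in each variable are natural in the other variables, and such that for each pair of variables the two isomorphisms from $F(a+b,c+e)$ to the sum of $F(a,c),F(a,e),F(b,c),F(b,e)$ obtained by expanding the two variables in either order agree up to $(a+b)+(c+d)\cong(a+c)+(b+d)$. A *2-cell* between multiexact functors is a natural transformation that is monoidal in each variable. **Theorem.**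 Let $n\ge 0$, let $\mathcal T_0,\dots,\mathcal T_n$ be small triangulated categories with universal determinant functors $\det\colon\mathcal T_i\to V(\mathcal T_i)$, and denote by $\det\colon\mathcal T_0\times\dots\times\mathcal T_n\to V(\mathcal T_0)\times\dots\times V(\mathcal T_n)$ their product. For every Picard groupoid $\mathcal P$ and every multi-determinant functor $D\colon\mathcal T_0\times\dots\times\mathcal T_n\to\mathcal P$ there is a pair $(d,a)$ consisting of a multiexact functor $d\colon V(\mathcal T_0)\times\dots\times V(\mathcal T_n)\to\mathcal P$ and a natural transformation $a\colon d\circ\det\Rightarrow D$ compatible with the additivity data in each variable (that is, a morphism of multi-determinant functors), such that for every other such pair $(g,\beta)$ there is a unique 2-cell $\gamma\colon d\Rightarrow g$ with $a=\beta\circ(\gamma*\det)$. -/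

import Mathlib

open CategoryTheory CategoryTheory.Limits CategoryTheory.MonoidalCategory
open CategoryTheory.Pretriangulated

universe u v w u' v'

noncomputable section

namespace MultiDeterminant

/-! ## Picard groupoids -/

/-- A Picard groupoid: a symmetric monoidal groupoid (not necessarily strict) in which
translation `x + (·)` by each object `x` is an equivalence. The sum is written `⊗`. -/
class PicardGroupoid (P : Type u) [Category.{v} P] [MonoidalCategory P] [SymmetricCategory P] :
    Prop where
  isGroupoid : IsGroupoid P
  translation_isEquivalence : ∀ x : P, (tensorLeft x).IsEquivalence

/-! ## Functors out of a finite product, one variable at a time -/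

section Slices

variable {ι : Type*} [DecidableEq ι] {C : ι → Type u} [∀ i, Category.{v} (C i)]

/-- The morphism of the product category that is `f` in the variable `i` and `φ j` in each other
variable `j`. -/
def updateHom (i : ι) {b b' : ∀ j, C j} (φ : ∀ j, j ≠ i → (b j ⟶ b' j)) {x y : C i}
    (f : x ⟶ y) : Function.update b i x ⟶ Function.update b' i y := fun j =>
  if h : j = i then by
    subst h
    exact eqToHom (Function.update_self j x b) ≫ f ≫ eqToHom (Function.update_self j y b').symm
  else
    eqToHom (Function.update_of_ne h x b) ≫ φ j h ≫ eqToHom (Function.update_of_ne h y b').symm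

/-- The inclusion of the variable `i`, all other variables being kept fixed at the values
prescribed by `b` (the value `b i` is discarded). -/
def slice (i : ι) (b : ∀ j, C j) : C i ⥤ ∀ j, C j where
  obj x := Function.update b i x
  map f := updateHom i (fun j _ => 𝟙 (b j)) f
  map_id x := by
    funext j
    by_cases h : j = i
    · subst h
      simp [updateHom]
    · simp [updateHom, h]
  map_comp f g := by
    funext j
    by_cases h : j = i
    · subst h
      simp [updateHom]
    · simp [updateHom, h]

/-- The identification of the two ways of substituting `x` in the variable `i` and `y` in the
variable `j`, pushed forward along a functor of several variables. -/
def swapHom {P : Type u'} [Category.{v'} P] (F : (∀ i, C i) ⥤ P) {i j : ι} (h : i ≠ j)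
    (b : ∀ k, C k) (x : C i) (y : C j) :
    F.obj (Function.update (Function.update b i x) j y) ⟶
      F.obj (Function.update (Function.update b j y) i x) :=
  F.map (eqToHom (Function.update_comm h x y b))

end Slices

/-! ## Determinant functors of one variable -/

section OneVariable

variable {T : Type u} [Category.{v} T] [HasZeroObject T] [HasShift T ℤ] [Preadditive T]
  [∀ n : ℤ, (shiftFunctor T n).Additive] [Pretriangulated T]

/-- The triangle `y ⟶ x ⊕ y ⟶ x ⟶ Σ y` is distinguished. -/
theorem biprod_inr_fst_distinguished (x y : T) :
    Triangle.mk (biprod.inr : y ⟶ x ⊞ y) biprod.fst 0 ∈ distTriang T := by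
  refine isomorphic_distinguished _ (binaryBiproductTriangle_distinguished y x) _
    (Triangle.isoMk _ _ (Iso.refl _) (biprod.braiding x y) (Iso.refl _) ?_ ?_ ?_)
  · change biprod.inr ≫ biprod.lift biprod.snd biprod.fst = 𝟙 y ≫ biprod.inl
    ext <;> simp
  · change biprod.fst ≫ 𝟙 x = biprod.lift biprod.snd biprod.fst ≫ biprod.snd
    simp
  · change (0 : x ⟶ y⟦(1 : ℤ)⟧) ≫ (shiftFunctor T (1 : ℤ)).map (𝟙 y) = 𝟙 x ≫ 0
    simp

variable {P : Type u'} [Category.{v'} P] [MonoidalCategory P] [SymmetricCategory P]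

/-- The additivity data, with its axioms, which make a functor from the category of isomorphisms
of a triangulated category `T` to `P` a determinant functor. -/
structure Additivity (F : Core T ⥤ P) where
  /-- The morphism `F z + F x ⟶ F y` of a distinguished triangle `x ⟶ y ⟶ z ⟶ Σ x`. -/
  add (Δ : Triangle T) (hΔ : Δ ∈ distTriang T) :
    F.obj ⟨Δ.obj₃⟩ ⊗ F.obj ⟨Δ.obj₁⟩ ⟶ F.obj ⟨Δ.obj₂⟩
  /-- Naturality with respect to isomorphisms of distinguished triangles. -/
  naturality : ∀ (Δ Δ' : Triangle T) (hΔ : Δ ∈ distTriang T) (hΔ' : Δ' ∈ distTriang T)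
    (e : Δ ≅ Δ'),
    (F.map (⟨Triangle.π₃.mapIso e⟩ : (⟨Δ.obj₃⟩ : Core T) ⟶ ⟨Δ'.obj₃⟩) ⊗ₘ
        F.map (⟨Triangle.π₁.mapIso e⟩ : (⟨Δ.obj₁⟩ : Core T) ⟶ ⟨Δ'.obj₁⟩)) ≫ add Δ' hΔ' =
      add Δ hΔ ≫ F.map (⟨Triangle.π₂.mapIso e⟩ : (⟨Δ.obj₂⟩ : Core T) ⟶ ⟨Δ'.obj₂⟩)
  /-- Commutativity axiom. -/
  commutativity : ∀ x y : T,
    (β_ (F.obj ⟨x⟩) (F.obj ⟨y⟩)).hom ≫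
        add (Triangle.mk (biprod.inl : x ⟶ x ⊞ y) biprod.snd 0)
          (binaryBiproductTriangle_distinguished x y) =
      add (Triangle.mk (biprod.inr : y ⟶ x ⊞ y) biprod.fst 0)
        (biprod_inr_fst_distinguished x y)
  /-- Octahedron axiom, for an octahedron on `x ⟶ y ⟶ z` with cones `z'`, `x'`, `y'` of
  `x ⟶ y`, `y ⟶ z`, `x ⟶ z` respectively. -/
  octahedron : ∀ {x y z z' x' y' : T} {f : x ⟶ y} {g : y ⟶ z} {k : x ⟶ z}
    (comm : f ≫ g = k)
    {p₁ : y ⟶ z'} {q₁ : z' ⟶ x⟦(1 : ℤ)⟧} (h₁ : Triangle.mk f p₁ q₁ ∈ distTriang T)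
    {p₃ : z ⟶ x'} {q₃ : x' ⟶ y⟦(1 : ℤ)⟧} (h₃ : Triangle.mk g p₃ q₃ ∈ distTriang T)
    {p₂ : z ⟶ y'} {q₂ : y' ⟶ x⟦(1 : ℤ)⟧} (h₂ : Triangle.mk k p₂ q₂ ∈ distTriang T)
    (O : Triangulated.Octahedron comm h₁ h₃ h₂),
    (add (Triangle.mk O.m₁ O.m₃ (q₃ ≫ p₁⟦(1 : ℤ)⟧')) O.mem ▷ F.obj ⟨x⟩) ≫
        add (Triangle.mk k p₂ q₂) h₂ =
      (α_ (F.obj ⟨x'⟩) (F.obj ⟨z'⟩) (F.obj ⟨x⟩)).hom ≫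
        (F.obj ⟨x'⟩ ◁ add (Triangle.mk f p₁ q₁) h₁) ≫ add (Triangle.mk g p₃ q₃) h₃

variable (T P) in
/-- A determinant functor from the triangulated category `T` to `P`. -/
structure DetFunctor where
  /-- The underlying functor on the category of isomorphisms of `T`. -/
  toFunctor : Core T ⥤ P
  /-- The additivity data. -/
  additivity : Additivity toFunctor

/-- A factorization `(f, α)` of the determinant functor `D` through the determinant functor `det`:
a morphism of Picard groupoids `f` (a symmetric monoidal functor) and a natural transformation
`α : f ∘ det ⟹ D` compatible with the additivity data. -/
structure DetFactorization {V : Type w} [Category.{w} V] [MonoidalCategory V]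
    [SymmetricCategory V] (det : DetFunctor T V) (D : DetFunctor T P) where
  /-- The functor `f`. -/
  functor : V ⥤ P
  /-- The symmetric monoidal structure of `f`. -/
  braided : functor.Braided
  /-- The natural transformation `α`. -/
  trans : det.toFunctor ⋙ functor ⟶ D.toFunctor
  compatible : ∀ (Δ : Triangle T) (hΔ : Δ ∈ distTriang T),
    Functor.LaxMonoidal.μ functor (det.toFunctor.obj ⟨Δ.obj₃⟩) (det.toFunctor.obj ⟨Δ.obj₁⟩) ≫
        functor.map (det.additivity.add Δ hΔ) ≫ trans.app ⟨Δ.obj₂⟩ =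
      (trans.app ⟨Δ.obj₃⟩ ⊗ₘ trans.app ⟨Δ.obj₁⟩) ≫ D.additivity.add Δ hΔ

attribute [instance] DetFactorization.braided

/-- `det : T ⟶ V` is a universal determinant functor: every determinant functor on `T` with values
in a Picard groupoid factors through `det`, uniquely up to a unique monoidal transformation. -/
def IsUniversal {V : Type w} [Category.{w} V] [MonoidalCategory V] [SymmetricCategory V]
    (det : DetFunctor T V) : Prop :=
  ∀ (P : Type w) [Category.{w} P] [MonoidalCategory P] [SymmetricCategory P] [PicardGroupoid P]
    (D : DetFunctor T P),
    ∃ p : DetFactorization det D, ∀ q : DetFactorization det D,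
      ∃! β : p.functor ⟶ q.functor, NatTrans.IsMonoidal β ∧
        Functor.whiskerLeft det.toFunctor β ≫ q.trans = p.trans

end OneVariable

/-! ## Multi-determinant functors -/

section MultiDet

variable {ι : Type*} [DecidableEq ι] (T : ι → Type u) [∀ i, Category.{v} (T i)]
  [∀ i, HasZeroObject (T i)] [∀ i, HasShift (T i) ℤ] [∀ i, Preadditive (T i)]
  [∀ i, ∀ n : ℤ, (shiftFunctor (T i) n).Additive] [∀ i, Pretriangulated (T i)]
  (P : Type u') [Category.{v'} P] [MonoidalCategory P] [SymmetricCategory P]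

/-- A multi-determinant functor on the triangulated categories `T i` with values in `P`. -/
structure MultiDet where
  /-- The underlying functor of several variables on the categories of isomorphisms. -/
  toFunctor : (∀ i, Core (T i)) ⥤ P
  /-- It is a determinant functor in each variable. -/
  additivity : ∀ (i : ι) (b : ∀ j, Core (T j)), Additivity (slice i b ⋙ toFunctor)
  /-- Triangle-Function axiom: the additivity data of the variable `i` are natural with respect to
  the isomorphisms `φ j : b j ⟶ b' j` of the other variables `j`. In particular these data depend
  only on the values `b j` of the other variables, and not on the discarded value `b i`. -/
  triangle_function : ∀ (i : ι) (b b' : ∀ j, Core (T j)) (φ : ∀ j, j ≠ i → (b j ⟶ b' j))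
    (Δ : Triangle (T i)) (hΔ : Δ ∈ distTriang (T i)),
    (toFunctor.map (updateHom i φ (𝟙 (⟨Δ.obj₃⟩ : Core (T i)))) ⊗ₘ
        toFunctor.map (updateHom i φ (𝟙 (⟨Δ.obj₁⟩ : Core (T i))))) ≫
        (additivity i b').add Δ hΔ =
      (additivity i b).add Δ hΔ ≫ toFunctor.map (updateHom i φ (𝟙 (⟨Δ.obj₂⟩ : Core (T i))))
  /-- Two Triangles axiom: for `x ⟶ y ⟶ z ⟶ Σ x` in the variable `i` and
  `x' ⟶ y' ⟶ z' ⟶ Σ x'` in the variable `j`, adding first in the variable `i` and then in `j` is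
  the same as adding first in the variable `j` and then in `i`, after the canonical isomorphism
  `(a + b) + (c + d) ⟶ (a + c) + (b + d)`. -/
  two_triangles : ∀ (i j : ι) (h : i ≠ j) (b : ∀ k, Core (T k))
    (Δ : Triangle (T i)) (hΔ : Δ ∈ distTriang (T i))
    (Δ' : Triangle (T j)) (hΔ' : Δ' ∈ distTriang (T j)),
    let x : Core (T i) := ⟨Δ.obj₁⟩
    let y : Core (T i) := ⟨Δ.obj₂⟩
    let z : Core (T i) := ⟨Δ.obj₃⟩
    let x' : Core (T j) := ⟨Δ'.obj₁⟩
    let y' : Core (T j) := ⟨Δ'.obj₂⟩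
    let z' : Core (T j) := ⟨Δ'.obj₃⟩
    let F := toFunctor
    /- the sum in the variable `i`, the variable `j` being fixed at `t` -/
    let addI (t : Core (T j)) :
        F.obj (Function.update (Function.update b i z) j t) ⊗
            F.obj (Function.update (Function.update b i x) j t) ⟶
          F.obj (Function.update (Function.update b i y) j t) :=
      (swapHom F h b z t ⊗ₘ swapHom F h b x t) ≫
        (additivity i (Function.update b j t)).add Δ hΔ ≫ swapHom F h.symm b t y
    /- the sum in the variable `j`, the variable `i` being fixed at `s` -/
    let addJ (s : Core (T i)) :
        F.obj (Function.update (Function.update b i s) j z') ⊗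
            F.obj (Function.update (Function.update b i s) j x') ⟶
          F.obj (Function.update (Function.update b i s) j y') :=
      (additivity j (Function.update b i s)).add Δ' hΔ'
    (addI z' ⊗ₘ addI x') ≫ addJ y = tensorμ _ _ _ _ ≫ (addJ z ⊗ₘ addJ x) ≫ addI y'

end MultiDet

/-! ## Multiexact functors of Picard groupoids -/

section MultiExact

variable {ι : Type*} [DecidableEq ι] (V : ι → Type u) [∀ i, Category.{v} (V i)]
  [∀ i, MonoidalCategory (V i)] [∀ i, SymmetricCategory (V i)]
  (P : Type u') [Category.{v'} P] [MonoidalCategory P] [SymmetricCategory P]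

/-- A functor of several variables with a symmetric monoidal structure in each variable. -/
structure SeparatelyMonoidal where
  /-- The underlying functor of several variables. -/
  toFunctor : (∀ i, V i) ⥤ P
  /-- The symmetric monoidal structure in each variable. -/
  braided : ∀ (i : ι) (b : ∀ j, V j), (slice i b ⋙ toFunctor).Braided

attribute [instance] SeparatelyMonoidal.braided

variable {V P}

/-- The monoidality constraint `F(…, x, …) + F(…, y, …) ⟶ F(…, x + y, …)` in the variable `i`. -/
def SeparatelyMonoidal.sum (F : SeparatelyMonoidal V P) (i : ι) (b : ∀ j, V j) (x y : V i) :
    F.toFunctor.obj (Function.update b i x) ⊗ F.toFunctor.obj (Function.update b i y) ⟶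
      F.toFunctor.obj (Function.update b i (x ⊗ y)) :=
  Functor.LaxMonoidal.μ (slice i b ⋙ F.toFunctor) x y

/-- In the situation of `SeparatelyMonoidal.sum`, the variable `j` being fixed at `t` after the
substitution in the variable `i`. -/
def SeparatelyMonoidal.sum' (F : SeparatelyMonoidal V P) {i j : ι} (h : i ≠ j) (b : ∀ j, V j)
    (x y : V i) (t : V j) :
    F.toFunctor.obj (Function.update (Function.update b i x) j t) ⊗
        F.toFunctor.obj (Function.update (Function.update b i y) j t) ⟶
      F.toFunctor.obj (Function.update (Function.update b i (x ⊗ y)) j t) :=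
  (swapHom F.toFunctor h b x t ⊗ₘ swapHom F.toFunctor h b y t) ≫
    F.sum i (Function.update b j t) x y ≫ swapHom F.toFunctor h.symm b t (x ⊗ y)

variable (V P)

/-- A multiexact functor of Picard groupoids, that is, a multimorphism of the multicategory of
Picard groupoids. -/
structure MultiExact extends SeparatelyMonoidal V P where
  /-- The monoidality constraint of the variable `i` is natural in the other variables. -/
  sum_natural : ∀ (i : ι) (b b' : ∀ j, V j) (φ : ∀ j, j ≠ i → (b j ⟶ b' j)) (x y : V i),
    (toFunctor.map (updateHom i φ (𝟙 x)) ⊗ₘ toFunctor.map (updateHom i φ (𝟙 y))) ≫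
        toSeparatelyMonoidal.sum i b' x y =
      toSeparatelyMonoidal.sum i b x y ≫ toFunctor.map (updateHom i φ (𝟙 (x ⊗ y)))
  /-- The constraints of two distinct variables are compatible: the two isomorphisms between
  `F(x + y, s + t)` and the sum of the four objects `F(x, s)`, `F(x, t)`, `F(y, s)`, `F(y, t)`
  agree up to `(a + b) + (c + d) ⟶ (a + c) + (b + d)`. -/
  interchange : ∀ (i j : ι) (h : i ≠ j) (b : ∀ k, V k) (x y : V i) (s t : V j),
    (toSeparatelyMonoidal.sum j (Function.update b i x) s t ⊗ₘ
        toSeparatelyMonoidal.sum j (Function.update b i y) s t) ≫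
        toSeparatelyMonoidal.sum' h b x y (s ⊗ t) =
      tensorμ _ _ _ _ ≫
        (toSeparatelyMonoidal.sum' h b x y s ⊗ₘ toSeparatelyMonoidal.sum' h b x y t) ≫
        toSeparatelyMonoidal.sum j (Function.update b i (x ⊗ y)) s t

variable {V P}

/-- The 2-cells of the multicategory of Picard groupoids: natural transformations which are
monoidal in each variable. -/
def IsTwoCell (F G : MultiExact V P) (γ : F.toFunctor ⟶ G.toFunctor) : Prop :=
  ∀ (i : ι) (b : ∀ j, V j), NatTrans.IsMonoidal
    (F₁ := slice i b ⋙ F.toFunctor) (F₂ := slice i b ⋙ G.toFunctor)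
    (Functor.whiskerLeft (slice i b) γ)

end MultiExact

/-! ## Factorization of multi-determinants through products of determinants -/

section Factorization

variable {ι : Type*} [DecidableEq ι] {T : ι → Type u} [∀ i, Category.{v} (T i)]
  [∀ i, HasZeroObject (T i)] [∀ i, HasShift (T i) ℤ] [∀ i, Preadditive (T i)]
  [∀ i, ∀ n : ℤ, (shiftFunctor (T i) n).Additive] [∀ i, Pretriangulated (T i)]
  {V : ι → Type w} [∀ i, Category.{w} (V i)]
  [∀ i, MonoidalCategory (V i)] [∀ i, SymmetricCategory (V i)]
  {P : Type u'} [Category.{v'} P] [MonoidalCategory P] [SymmetricCategory P]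

/-- The product of a family of determinant functors. -/
def prodDet (det : ∀ i, DetFunctor (T i) (V i)) : (∀ i, Core (T i)) ⥤ ∀ i, V i :=
  Functor.pi fun i => (det i).toFunctor

theorem prodDet_update (det : ∀ i, DetFunctor (T i) (V i)) (i : ι) (b : ∀ j, Core (T j))
    (x : Core (T i)) :
    (prodDet det).obj (Function.update b i x) =
      Function.update ((prodDet det).obj b) i ((det i).toFunctor.obj x) := by
  funext j
  by_cases h : j = i
  · subst h
    simp [prodDet]
  · simp [prodDet, h]

/-- The identification of `d(det(…, x, …))`, `x` being substituted in the variable `i`, with `d`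
evaluated at `det x` in the variable `i`. -/
def prodDetIso (det : ∀ i, DetFunctor (T i) (V i)) (d : (∀ i, V i) ⥤ P) (i : ι)
    (b : ∀ j, Core (T j)) (x : Core (T i)) :
    d.obj ((prodDet det).obj (Function.update b i x)) ≅
      d.obj (Function.update ((prodDet det).obj b) i ((det i).toFunctor.obj x)) :=
  d.mapIso (eqToIso (prodDet_update det i b x))

/-- The additivity data of `d ∘ det` in the variable `i`: the composite
`d(det z) + d(det x) ⟶ d(det z + det x) ⟶ d(det y)`. -/
def compAdd (det : ∀ i, DetFunctor (T i) (V i)) (d : MultiExact V P) (i : ι)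
    (b : ∀ j, Core (T j)) (Δ : Triangle (T i)) (hΔ : Δ ∈ distTriang (T i)) :
    d.toFunctor.obj ((prodDet det).obj (Function.update b i ⟨Δ.obj₃⟩)) ⊗
        d.toFunctor.obj ((prodDet det).obj (Function.update b i ⟨Δ.obj₁⟩)) ⟶
      d.toFunctor.obj ((prodDet det).obj (Function.update b i ⟨Δ.obj₂⟩)) :=
  ((prodDetIso det d.toFunctor i b ⟨Δ.obj₃⟩).hom ⊗ₘ
      (prodDetIso det d.toFunctor i b ⟨Δ.obj₁⟩).hom) ≫
    d.sum i ((prodDet det).obj b) _ _ ≫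
    d.toFunctor.map ((slice i ((prodDet det).obj b)).map ((det i).additivity.add Δ hΔ)) ≫
    (prodDetIso det d.toFunctor i b ⟨Δ.obj₂⟩).inv

/-- A natural transformation `a : d ∘ det ⟹ D` is a morphism of multi-determinant functors, that
is, it is compatible with the additivity data in each variable. -/
def IsDetMorphism (det : ∀ i, DetFunctor (T i) (V i)) (d : MultiExact V P) (D : MultiDet T P)
    (a : prodDet det ⋙ d.toFunctor ⟶ D.toFunctor) : Prop :=
  ∀ (i : ι) (b : ∀ j, Core (T j)) (Δ : Triangle (T i)) (hΔ : Δ ∈ distTriang (T i)),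
    compAdd det d i b Δ hΔ ≫ a.app (Function.update b i ⟨Δ.obj₂⟩) =
      (a.app (Function.update b i ⟨Δ.obj₃⟩) ⊗ₘ a.app (Function.update b i ⟨Δ.obj₁⟩)) ≫
        (D.additivity i b).add Δ hΔ

end Factorization

end MultiDeterminant

end

universe u₁ v₁ w₁

noncomputable section

namespace MultiDeterminant

open Functor.LaxMonoidal

/-! ### The exchange of the two inner terms in a symmetric monoidal category. -/

section Coherence

variable {P : Type*} [Category* P] [MonoidalCategory P] [SymmetricCategory P]

/-! Determinant functors, symmetric monoidal functors and their versions in several variables are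
all functors with additions `F quo + F sub ⟶ F mid` that obey equations between formal composites. A
`Signature` records the extensions and the equations, and `Model S P` is the category of such
functors with values in a symmetric monoidal category `P`. Since `P` is symmetric, models can be
added pointwise, so `Model S P` is again symmetric monoidal and can itself serve as a target.

In this language, composition with `det` is a restriction functor `Model.pull` from models of
`monSignature V` to models of `detSignature T`, and universality makes it an equivalence for every
Picard groupoid target of the universe concerned (`IsUniversal.isEquivalence`). Units are left out
of the signature: translations of a Picard groupoid are fully faithful, so the unit constraint can
be reconstructed, and a transformation compatible with sums respects units (`isMonoidal_of_tensor`).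

A model in several variables is a model in the first variable whose values are models in the other
ones. Its additions in the first variable are morphisms of models precisely because of naturality in
the other variables and the interchange law. This gives an equivalence `Model.curry`, under which
restriction in all variables becomes restriction in the first variable followed by restriction in
the others.

The second step is handled by induction and by composition with a braided equivalence
(`Model.post`). In the first step the target is a category of models, to which the universal
property is not applied directly. Exchanging the two variables (`Model.swap`) turns restriction of
the outer variable into composition with the restriction functor for the target `P`, which is an
equivalence (`Model.isEquivalence_pull_model`). Hence neither a Picard property nor a universe
condition is needed for the intermediate targets.

So restriction along the product of the `det i` is an equivalence
(`Model.exists_isEquivalence_pull_piMap`). Essential surjectivity produces `(d, a)`. Full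
faithfulness, together with the invertibility of all morphisms of `P`, produces the 2-cell to any
other pair and its uniqueness. -/

theorem tensorμ_braiding (A B C D : P) :
    tensorμ A B C D ≫ (β_ (A ⊗ C) (B ⊗ D)).hom =
      ((β_ A B).hom ⊗ₘ (β_ C D).hom) ≫ tensorμ B A D C := by
  simp [tensorμ, SymmetricCategory.braiding_swap_eq_inv_braiding C B]
  rw [MonoidalCategory.tensorHom_def]
  monoidal

-- The exchange is an involution because the braiding is symmetric. This is why the interchange law
-- of two variables can be read in either order.
@[simp]
theorem tensorμ_tensorμ (A B C D : P) : tensorμ A B C D ≫ tensorμ A C B D = 𝟙 _ := by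
  rw [← tensorμ_tensorδ]
  simp [tensorμ, tensorδ, SymmetricCategory.braiding_swap_eq_inv_braiding B C]

@[simp]
theorem tensorμ_tensorμ_assoc (A B C D : P) {X : P} (f : (A ⊗ B) ⊗ (C ⊗ D) ⟶ X) :
    tensorμ A B C D ≫ tensorμ A C B D ≫ f = f := by
  rw [← Category.assoc, tensorμ_tensorμ, Category.id_comp]

instance (A B C D : P) : IsIso (tensorμ A B C D) :=
  ⟨tensorδ A B C D, tensorμ_tensorδ _ _ _ _, tensorδ_tensorμ _ _ _ _⟩

/-- Obtained from `tensorμ_braiding` by the involution property. It expresses that the sum functor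
of two variables respects the braiding, which is needed for the commutativity laws of a pointwise
sum. -/
theorem braiding_tensorμ (A B C D : P) :
    (β_ (A ⊗ B) (C ⊗ D)).hom ≫ tensorμ C D A B =
      tensorμ A B C D ≫ ((β_ A C).hom ⊗ₘ (β_ B D).hom) := by
  rw [← cancel_mono (tensorμ C A D B), Category.assoc, tensorμ_tensorμ, Category.assoc,
    ← tensorμ_braiding, tensorμ_tensorμ_assoc, Category.comp_id]

end Coherence

/-! ## Signatures of partial additions and their models -/

/-- Formal sums of objects. -/
inductive Word (C : Type u) : Type u
  | of : C → Word C
  | sum : Word C → Word C → Word C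

/-- A class of formal extensions `sub ⟶ mid ⟶ quo` of objects of `C`. -/
structure Extensions (C : Type u) where
  Ext : Type w
  sub : Ext → C
  mid : Ext → C
  quo : Ext → C

/-- Formal composites of morphisms of `C`, of additions `quo e + sub e ⟶ mid e`, and of the
constraints of a symmetric monoidal category. -/
inductive Expr {C : Type u} [Category.{v} C] (A : Extensions.{u, w} C) :
    Word C → Word C → Type (max u v w)
  | id (p : Word C) : Expr A p p
  | comp {p q r : Word C} : Expr A p q → Expr A q r → Expr A p r
  | sum {p q p' q' : Word C} : Expr A p q → Expr A p' q' → Expr A (p.sum p') (q.sum q')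
  | assoc (p q r : Word C) : Expr A ((p.sum q).sum r) (p.sum (q.sum r))
  | assocInv (p q r : Word C) : Expr A (p.sum (q.sum r)) ((p.sum q).sum r)
  | braid (p q : Word C) : Expr A (p.sum q) (q.sum p)
  | hom {x y : C} (f : x ⟶ y) : Expr A (.of x) (.of y)
  | add (e : A.Ext) : Expr A (.sum (.of (A.quo e)) (.of (A.sub e))) (.of (A.mid e))

/-- A signature: a class of extensions, and laws which their additions have to satisfy. -/
structure Signature (C : Type u) [Category.{v} C] extends Extensions.{u, w} C where
  Law : ∀ {p q : Word C}, Expr toExtensions p q → Expr toExtensions p q → Prop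

/-- A functor equipped with an addition for each extension. -/
structure Premodel {C : Type u} [Category.{v} C] (A : Extensions.{u, w} C)
    (P : Type u') [Category.{v'} P] [MonoidalCategory P] where
  functor : C ⥤ P
  add : ∀ e, functor.obj (A.quo e) ⊗ functor.obj (A.sub e) ⟶ functor.obj (A.mid e)

namespace Premodel

variable {C : Type u} [Category.{v} C] {A : Extensions.{u, w} C}
variable {P : Type u'} [Category.{v'} P] [MonoidalCategory P]

/-- The value of a formal sum. -/
def word (F : Premodel A P) : Word C → P
  | .of x => F.functor.obj x
  | .sum p q => F.word p ⊗ F.word q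

/-- Natural transformations compatible with the additions. -/
@[ext]
structure Hom (F G : Premodel A P) where
  app : ∀ x, F.functor.obj x ⟶ G.functor.obj x
  naturality : ∀ {x y : C} (f : x ⟶ y), F.functor.map f ≫ app y = app x ≫ G.functor.map f
  add : ∀ e, F.add e ≫ app (A.mid e) = (app (A.quo e) ⊗ₘ app (A.sub e)) ≫ G.add e

attribute [simp] Hom.naturality

namespace Hom

@[simp]
theorem naturality_assoc {F G : Premodel A P} (φ : Hom F G) {x y : C} (f : x ⟶ y) {z : P}
    (g : G.functor.obj y ⟶ z) :
    F.functor.map f ≫ φ.app y ≫ g = φ.app x ≫ G.functor.map f ≫ g := by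
  rw [← Category.assoc, φ.naturality, Category.assoc]

theorem add_assoc {F G : Premodel A P} (φ : Hom F G) (e : A.Ext) {z : P}
    (g : G.functor.obj (A.mid e) ⟶ z) :
    F.add e ≫ φ.app (A.mid e) ≫ g = (φ.app (A.quo e) ⊗ₘ φ.app (A.sub e)) ≫ G.add e ≫ g := by
  rw [← Category.assoc, φ.add, Category.assoc]

abbrev id (F : Premodel A P) : Hom F F where
  app x := 𝟙 _
  naturality := by simp
  add := by simp

abbrev comp {F G H : Premodel A P} (φ : Hom F G) (ψ : Hom G H) : Hom F H where
  app x := φ.app x ≫ ψ.app x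
  naturality := by simp
  add e := by rw [φ.add_assoc, ψ.add, tensorHom_comp_tensorHom_assoc]

/-- The inverse of a componentwise invertible morphism. -/
def inv {F G : Premodel A P} (φ : Hom F G) [∀ x, IsIso (φ.app x)] : Hom G F where
  app x := CategoryTheory.inv (φ.app x)
  naturality f := by rw [IsIso.comp_inv_eq, Category.assoc, naturality, IsIso.inv_hom_id_assoc]
  add e := by
    rw [IsIso.comp_inv_eq, Category.assoc, add, tensorHom_comp_tensorHom_assoc]
    simp

/-- The value of a morphism at a formal sum. -/
def word {F G : Premodel A P} (φ : Hom F G) : ∀ p : Word C, F.word p ⟶ G.word p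
  | .of x => φ.app x
  | .sum p q => φ.word p ⊗ₘ φ.word q

instance {F G : Premodel A P} (φ : Hom F G) [∀ x, IsIso (φ.app x)] (p : Word C) :
    IsIso (φ.word p) := by
  induction p with
  | of x => exact ‹∀ x, IsIso (φ.app x)› x
  | sum p q hp hq => exact inferInstanceAs (IsIso (φ.word p ⊗ₘ φ.word q))

end Hom

section Symmetric

variable [SymmetricCategory P]

/-- The value of a formal composite. -/
def expr (F : Premodel A P) : ∀ {p q : Word C}, Expr A p q → (F.word p ⟶ F.word q)
  | _, _, .id p => 𝟙 _
  | _, _, .comp f g => F.expr f ≫ F.expr g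
  | _, _, .sum f g => F.expr f ⊗ₘ F.expr g
  | _, _, .assoc p q r => (α_ _ _ _).hom
  | _, _, .assocInv p q r => (α_ _ _ _).inv
  | _, _, .braid p q => (β_ _ _).hom
  | _, _, .hom f => F.functor.map f
  | _, _, .add e => F.add e

/-- Every generator of `Expr` is natural: the constraints in `P`, the images of morphisms and the
additions by the definition of `Hom`. Laws can therefore be transported along componentwise
isomorphisms without inspecting them. -/
theorem Hom.expr {F G : Premodel A P} (φ : Hom F G) {p q : Word C} (m : Expr A p q) :
    F.expr m ≫ φ.word q = φ.word p ≫ G.expr m := by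
  induction m with
  | id p => simp [Premodel.expr]
  | comp f g hf hg => simp [Premodel.expr, hg, reassoc_of% hf]
  | sum f g hf hg =>
    exact (tensorHom_comp_tensorHom _ _ _ _).trans
      ((congrArg₂ _ hf hg).trans (tensorHom_comp_tensorHom _ _ _ _).symm)
  | assoc p q r => exact (associator_naturality _ _ _).symm
  | assocInv p q r => exact (associator_inv_naturality _ _ _).symm
  | braid p q => exact (BraidedCategory.braiding_naturality _ _).symm
  | hom f => exact φ.naturality f
  | add e => exact φ.add e

end Symmetric

end Premodel

end MultiDeterminant

end

noncomputable section

namespace MultiDeterminant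

open Functor.LaxMonoidal

section

variable {P : Type*} [Category* P] [MonoidalCategory P]

theorem tensorHom_comp_right {X Y X' Y' Z' : P} (f : X ⟶ Y) (g : X' ⟶ Y') (h : Y' ⟶ Z') :
    f ⊗ₘ (g ≫ h) = (f ⊗ₘ g) ≫ Y ◁ h := by
  rw [← id_tensorHom, tensorHom_comp_tensorHom, Category.comp_id]

theorem tensorHom_comp_left {X Y X' Y' Z : P} (f : X ⟶ Y) (g : X' ⟶ Y') (h : Y ⟶ Z) :
    (f ≫ h) ⊗ₘ g = (f ⊗ₘ g) ≫ h ▷ Y' := by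
  rw [← tensorHom_id, tensorHom_comp_tensorHom, Category.comp_id]

theorem comp_tensorHom_left {X Y Z X' Y' : P} (f : X ⟶ Y) (g : Y ⟶ Z) (h : X' ⟶ Y') :
    (f ≫ g) ⊗ₘ h = f ▷ X' ≫ (g ⊗ₘ h) := by
  rw [← tensorHom_id, tensorHom_comp_tensorHom, Category.id_comp]

theorem comp_tensorHom_right {X Y X' Y' Z' : P} (f : X ⟶ Y) (g : X' ⟶ Y') (h : Y' ⟶ Z') :
    f ⊗ₘ (g ≫ h) = X ◁ g ≫ (f ⊗ₘ h) := by
  rw [← id_tensorHom, tensorHom_comp_tensorHom, Category.id_comp]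

end

/-! ### Stability of laws under isomorphisms, braided functors and pointwise sums. -/

namespace Premodel

variable {C : Type u} [Category.{v} C]

section Satisfies

variable {S : Signature.{u, v, w} C}
variable {P : Type u'} [Category.{v'} P] [MonoidalCategory P] [SymmetricCategory P]

variable (S) in
/-- The premodel `F` satisfies the laws of the signature `S`. -/
def Satisfies (F : Premodel S.toExtensions P) : Prop :=
  ∀ ⦃p q : Word C⦄ (m m' : Expr S.toExtensions p q), S.Law m m' → F.expr m = F.expr m'

theorem Satisfies.of_hom {F G : Premodel S.toExtensions P} (hF : Satisfies S F) (φ : Hom F G)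
    (_ : ∀ x, IsIso (φ.app x)) : Satisfies S G := fun p q m m' h => by
  rw [← cancel_epi (φ.word p), ← φ.expr, ← φ.expr, hF m m' h]

theorem Satisfies.of_hom' {F G : Premodel S.toExtensions P} (hG : Satisfies S G) (φ : Hom F G)
    (_ : ∀ x, IsIso (φ.app x)) : Satisfies S F := fun p q m m' h => by
  rw [← cancel_mono (φ.word q), φ.expr, φ.expr, hG m m' h]

/-- Used when two constructions give additions that differ only by composites with identities. -/
theorem Satisfies.of_add_eq {F : C ⥤ P}
    {a a' : ∀ e, F.obj (S.quo e) ⊗ F.obj (S.sub e) ⟶ F.obj (S.mid e)}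
    (h : Satisfies S ⟨F, a⟩) (ha : ∀ e, a' e = a e) : Satisfies S ⟨F, a'⟩ := by
  rwa [funext ha]

/-- A word in `C` forces `C` to be nonempty. -/
theorem Satisfies.of_nonempty {F : Premodel S.toExtensions P} (h : Nonempty C → Satisfies S F) :
    Satisfies S F := fun p q m m' hm => by
  have : ∀ p : Word C, Nonempty C := fun p => by
    induction p with
    | of x => exact ⟨x⟩
    | sum _ _ h _ => exact h
  exact h (this p) m m' hm

end Satisfies

section Post

variable {A : Extensions.{u, w} C}
variable {P : Type u'} [Category.{v'} P] [MonoidalCategory P]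
variable {Q : Type*} [Category* Q] [MonoidalCategory Q]

/-- The image of a premodel by a monoidal functor. -/
abbrev post (H : P ⥤ Q) [H.LaxMonoidal] (F : Premodel A P) : Premodel A Q where
  functor := F.functor ⋙ H
  add e := μ H _ _ ≫ H.map (F.add e)

/-- The comparison of the value of a word in `post H F` with the image of its value in `F`. -/
def postWord (H : P ⥤ Q) [H.LaxMonoidal] (F : Premodel A P) :
    ∀ p : Word C, (post H F).word p ⟶ H.obj (F.word p)
  | .of _ => 𝟙 _
  | .sum p q => (postWord H F p ⊗ₘ postWord H F q) ≫ μ H _ _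

instance (H : P ⥤ Q) [H.Monoidal] (F : Premodel A P) (p : Word C) : IsIso (postWord H F p) := by
  induction p with
  | of x => exact inferInstanceAs (IsIso (𝟙 _))
  | sum p q hp hq => exact inferInstanceAs (IsIso ((postWord H F p ⊗ₘ postWord H F q) ≫ μ H _ _))

/-- For each generator this is one of the coherence axioms of `H`. Words contain no units, so the
unit axioms play no role. -/
theorem post_expr [SymmetricCategory P] [SymmetricCategory Q] (H : P ⥤ Q) [H.LaxBraided]
    (F : Premodel A P) {p q : Word C} (m : Expr A p q) :
    (post H F).expr m ≫ postWord H F q = postWord H F p ≫ H.map (F.expr m) := by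
  induction m with
  | id p => simp [Premodel.expr]
  | comp f g hf hg => simp [Premodel.expr, hg, reassoc_of% hf]
  | sum f g hf hg =>
    change (_ ⊗ₘ _) ≫ (_ ⊗ₘ _) ≫ μ H _ _ = ((_ ⊗ₘ _) ≫ μ H _ _) ≫ H.map (_ ⊗ₘ _)
    rw [tensorHom_comp_tensorHom_assoc, hf, hg, Category.assoc, ← μ_natural,
      tensorHom_comp_tensorHom_assoc]
  | assoc p q r =>
    change (α_ _ _ _).hom ≫ (_ ⊗ₘ ((_ ⊗ₘ _) ≫ μ H _ _)) ≫ μ H _ _ =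
      ((((_ ⊗ₘ _) ≫ μ H _ _) ⊗ₘ _) ≫ μ H _ _) ≫ H.map (α_ _ _ _).hom
    rw [tensorHom_comp_right, tensorHom_comp_left]
    simp
  | assocInv p q r =>
    change (α_ _ _ _).inv ≫ (((_ ⊗ₘ _) ≫ μ H _ _) ⊗ₘ _) ≫ μ H _ _ =
      ((_ ⊗ₘ ((_ ⊗ₘ _) ≫ μ H _ _)) ≫ μ H _ _) ≫ H.map (α_ _ _ _).inv
    rw [tensorHom_comp_right, tensorHom_comp_left]
    simp
  | braid p q =>
    change (β_ _ _).hom ≫ (_ ⊗ₘ _) ≫ μ H _ _ = ((_ ⊗ₘ _) ≫ μ H _ _) ≫ H.map (β_ _ _).hom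
    simp [Functor.LaxBraided.braided]
  | hom f => exact (Category.comp_id _).trans (Category.id_comp _).symm
  | add e =>
    change (μ H _ _ ≫ H.map (F.add e)) ≫ 𝟙 _ = ((𝟙 _ ⊗ₘ 𝟙 _) ≫ μ H _ _) ≫ H.map (F.add e)
    simp

variable {S : Signature.{u, v, w} C} [SymmetricCategory P] [SymmetricCategory Q]

theorem Satisfies.post {F : Premodel S.toExtensions P} (hF : Satisfies S F) (H : P ⥤ Q)
    [H.Braided] : Satisfies S (F.post H) := fun p q m m' h => by
  rw [← cancel_mono (postWord H F q), post_expr, post_expr, hF m m' h]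

/-- Laws can be tested after jointly faithful braided functors. -/
theorem satisfies_of_post {F : Premodel S.toExtensions P} {ι : Type*} (H : ι → (P ⥤ Q))
    [∀ i, (H i).Braided]
    (hH : ∀ {x y : P} (f g : x ⟶ y), (∀ i, (H i).map f = (H i).map g) → f = g)
    (hF : ∀ i, Satisfies S (F.post (H i))) : Satisfies S F := fun p q m m' h =>
  hH _ _ fun i => by
    rw [← cancel_epi (postWord (H i) F p), ← post_expr, ← post_expr, hF i m m' h]

end Post

section Tensor

variable {A : Extensions.{u, w} C}
variable {P : Type u'} [Category.{v'} P] [MonoidalCategory P] [SymmetricCategory P]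

/-- The pointwise sum of two premodels. -/
abbrev tensor (F G : Premodel A P) : Premodel A P where
  functor :=
    { obj := fun x => F.functor.obj x ⊗ G.functor.obj x
      map := fun f => F.functor.map f ⊗ₘ G.functor.map f }
  add e := tensorμ _ _ _ _ ≫ (F.add e ⊗ₘ G.add e)

variable (A P) in
/-- The constant premodel with value the unit. -/
abbrev unit : Premodel A P where
  functor := (Functor.const C).obj (𝟙_ P)
  add _ := (λ_ (𝟙_ P)).hom

/-- The value of a word in a pointwise sum. -/
def tensorWord (F G : Premodel A P) : ∀ p : Word C, (F.tensor G).word p ⟶ F.word p ⊗ G.word p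
  | .of _ => 𝟙 _
  | .sum p q => (F.tensorWord G p ⊗ₘ F.tensorWord G q) ≫ tensorμ _ _ _ _

instance (F G : Premodel A P) (p : Word C) : IsIso (tensorWord F G p) := by
  induction p with
  | of x => exact inferInstanceAs (IsIso (𝟙 _))
  | sum p q hp hq =>
    exact inferInstanceAs (IsIso ((F.tensorWord G p ⊗ₘ F.tensorWord G q) ≫ tensorμ _ _ _ _))

/-- The reason is that the sum `P × P ⥤ P` is a symmetric monoidal functor with constraint
`tensorμ`; the inductive cases are its naturality, associativity and symmetry. -/
theorem tensor_expr (F G : Premodel A P) {p q : Word C} (m : Expr A p q) :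
    (F.tensor G).expr m ≫ tensorWord F G q = tensorWord F G p ≫ (F.expr m ⊗ₘ G.expr m) := by
  induction m with
  | id p => simp [Premodel.expr]
  | comp f g hf hg => simp [Premodel.expr, hg, reassoc_of% hf]
  | sum f g hf hg =>
    change (_ ⊗ₘ _) ≫ (_ ⊗ₘ _) ≫ tensorμ _ _ _ _ =
      ((_ ⊗ₘ _) ≫ tensorμ _ _ _ _) ≫ ((_ ⊗ₘ _) ⊗ₘ (_ ⊗ₘ _))
    rw [tensorHom_comp_tensorHom_assoc, hf, hg, Category.assoc, ← tensorμ_natural,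
      tensorHom_comp_tensorHom_assoc]
  | assoc p q r =>
    change (α_ _ _ _).hom ≫ (_ ⊗ₘ ((_ ⊗ₘ _) ≫ tensorμ _ _ _ _)) ≫ tensorμ _ _ _ _ =
      ((((_ ⊗ₘ _) ≫ tensorμ _ _ _ _) ⊗ₘ _) ≫ tensorμ _ _ _ _) ≫
        ((α_ _ _ _).hom ⊗ₘ (α_ _ _ _).hom)
    rw [tensorHom_comp_right, tensorHom_comp_left]
    simp only [Category.assoc, tensor_associativity,
      associator_naturality_assoc]
  | assocInv p q r =>
    change (α_ _ _ _).inv ≫ (((_ ⊗ₘ _) ≫ tensorμ _ _ _ _) ⊗ₘ _) ≫ tensorμ _ _ _ _ =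
      ((_ ⊗ₘ ((_ ⊗ₘ _) ≫ tensorμ _ _ _ _)) ≫ tensorμ _ _ _ _) ≫
        ((α_ _ _ _).inv ⊗ₘ (α_ _ _ _).inv)
    rw [Iso.inv_comp_eq, ← cancel_mono ((α_ _ _ _).hom ⊗ₘ (α_ _ _ _).hom)]
    rw [tensorHom_comp_right, tensorHom_comp_left]
    simp only [Category.assoc, tensorHom_id, tensor_associativity,
      associator_naturality_assoc, tensorHom_comp_tensorHom, Iso.inv_hom_id, id_whiskerRight,
      Category.comp_id]
  | braid p q =>
    change (β_ _ _).hom ≫ (_ ⊗ₘ _) ≫ tensorμ _ _ _ _ =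
      ((_ ⊗ₘ _) ≫ tensorμ _ _ _ _) ≫ ((β_ _ _).hom ⊗ₘ (β_ _ _).hom)
    rw [← BraidedCategory.braiding_naturality_assoc, braiding_tensorμ, Category.assoc]
  | hom f => exact (Category.comp_id _).trans (Category.id_comp _).symm
  | add e =>
    change (tensorμ _ _ _ _ ≫ (_ ⊗ₘ _)) ≫ 𝟙 _ =
      ((𝟙 _ ⊗ₘ 𝟙 _) ≫ tensorμ _ _ _ _) ≫ (F.add e ⊗ₘ G.add e)
    simp

variable (A P) in
/-- The value of a word in the unit premodel. -/
def unitWord : ∀ p : Word C, (unit A P).word p ⟶ 𝟙_ P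
  | .of _ => 𝟙 _
  | .sum p q => (unitWord p ⊗ₘ unitWord q) ≫ (λ_ (𝟙_ P)).hom

instance (p : Word C) : IsIso (unitWord A P p) := by
  induction p with
  | of x => exact inferInstanceAs (IsIso (𝟙 _))
  | sum p q hp hq =>
    exact inferInstanceAs (IsIso ((unitWord A P p ⊗ₘ unitWord A P q) ≫ (λ_ (𝟙_ P)).hom))

/-- All words are identified with the unit compatibly with every generator, so parallel formal
composites have equal values and the unit premodel satisfies any laws whatever. -/
theorem unit_expr {p q : Word C} (m : Expr A p q) :
    (unit A P).expr m ≫ unitWord A P q = unitWord A P p := by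
  have key : ∀ p q r : Word C, (α_ _ _ _).hom ≫
      (unitWord A P p ⊗ₘ ((unitWord A P q ⊗ₘ unitWord A P r) ≫ (λ_ (𝟙_ P)).hom)) ≫
        (λ_ (𝟙_ P)).hom =
      ((((unitWord A P p ⊗ₘ unitWord A P q) ≫ (λ_ (𝟙_ P)).hom) ⊗ₘ unitWord A P r) ≫
        (λ_ (𝟙_ P)).hom) := fun p q r => by
    rw [tensorHom_comp_right, tensorHom_comp_left]
    simp only [Category.assoc]
    rw [← associator_naturality_assoc]
    congr 1
    -- At the unit object the two unitors coincide, so associativity of the addition becomes the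
    -- triangle identity.
    rw [unitors_equal, ← MonoidalCategory.triangle_assoc, unitors_equal]
  induction m with
  | id p => simp [Premodel.expr]
  | comp f g hf hg => simp [Premodel.expr, hg, hf]
  | sum f g hf hg =>
    change (_ ⊗ₘ _) ≫ (_ ⊗ₘ _) ≫ (λ_ _).hom = (_ ⊗ₘ _) ≫ (λ_ _).hom
    rw [tensorHom_comp_tensorHom_assoc, hf, hg]
  | assoc p q r => exact key p q r
  | assocInv p q r => exact (Iso.inv_comp_eq _).2 (key p q r).symm
  | braid p q =>
    change (β_ _ _).hom ≫ (_ ⊗ₘ _) ≫ (λ_ _).hom = (_ ⊗ₘ _) ≫ (λ_ _).hom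
    rw [← BraidedCategory.braiding_naturality_assoc, braiding_leftUnitor, unitors_equal]
  | hom f => exact Category.comp_id _
  | add e =>
    change (λ_ _).hom ≫ 𝟙 _ = (𝟙 _ ⊗ₘ 𝟙 _) ≫ (λ_ _).hom
    simp

variable {S : Signature.{u, v, w} C}

theorem Satisfies.tensor {F G : Premodel S.toExtensions P} (hF : Satisfies S F)
    (hG : Satisfies S G) : Satisfies S (F.tensor G) := fun p q m m' h => by
  rw [← cancel_mono (tensorWord F G q), tensor_expr, tensor_expr, hF m m' h, hG m m' h]

theorem satisfies_unit : Satisfies S (unit S.toExtensions P) := fun p q m m' _ => by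
  rw [← cancel_mono (unitWord S.toExtensions P q), unit_expr, unit_expr]

end Tensor

end Premodel

end MultiDeterminant

end

noncomputable section

namespace MultiDeterminant

open Functor.LaxMonoidal

/-! ### The symmetric monoidal category of models of a signature. -/

variable {C : Type u} [Category.{v} C]

/-- A model of a signature. -/
structure Model (S : Signature.{u, v, w} C) (P : Type u') [Category.{v'} P] [MonoidalCategory P]
    [SymmetricCategory P] extends Premodel S.toExtensions P where
  satisfies : Premodel.Satisfies S toPremodel

namespace Model

variable {S : Signature.{u, v, w} C}
variable {P : Type u'} [Category.{v'} P] [MonoidalCategory P] [SymmetricCategory P]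

instance : Category (Model S P) where
  Hom F G := F.toPremodel.Hom G.toPremodel
  id F := Premodel.Hom.id F.toPremodel
  comp φ ψ := Premodel.Hom.comp φ ψ
  id_comp _ := Premodel.Hom.ext (funext fun _ => Category.id_comp _)
  comp_id _ := Premodel.Hom.ext (funext fun _ => Category.comp_id _)
  assoc _ _ _ := Premodel.Hom.ext (funext fun _ => Category.assoc _ _ _)

/-- The component of a morphism of models. -/
abbrev app {F G : Model S P} (φ : F ⟶ G) (x : C) : F.functor.obj x ⟶ G.functor.obj x :=
  Premodel.Hom.app φ x

theorem hom_ext {F G : Model S P} {φ ψ : F ⟶ G} (h : ∀ x, app φ x = app ψ x) : φ = ψ :=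
  Premodel.Hom.ext (funext h)

@[simp]
theorem naturality {F G : Model S P} (φ : F ⟶ G) {x y : C} (f : x ⟶ y) :
    F.functor.map f ≫ app φ y = app φ x ≫ G.functor.map f :=
  Premodel.Hom.naturality φ f

theorem add_app {F G : Model S P} (φ : F ⟶ G) (e : S.Ext) :
    F.add e ≫ app φ (S.mid e) = (app φ (S.quo e) ⊗ₘ app φ (S.sub e)) ≫ G.add e :=
  Premodel.Hom.add φ e

/-- Evaluation at an object. -/
abbrev ev (S : Signature.{u, v, w} C) (P : Type u') [Category.{v'} P] [MonoidalCategory P]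
    [SymmetricCategory P] (x : C) : Model S P ⥤ P where
  obj F := F.functor.obj x
  map φ := app φ x

theorem isIso_of_app {F G : Model S P} (φ : F ⟶ G) (h : ∀ x, IsIso (app φ x)) : IsIso φ :=
  ⟨Premodel.Hom.inv φ, hom_ext fun x => IsIso.hom_inv_id (app φ x),
    hom_ext fun x => IsIso.inv_hom_id (app φ x)⟩

/-- A componentwise invertible morphism of premodels between models as an isomorphism. -/
def isoOfHom {F G : Model S P} (φ : F.toPremodel.Hom G.toPremodel)
    (h : ∀ x, IsIso (φ.app x)) : F ≅ G :=
  haveI : IsIso (X := F) (Y := G) φ := isIso_of_app _ h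
  asIso (X := F) (Y := G) φ

/-- A morphism of models given by invertible components. -/
abbrev isoMk {F G : Model S P} (φ : ∀ x, F.functor.obj x ≅ G.functor.obj x)
    (nat : ∀ {x y : C} (f : x ⟶ y), F.functor.map f ≫ (φ y).hom = (φ x).hom ≫ G.functor.map f)
    (add : ∀ e, F.add e ≫ (φ (S.mid e)).hom =
      ((φ (S.quo e)).hom ⊗ₘ (φ (S.sub e)).hom) ≫ G.add e) : F ≅ G where
  hom := { app := fun x => (φ x).hom, naturality := nat, add := add }
  inv :=
    { app := fun x => (φ x).inv
      naturality := fun f => by rw [Iso.comp_inv_eq, Category.assoc, nat, Iso.inv_hom_id_assoc]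
      add := fun e => by
        rw [Iso.comp_inv_eq, Category.assoc, add, tensorHom_comp_tensorHom_assoc]
        simp }
  hom_inv_id := hom_ext fun x => (φ x).hom_inv_id
  inv_hom_id := hom_ext fun x => (φ x).inv_hom_id

/-- The addition of a pointwise sum begins with the exchange `tensorμ`. Compatibility of the
structural maps with additions is therefore the naturality of `tensorμ` and its coherence with
associators and unitors. -/
instance : MonoidalCategoryStruct (Model S P) where
  tensorObj F G := ⟨F.toPremodel.tensor G.toPremodel, F.satisfies.tensor G.satisfies⟩
  tensorUnit := ⟨Premodel.unit S.toExtensions P, Premodel.satisfies_unit⟩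
  tensorHom {F G F' G'} φ ψ :=
    { app := fun x => app φ x ⊗ₘ app ψ x
      naturality := fun f => by simp
      add := fun e => by
        dsimp
        rw [Category.assoc, tensorHom_comp_tensorHom, add_app, add_app,
          ← tensorHom_comp_tensorHom, tensorμ_natural_assoc] }
  whiskerLeft F G G' ψ :=
    { app := fun x => F.functor.obj x ◁ app ψ x
      naturality := fun f => by simp [← id_tensorHom]
      add := fun e => by
        dsimp
        rw [Category.assoc, ← id_tensorHom, tensorHom_comp_tensorHom, add_app, Category.comp_id,
          ← id_tensorHom, ← id_tensorHom, tensorμ_natural_assoc, tensorHom_comp_tensorHom]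
        simp }
  whiskerRight {F F'} φ G :=
    { app := fun x => app φ x ▷ G.functor.obj x
      naturality := fun f => by simp [← tensorHom_id]
      add := fun e => by
        dsimp
        rw [Category.assoc, ← tensorHom_id, tensorHom_comp_tensorHom, add_app, Category.comp_id,
          ← tensorHom_id, ← tensorHom_id, tensorμ_natural_assoc, tensorHom_comp_tensorHom]
        simp }
  associator F G H := isoMk (fun x => α_ _ _ _) (fun f => by dsimp; simp) (fun e => by
    dsimp
    have := associator_monoidal (F.functor.obj (S.quo e)) (G.functor.obj (S.quo e))
      (H.functor.obj (S.quo e)) (F.functor.obj (S.sub e)) (G.functor.obj (S.sub e))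
      (H.functor.obj (S.sub e))
    rw [comp_tensorHom_right, ← reassoc_of% this, comp_tensorHom_left]
    simp only [Category.assoc, associator_naturality])
  leftUnitor F := isoMk (fun x => λ_ _) (fun f => by dsimp; simp) (fun e => by
    dsimp
    rw [leftUnitor_monoidal, ← Category.comp_id (λ_ (𝟙_ P)).hom, comp_tensorHom_left]
    simp)
  rightUnitor F := isoMk (fun x => ρ_ _) (fun f => by dsimp; simp) (fun e => by
    dsimp
    rw [rightUnitor_monoidal, ← Category.comp_id (λ_ (𝟙_ P)).hom, comp_tensorHom_right]
    simp)

section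

variable (F G : Model S P)

@[simp] theorem tensor_obj (x : C) :
    (F ⊗ G).functor.obj x = F.functor.obj x ⊗ G.functor.obj x := rfl

@[simp] theorem tensor_map {x y : C} (f : x ⟶ y) :
    (F ⊗ G).functor.map f = F.functor.map f ⊗ₘ G.functor.map f := rfl

@[simp] theorem tensor_add (e : S.Ext) :
    (F ⊗ G).add e = tensorμ _ _ _ _ ≫ (F.add e ⊗ₘ G.add e) := rfl

end

instance : MonoidalCategory (Model S P) where
  tensorHom_def _ _ := hom_ext fun _ => MonoidalCategory.tensorHom_def _ _
  id_tensorHom_id _ _ := hom_ext fun _ => id_tensorHom_id _ _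
  tensorHom_comp_tensorHom _ _ _ _ := hom_ext fun _ => tensorHom_comp_tensorHom _ _ _ _
  whiskerLeft_id _ _ := hom_ext fun _ => MonoidalCategory.whiskerLeft_id _ _
  id_whiskerRight _ _ := hom_ext fun _ => MonoidalCategory.id_whiskerRight _ _
  associator_naturality _ _ _ := hom_ext fun _ => associator_naturality _ _ _
  leftUnitor_naturality _ := hom_ext fun _ => MonoidalCategory.leftUnitor_naturality _
  rightUnitor_naturality _ := hom_ext fun _ => MonoidalCategory.rightUnitor_naturality _
  pentagon _ _ _ _ := hom_ext fun _ => MonoidalCategory.pentagon _ _ _ _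
  triangle _ _ := hom_ext fun _ => MonoidalCategory.triangle _ _

instance : BraidedCategory (Model S P) where
  braiding F G := isoMk (fun x => β_ _ _)
    (fun f => BraidedCategory.braiding_naturality _ _) (fun e => by
    change (tensorμ _ _ _ _ ≫ _) ≫ (β_ _ _).hom = _ ≫ tensorμ _ _ _ _ ≫ _
    rw [Category.assoc]
    rw [BraidedCategory.braiding_naturality, ← Category.assoc, tensorμ_braiding, Category.assoc])
  braiding_naturality_right _ _ _ _ :=
    hom_ext fun _ => BraidedCategory.braiding_naturality_right _ _
  braiding_naturality_left _ _ := hom_ext fun _ => BraidedCategory.braiding_naturality_left _ _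
  hexagon_forward _ _ _ := hom_ext fun _ => BraidedCategory.hexagon_forward _ _ _
  hexagon_reverse _ _ _ := hom_ext fun _ => BraidedCategory.hexagon_reverse _ _ _

instance : SymmetricCategory (Model S P) where
  symmetry _ _ := hom_ext fun _ => SymmetricCategory.symmetry _ _

/-- The structure of `Model S P` is pointwise, so evaluation is strictly monoidal. Evaluations are
moreover jointly faithful, which reduces laws valued in models to laws valued in `P`. -/
instance (x : C) : (ev S P x).Monoidal :=
  Functor.CoreMonoidal.toMonoidal
    { εIso := Iso.refl _
      μIso := fun _ _ => Iso.refl _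
      μIso_hom_natural_left := fun _ _ => (Category.comp_id _).trans (Category.id_comp _).symm
      μIso_hom_natural_right := fun _ _ => (Category.comp_id _).trans (Category.id_comp _).symm
      associativity := fun F G H => by
        change 𝟙 _ ▷ _ ≫ 𝟙 _ ≫ (α_ _ _ _).hom = (α_ _ _ _).hom ≫ _ ◁ 𝟙 _ ≫ 𝟙 _
        simp
      left_unitality := fun F => by
        change (λ_ _).hom = 𝟙 _ ▷ _ ≫ 𝟙 _ ≫ (λ_ _).hom
        simp
      right_unitality := fun F => by
        change (ρ_ _).hom = _ ◁ 𝟙 _ ≫ 𝟙 _ ≫ (ρ_ _).hom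
        simp }

instance (x : C) : (ev S P x).Braided where
  braided F G := by
    change 𝟙 _ ≫ (β_ _ _).hom = (β_ _ _).hom ≫ 𝟙 _
    simp

end Model

end MultiDeterminant

end

noncomputable section

namespace MultiDeterminant

open Functor.LaxMonoidal

variable {C : Type u} [Category.{v} C] {D : Type u₁} [Category.{v₁} D]

/-! ### Change of target and exchange of two variables. -/

namespace Model

variable {S : Signature.{u, v, w} C}
variable {P : Type u'} [Category.{v'} P] [MonoidalCategory P] [SymmetricCategory P]
variable {Q : Type*} [Category* Q] [MonoidalCategory Q] [SymmetricCategory Q]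

section Post

variable (H : P ⥤ Q) [H.Braided]

variable (S) in
/-- Composition of models with a braided functor. -/
abbrev post : Model S P ⥤ Model S Q where
  obj F := ⟨F.toPremodel.post H, F.satisfies.post H⟩
  map φ :=
    { app := fun x => H.map (app φ x)
      naturality := fun f => by simp [← Functor.map_comp]
      add := fun e => by
        dsimp
        rw [Category.assoc, ← H.map_comp, add_app, H.map_comp, μ_natural_assoc] }
  map_id F := hom_ext fun x => H.map_id _
  map_comp φ ψ := hom_ext fun x => H.map_comp _ _

instance [H.Faithful] : (post S H).Faithful where
  map_injective h := hom_ext fun x => H.map_injective (congrArg (app · x) h)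

/-- Components are lifted one by one. Both conditions on the lifts are equations that can be tested
after `H`, the second one after cancelling the invertible constraint `μ`. -/
instance [H.Faithful] [H.Full] : (post S H).Full where
  map_surjective {F G} φ := by
    refine ⟨{ app := fun x => H.preimage (app φ x), naturality := fun f => ?_, add := fun e => ?_ },
      hom_ext fun x => H.map_preimage _⟩
    · apply H.map_injective
      rw [H.map_comp, H.map_comp, H.map_preimage, H.map_preimage]
      exact naturality φ f
    · apply H.map_injective
      rw [← cancel_epi (μ H _ _), H.map_comp, H.map_comp, H.map_preimage, ← μ_natural_assoc,
        H.map_preimage, H.map_preimage]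
      exact (Category.assoc _ _ _).symm.trans (add_app φ e)

/-- The image of a chosen preimage by an equivalence. -/
def objInvIso [H.IsEquivalence] (x : Q) : H.obj (H.inv.obj x) ≅ x :=
  H.asEquivalence.counitIso.app x

omit [MonoidalCategory P] [SymmetricCategory P] [MonoidalCategory Q] [SymmetricCategory Q] in
theorem objInvIso_naturality [H.IsEquivalence] {x y : Q} (f : x ⟶ y) :
    H.map (H.inv.map f) ≫ (objInvIso H y).hom = (objInvIso H x).hom ≫ f :=
  H.asEquivalence.counitIso.hom.naturality f

/-- A premodel with values in `P` obtained from a premodel with values in `Q` by choosing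
preimages of the objects. -/
abbrev _root_.MultiDeterminant.Premodel.lift [H.IsEquivalence]
    (G : Premodel S.toExtensions Q) : Premodel S.toExtensions P where
  functor := G.functor ⋙ H.inv
  add e := H.preimage (Functor.OplaxMonoidal.δ H _ _ ≫
    ((objInvIso H _).hom ⊗ₘ (objInvIso H _).hom) ≫ G.add e ≫ (objInvIso H _).inv)

/-- The image of a lift. -/
abbrev _root_.MultiDeterminant.Premodel.postLift [H.IsEquivalence]
    (G : Premodel S.toExtensions Q) : ((G.lift H).post H).Hom G where
  app x := (objInvIso H _).hom
  naturality f := objInvIso_naturality H _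
  add e := by
    dsimp
    rw [Functor.map_preimage, Functor.Monoidal.μ_δ_assoc]
    simp

/-- The lift satisfies the laws because its image under the faithful functor `H` is isomorphic to
the given model. -/
instance [H.IsEquivalence] : (post S H).EssSurj where
  mem_essImage G := by
    have hφ : ∀ x, IsIso ((G.postLift H).app x) := fun x =>
      inferInstanceAs (IsIso (objInvIso H (G.functor.obj x)).hom)
    refine ⟨⟨G.lift H, Premodel.satisfies_of_post (ι := Unit) (fun _ => H)
      (fun f g h => H.map_injective (h ())) fun _ => G.satisfies.of_hom' _ hφ⟩, ⟨?_⟩⟩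
    exact isoOfHom (F := (post S H).obj _) (G.postLift H) hφ

instance [H.IsEquivalence] : (post S H).IsEquivalence where

end Post

section Swap

variable {S' : Signature.{u₁, v₁, w₁} D}

theorem ev_jointly_faithful {F G : Model S P} (φ ψ : F ⟶ G)
    (h : ∀ x, (ev S P x).map φ = (ev S P x).map ψ) : φ = ψ :=
  hom_ext h

/-- The model obtained from a model with values in models by fixing the inner variable. -/
abbrev fixInner (F : Model S (Model S' P)) (y : D) : Model S P where
  functor := F.functor ⋙ ev S' P y
  add e := app (F.add e) y
  satisfies := (F.satisfies.post (ev S' P y)).of_add_eq fun _ => (Category.id_comp _).symm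

/-- Exchange of the two variables of a model with values in models. -/
abbrev swapPremodel (F : Model S (Model S' P)) : Premodel S'.toExtensions (Model S P) where
  functor :=
    { obj := F.fixInner
      map := fun {y y'} f =>
        { app := fun x => (F.functor.obj x).functor.map f
          naturality := fun g => (naturality (F.functor.map g) f).symm
          add := fun e => (naturality (F.add e) f).symm }
      map_id := fun y => hom_ext fun x => (F.functor.obj x).functor.map_id y
      map_comp := fun f g => hom_ext fun x => (F.functor.obj x).functor.map_comp f g }
  add e' :=
    { app := fun x => (F.functor.obj x).add e'
      naturality := fun g => (add_app (F.functor.map g) e').symm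
      add := fun e => by
        have := add_app (F.add e) e'
        dsimp at this ⊢
        rw [Category.assoc] at this
        -- Compatibility of the outer additions with the inner ones is symmetric in the two
        -- variables up to the exchange, which is an involution.
        rw [Category.assoc, ← this, tensorμ_tensorμ_assoc] }

variable (S S' P) in
/-- Exchange of the two variables of models with values in models. -/
abbrev swap : Model S (Model S' P) ⥤ Model S' (Model S P) where
  obj F := ⟨swapPremodel F, Premodel.satisfies_of_post (ev S P) ev_jointly_faithful fun x =>
    (F.functor.obj x).satisfies.of_add_eq fun _ => Category.id_comp _⟩
  map φ :=
    { app := fun y =>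
        { app := fun x => app (app φ x) y
          naturality := fun f => congrArg (app · y) (naturality φ f)
          add := fun e => congrArg (app · y) (add_app φ e) }
      naturality := fun f => hom_ext fun x => naturality (app φ x) f
      add := fun e => hom_ext fun x => add_app (app φ x) e }
  map_id _ := rfl
  map_comp _ _ := rfl

/-- Exchanging twice returns the original data definitionally, so both isomorphisms of the
equivalence are reflexivity. -/
instance : (swap S P S').IsEquivalence :=
  (CategoryTheory.Equivalence.mk (swap S P S') (swap S' P S) (Iso.refl _)
    (Iso.refl _)).isEquivalence_functor

end Swap

end Model

/-! ## Restriction of models -/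

/-- A functor together with a compatible way to turn extensions into extensions. -/
structure Extensions.Map (A : Extensions.{u, w} C) (B : Extensions.{u₁, w₁} D) where
  functor : C ⥤ D
  ext : A.Ext → B.Ext
  quo : ∀ e, functor.obj (A.quo e) ⟶ B.quo (ext e)
  sub : ∀ e, functor.obj (A.sub e) ⟶ B.sub (ext e)
  mid : ∀ e, B.mid (ext e) ⟶ functor.obj (A.mid e)

section Restriction

variable {A : Extensions.{u, w} C} {B : Extensions.{u₁, w₁} D}
variable {S : Signature.{u, v, w} C} {S' : Signature.{u₁, v₁, w₁} D}
variable {P : Type u'} [Category.{v'} P] [MonoidalCategory P]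

/-- Restriction of a premodel. -/
abbrev Premodel.pull (m : A.Map B) (F : Premodel B P) : Premodel A P where
  functor := m.functor ⋙ F.functor
  add e := (F.functor.map (m.quo e) ⊗ₘ F.functor.map (m.sub e)) ≫ F.add (m.ext e) ≫
    F.functor.map (m.mid e)

/-- Restriction of a morphism of premodels. -/
abbrev Premodel.Hom.pull (m : A.Map B) {F G : Premodel B P} (φ : F.Hom G) :
    (F.pull m).Hom (G.pull m) where
  app x := φ.app (m.functor.obj x)
  naturality f := φ.naturality _
  add e := by
    dsimp
    simp only [Category.assoc, Hom.naturality, Hom.add_assoc, tensorHom_comp_tensorHom_assoc]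

variable [SymmetricCategory P]

variable (P) in
/-- Restriction along `m` turns models with values in `P` into models. -/
def Preserves (m : S.toExtensions.Map S'.toExtensions) : Prop :=
  ∀ F : Model S' P, Premodel.Satisfies S (F.toPremodel.pull m)

namespace Model

variable {m : S.toExtensions.Map S'.toExtensions}

/-- Restriction of models. -/
abbrev pull (hm : Preserves P m) : Model S' P ⥤ Model S P where
  obj F := ⟨F.toPremodel.pull m, hm F⟩
  map φ := Premodel.Hom.pull m φ
  map_id _ := rfl
  map_comp _ _ := rfl

variable (hm : Preserves P m)

instance : (pull hm).Monoidal :=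
  Functor.CoreMonoidal.toMonoidal
    { εIso := isoMk (fun x => Iso.refl _)
        (fun f => (Category.comp_id _).trans (Category.id_comp _).symm) (fun e => by
        change (λ_ _).hom ≫ 𝟙 _ = (𝟙 _ ⊗ₘ 𝟙 _) ≫ (𝟙 _ ⊗ₘ 𝟙 _) ≫ (λ_ _).hom ≫ 𝟙 _
        simp)
      μIso := fun F G => isoMk (fun x => Iso.refl _) (fun f => by simp) (fun e => by
        dsimp
        simp only [Category.assoc, Category.comp_id, id_tensorHom_id, Category.id_comp,
          ← tensorHom_comp_tensorHom, tensorμ_natural_assoc])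
      μIso_hom_natural_left := fun _ _ =>
        hom_ext fun x => (Category.comp_id _).trans (Category.id_comp _).symm
      μIso_hom_natural_right := fun _ _ =>
        hom_ext fun x => (Category.comp_id _).trans (Category.id_comp _).symm
      associativity := fun F G H => hom_ext fun x => by
        change 𝟙 _ ▷ _ ≫ 𝟙 _ ≫ (α_ _ _ _).hom = (α_ _ _ _).hom ≫ _ ◁ 𝟙 _ ≫ 𝟙 _
        simp
      left_unitality := fun F => hom_ext fun x => by
        change (λ_ _).hom = 𝟙 _ ▷ _ ≫ 𝟙 _ ≫ (λ_ _).hom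
        simp
      right_unitality := fun F => hom_ext fun x => by
        change (ρ_ _).hom = _ ◁ 𝟙 _ ≫ 𝟙 _ ≫ (ρ_ _).hom
        simp }

instance : (pull hm).Braided where
  braided F G := hom_ext fun x => by
    change 𝟙 _ ≫ (β_ _ _).hom = (β_ _ _).hom ≫ 𝟙 _
    simp

variable {E : Type*} [Category* E] {R : Signature E}

/-- Laws in `Model R P` can be tested at each object of `E`, and evaluating a restricted model there
gives the restriction of a model with values in `P`. -/
theorem _root_.MultiDeterminant.Preserves.model (hm : Preserves P m) (R : Signature E) :
    Preserves (Model R P) m := fun F =>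
  Premodel.satisfies_of_post (ev R P) ev_jointly_faithful fun y => by
    exact (hm (F.fixInner y)).of_add_eq fun e => Category.id_comp _

/-- Restriction in the outer variable is restriction in the inner one after the exchange. -/
def pullSwap : pull (hm.model R) ⋙ swap S P R ≅ swap S' P R ⋙ post R (pull hm) :=
  NatIso.ofComponents (fun F => isoMk (fun x => Iso.refl _)
    (fun f => hom_ext fun y =>
      (Category.comp_id _).trans (Category.id_comp _).symm)
    (fun e => hom_ext fun y => by
      change (F.functor.obj (m.functor.obj y)).add e ≫ 𝟙 _ =
        (𝟙 _ ⊗ₘ 𝟙 _) ≫ 𝟙 _ ≫ (F.functor.obj (m.functor.obj y)).add e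
      simp))
    (fun φ => hom_ext fun x => hom_ext fun y =>
      (Category.comp_id _).trans (Category.id_comp _).symm)

/-- This extends the equivalence from the target `P` to the targets `Model R P`. By `pullSwap`,
after exchanging variables the functor is composition with the equivalence `pull hm`, to which the
instances for `post` apply; it remains to cancel `swap`. -/
theorem isEquivalence_pull_model [(pull hm).IsEquivalence] (R : Signature E) :
    (pull (hm.model R)).IsEquivalence := by
  have : (pull (hm.model R) ⋙ swap S P R).IsEquivalence :=
    Functor.isEquivalence_of_iso (pullSwap hm).symm
  exact Functor.isEquivalence_of_comp_right _ (swap S P R)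

end Model

end Restriction

end MultiDeterminant

end

noncomputable section

namespace MultiDeterminant

open Functor.LaxMonoidal

/-! ### Formal composites under restriction. -/

section Map

variable {C : Type u} [Category.{v} C] {D : Type u₁} [Category.{v₁} D]
variable {A : Extensions.{u, w} C} {B : Extensions.{u₁, w₁} D}

/-- The image of a formal sum. -/
def Word.map (f : C → D) : Word C → Word D
  | .of x => .of (f x)
  | .sum p q => .sum (p.map f) (q.map f)

/-- The image of a formal composite. -/
def Expr.map (m : A.Map B) : ∀ {p q : Word C}, Expr A p q →
    Expr B (p.map m.functor.obj) (q.map m.functor.obj)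
  | _, _, .id p => .id _
  | _, _, .comp f g => .comp (f.map m) (g.map m)
  | _, _, .sum f g => .sum (f.map m) (g.map m)
  | _, _, .assoc p q r => .assoc _ _ _
  | _, _, .assocInv p q r => .assocInv _ _ _
  | _, _, .braid p q => .braid _ _
  | _, _, .hom f => .hom (m.functor.map f)
  | _, _, .add e => .comp (.sum (.hom (m.quo e)) (.hom (m.sub e)))
      (.comp (.add (m.ext e)) (.hom (m.mid e)))

namespace Premodel

variable {P : Type u'} [Category.{v'} P] [MonoidalCategory P]

/-- The value of a word in a restriction. -/
def pullWord (m : A.Map B) (F : Premodel B P) :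
    ∀ p : Word C, (F.pull m).word p ⟶ F.word (p.map m.functor.obj)
  | .of _ => 𝟙 _
  | .sum p q => F.pullWord m p ⊗ₘ F.pullWord m q

instance (m : A.Map B) (F : Premodel B P) (p : Word C) : IsIso (F.pullWord m p) := by
  induction p with
  | of x => exact inferInstanceAs (IsIso (𝟙 _))
  | sum p q hp hq => exact inferInstanceAs (IsIso (F.pullWord m p ⊗ₘ F.pullWord m q))

variable [SymmetricCategory P]

theorem pull_expr (m : A.Map B) (F : Premodel B P) {p q : Word C} (a : Expr A p q) :
    (F.pull m).expr a ≫ F.pullWord m q = F.pullWord m p ≫ F.expr (a.map m) := by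
  induction a with
  | id p => simp [Premodel.expr, Expr.map]
  | comp f g hf hg => simp [Premodel.expr, Expr.map, hg, reassoc_of% hf]
  | sum f g hf hg =>
    exact (tensorHom_comp_tensorHom _ _ _ _).trans
      ((congrArg₂ _ hf hg).trans (tensorHom_comp_tensorHom _ _ _ _).symm)
  | assoc p q r => exact (associator_naturality _ _ _).symm
  | assocInv p q r => exact (associator_inv_naturality _ _ _).symm
  | braid p q => exact (BraidedCategory.braiding_naturality _ _).symm
  | hom f => exact (Category.comp_id _).trans (Category.id_comp _).symm
  | add e =>
    change ((_ ⊗ₘ _) ≫ F.add _ ≫ F.functor.map _) ≫ 𝟙 _ =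
      (𝟙 _ ⊗ₘ 𝟙 _) ≫ (F.functor.map _ ⊗ₘ F.functor.map _) ≫ F.add _ ≫ F.functor.map _
    simp

/-- The two evaluations are conjugate by the invertible maps `pullWord`. Laws imposed on each slice
of a functor of several variables can thus be read in the slice itself. -/
theorem expr_map_eq_iff (m : A.Map B) (F : Premodel B P) {p q : Word C} (a a' : Expr A p q) :
    F.expr (a.map m) = F.expr (a'.map m) ↔ (F.pull m).expr a = (F.pull m).expr a' := by
  rw [← cancel_epi (F.pullWord m p), ← pull_expr, ← pull_expr, cancel_mono]

end Premodel

end Map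

/-! ## Signatures in several variables -/

section UpdateHom

variable {ι : Type*} [DecidableEq ι] {C : ι → Type u} [∀ i, Category.{v} (C i)]

theorem updateHom_self (i : ι) {b b' : ∀ j, C j} (φ : ∀ j, j ≠ i → (b j ⟶ b' j)) {x y : C i}
    (f : x ⟶ y) : updateHom i φ f i =
      eqToHom (Function.update_self i x b) ≫ f ≫ eqToHom (Function.update_self i y b').symm := by
  simp [updateHom]

theorem updateHom_of_ne (i : ι) {b b' : ∀ j, C j} (φ : ∀ j, j ≠ i → (b j ⟶ b' j)) {x y : C i}
    (f : x ⟶ y) {j : ι} (h : j ≠ i) : updateHom i φ f j =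
      eqToHom (Function.update_of_ne h x b) ≫ φ j h ≫
        eqToHom (Function.update_of_ne h y b').symm := by
  simp [updateHom, h]

theorem updateHom_eqToHom (i : ι) {b b' : ∀ j, C j} (h : ∀ j, j ≠ i → b j = b' j) {x y : C i}
    (h' : x = y) :
    updateHom i (fun j hj => eqToHom (h j hj)) (eqToHom h') =
      eqToHom (by
        subst h'
        funext j
        by_cases hj : j = i
        · subst hj; simp
        · simp [hj, h j hj] : Function.update b i x = Function.update b' i y) := by
  funext j
  by_cases hj : j = i
  · subst hj; rw [updateHom_self]; simp [Functor.eqToHom_proj]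
  · rw [updateHom_of_ne _ _ _ hj]; simp [Functor.eqToHom_proj]

end UpdateHom

section PiSignature

variable {ι : Type} [DecidableEq ι] {C : ι → Type u} [∀ i, Category.{v} (C i)]

/-- Extensions in one of several variables. -/
abbrev piExtensions (A : ∀ i, Extensions.{u, w} (C i)) : Extensions (∀ i, C i) where
  Ext := Σ i, (∀ j, C j) × (A i).Ext
  sub e := Function.update e.2.1 e.1 ((A e.1).sub e.2.2)
  mid e := Function.update e.2.1 e.1 ((A e.1).mid e.2.2)
  quo e := Function.update e.2.1 e.1 ((A e.1).quo e.2.2)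

variable (S : ∀ i, Signature.{u, v, w} (C i))

/-- The inclusion of the extensions in one variable. -/
abbrev sliceMap (i : ι) (b : ∀ j, C j) :
    (S i).toExtensions.Map (piExtensions fun i => (S i).toExtensions) where
  functor := slice i b
  ext e := ⟨i, b, e⟩
  quo _ := 𝟙 _
  sub _ := 𝟙 _
  mid _ := 𝟙 _

/-- The formal addition in the variable `i`. -/
abbrev Expr.addAt (i : ι) (b : ∀ j, C j) (e : (S i).Ext) :
    Expr (piExtensions fun i => (S i).toExtensions)
      (.sum (.of (Function.update b i ((S i).quo e))) (.of (Function.update b i ((S i).sub e))))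
      (.of (Function.update b i ((S i).mid e))) :=
  .add (A := piExtensions fun i => (S i).toExtensions) ⟨i, b, e⟩

/-- The addition in the variable `i`, the variable `j` being substituted last. -/
abbrev Expr.addSwap {i j : ι} (h : i ≠ j) (b : ∀ k, C k) (e : (S i).Ext) (t : C j) :
    Expr (piExtensions fun i => (S i).toExtensions)
      (.sum (.of (Function.update (Function.update b i ((S i).quo e)) j t))
        (.of (Function.update (Function.update b i ((S i).sub e)) j t)))
      (.of (Function.update (Function.update b i ((S i).mid e)) j t)) :=
  .comp (.sum (.hom (eqToHom (Function.update_comm h _ _ _)))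
      (.hom (eqToHom (Function.update_comm h _ _ _))))
    (.comp (.addAt S i (Function.update b j t) e)
      (.hom (eqToHom (Function.update_comm h.symm _ _ _))))

/-- The exchange of the two inner terms of a sum of four terms. -/
abbrev Expr.exchange {D : Type*} [Category* D] {A : Extensions D} (p q r s : Word D) :
    Expr A ((p.sum q).sum (r.sum s)) ((p.sum r).sum (q.sum s)) :=
  .comp (.assoc _ _ _) (.comp (.sum (.id _) (.assocInv _ _ _))
    (.comp (.sum (.id _) (.sum (.braid _ _) (.id _)))
      (.comp (.sum (.id _) (.assoc _ _ _)) (.assocInv _ _ _))))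

variable [LT ι]

/-- The laws of the additions in several variables: the laws of each variable, naturality in the
other variables, and the compatibility of the additions in two variables. -/
inductive PiLaw : ∀ {p q : Word (∀ i, C i)},
    Expr (piExtensions fun i => (S i).toExtensions) p q →
    Expr (piExtensions fun i => (S i).toExtensions) p q → Prop
  | slice (i : ι) (b : ∀ j, C j) {p q : Word (C i)} (m m' : Expr (S i).toExtensions p q)
      (h : (S i).Law m m') : PiLaw (m.map (sliceMap S i b)) (m'.map (sliceMap S i b))
  | natural (i : ι) (b b' : ∀ j, C j) (φ : ∀ j, j ≠ i → (b j ⟶ b' j)) (e : (S i).Ext) :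
      PiLaw
        (.comp (.sum (.hom (updateHom i φ (𝟙 _))) (.hom (updateHom i φ (𝟙 _)))) (.addAt S i b' e))
        (.comp (.addAt S i b e) (.hom (updateHom i φ (𝟙 _))))
  | interchange (i j : ι) (hij : i < j) (h : i ≠ j) (b : ∀ k, C k) (e : (S i).Ext)
      (e' : (S j).Ext) :
      PiLaw
        (.comp (.sum (Expr.addSwap S h b e ((S j).quo e')) (Expr.addSwap S h b e ((S j).sub e')))
          (.addAt S j (Function.update b i ((S i).mid e)) e'))
        (.comp (Expr.exchange _ _ _ _)
          (.comp (.sum (.addAt S j (Function.update b i ((S i).quo e)) e')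
              (.addAt S j (Function.update b i ((S i).sub e)) e'))
            (Expr.addSwap S h b e ((S j).mid e'))))

/-- The signature of functors of several variables equipped with additions in each variable. -/
abbrev piSignature : Signature (∀ i, C i) where
  toExtensions := piExtensions fun i => (S i).toExtensions
  Law := PiLaw S

variable {S}
variable {P : Type u'} [Category.{v'} P] [MonoidalCategory P] [SymmetricCategory P]

namespace Premodel

variable (F : Premodel (piSignature S).toExtensions P)

/-- The premodel in the variable `i`, the other variables being fixed. -/
abbrev atSlice (i : ι) (b : ∀ j, C j) : Premodel (S i).toExtensions P where
  functor := slice i b ⋙ F.functor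
  add e := F.add ⟨i, b, e⟩

/-- The addition in the variable `i`, the variable `j` being substituted last. -/
abbrev addSwap {i j : ι} (h : i ≠ j) (b : ∀ k, C k) (e : (S i).Ext) (t : C j) :
    F.functor.obj (Function.update (Function.update b i ((S i).quo e)) j t) ⊗
        F.functor.obj (Function.update (Function.update b i ((S i).sub e)) j t) ⟶
      F.functor.obj (Function.update (Function.update b i ((S i).mid e)) j t) :=
  (swapHom F.functor h b _ t ⊗ₘ swapHom F.functor h b _ t) ≫
    F.add ⟨i, Function.update b j t, e⟩ ≫ swapHom F.functor h.symm b t _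

/-- Naturality of the additions of one variable in the other variables. -/
def IsNatural : Prop :=
  ∀ (i : ι) (b b' : ∀ j, C j) (φ : ∀ j, j ≠ i → (b j ⟶ b' j)) (e : (S i).Ext),
    (F.functor.map (updateHom i φ (𝟙 _)) ⊗ₘ F.functor.map (updateHom i φ (𝟙 _))) ≫
        F.add ⟨i, b', e⟩ =
      F.add ⟨i, b, e⟩ ≫ F.functor.map (updateHom i φ (𝟙 _))

/-- Compatibility of the additions in the variables `i` and `j`. -/
def Interchange (i j : ι) (h : i ≠ j) : Prop :=
  ∀ (b : ∀ k, C k) (e : (S i).Ext) (e' : (S j).Ext),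
    (F.addSwap h b e ((S j).quo e') ⊗ₘ F.addSwap h b e ((S j).sub e')) ≫
        F.add ⟨j, Function.update b i ((S i).mid e), e'⟩ =
      tensorμ _ _ _ _ ≫
        (F.add ⟨j, Function.update b i ((S i).quo e), e'⟩ ⊗ₘ
            F.add ⟨j, Function.update b i ((S i).sub e), e'⟩) ≫
          F.addSwap h b e ((S j).mid e')

/-- The working form of the laws of `piSignature`: afterwards formal composites in several variables
are no longer manipulated. -/
theorem satisfies_pi_iff :
    Satisfies (piSignature S) F ↔ (∀ i b, Satisfies (S i) (F.atSlice i b)) ∧ F.IsNatural ∧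
      ∀ (i j : ι) (_ : i < j) (h : i ≠ j), F.Interchange i j h := by
  -- Restriction along `sliceMap` only inserts images of identities into the additions.
  have hs : ∀ i b, Satisfies (S i) (F.atSlice i b) ↔
      Satisfies (S i) (F.pull (sliceMap S i b)) := fun i b => by
    have : ∀ e, (F.pull (sliceMap S i b)).add e = F.add ⟨i, b, e⟩ := fun e => by
      change (F.functor.map (𝟙 (Function.update b i _)) ⊗ₘ
        F.functor.map (𝟙 (Function.update b i _))) ≫ F.add ⟨i, b, e⟩ ≫
          F.functor.map (𝟙 (Function.update b i _)) = _
      simp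
    exact ⟨fun h => h.of_add_eq this, fun h => h.of_add_eq fun e => (this e).symm⟩
  -- The formal exchange evaluates to `tensorμ`.
  have hi : ∀ (i j : ι) (h : i ≠ j) (b : ∀ k, C k) (e : (S i).Ext) (e' : (S j).Ext),
      F.expr (.comp (Expr.exchange _ _ _ _)
          (.comp (.sum (.addAt S j (Function.update b i ((S i).quo e)) e')
              (.addAt S j (Function.update b i ((S i).sub e)) e'))
            (Expr.addSwap S h b e ((S j).mid e')))) =
      tensorμ _ _ _ _ ≫
        (F.add ⟨j, Function.update b i ((S i).quo e), e'⟩ ⊗ₘ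
            F.add ⟨j, Function.update b i ((S i).sub e), e'⟩) ≫
          F.addSwap h b e ((S j).mid e') := fun i j h b e e' => by
    refine congrArg (· ≫ _) ?_
    change (α_ _ _ _).hom ≫ (𝟙 _ ⊗ₘ (α_ _ _ _).inv) ≫ (𝟙 _ ⊗ₘ ((β_ _ _).hom ⊗ₘ 𝟙 _)) ≫
      (𝟙 _ ⊗ₘ (α_ _ _ _).hom) ≫ (α_ _ _ _).inv = tensorμ _ _ _ _
    simp [tensorμ]
  constructor
  · refine fun hF => ⟨fun i b => (hs i b).2 fun p q m m' h => ?_, fun i b b' φ e => ?_,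
      fun i j hij h b e e' => ?_⟩
    · exact (expr_map_eq_iff _ _ _ _).1 (hF _ _ (PiLaw.slice i b m m' h))
    · exact hF _ _ (PiLaw.natural i b b' φ e)
    · exact (hF _ _ (PiLaw.interchange i j hij h b e e')).trans (hi i j h b e e')
  · rintro ⟨h₁, h₂, h₃⟩ p q m m' h
    cases h with
    | slice i b m m' h => exact (expr_map_eq_iff _ _ _ _).2 ((hs i b).1 (h₁ i b) m m' h)
    | natural i b b' φ e => exact h₂ i b b' φ e
    | interchange i j hij h b e e' => exact (h₃ i j hij h b e e').trans (hi i j h b e e').symm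

variable {F}

omit [SymmetricCategory P] in
/-- The additions in the variable `i` do not depend on the discarded value of this variable. -/
theorem IsNatural.add_eq (hF : F.IsNatural) (i : ι) {b b' : ∀ j, C j}
    (h : ∀ j, j ≠ i → b j = b' j) (h' : ∀ x : C i, Function.update b i x = Function.update b' i x)
    (e : (S i).Ext) :
    F.add ⟨i, b, e⟩ = (F.functor.map (eqToHom (h' _)) ⊗ₘ F.functor.map (eqToHom (h' _))) ≫
      F.add ⟨i, b', e⟩ ≫ F.functor.map (eqToHom (h' _).symm) := by
  -- Independence of the discarded value is naturality along identities of the other variables,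
  -- presented as `eqToHom`.
  have := hF i b b' (fun j hj => eqToHom (h j hj)) e
  simp only [← eqToHom_refl _ rfl, updateHom_eqToHom] at this
  rw [reassoc_of% this, ← F.functor.map_comp]
  simp

end Premodel

end PiSignature

end MultiDeterminant

end

noncomputable section

namespace MultiDeterminant

open Functor.LaxMonoidal Function

/-! ### Additions transported along equalities of objects. -/

section AddOf

variable {ι : Type} [DecidableEq ι] {C : ι → Type u} [∀ i, Category.{v} (C i)]
variable {A : ∀ i, Extensions.{u, w} (C i)}
variable {P : Type u'} [Category.{v'} P] [MonoidalCategory P]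

namespace Premodel

variable (F : Premodel (piExtensions A) P)

/-- The addition in the variable `i`, transported along equalities of objects. -/
def addOf (i : ι) (b : ∀ j, C j) (e : (A i).Ext) {x y z : ∀ j, C j}
    (hz : z = update b i ((A i).quo e)) (hx : x = update b i ((A i).sub e))
    (hy : y = update b i ((A i).mid e)) :
    F.functor.obj z ⊗ F.functor.obj x ⟶ F.functor.obj y :=
  (F.functor.map (eqToHom hz) ⊗ₘ F.functor.map (eqToHom hx)) ≫ F.add ⟨i, b, e⟩ ≫
    F.functor.map (eqToHom hy.symm)

theorem addOf_rfl (i : ι) (b : ∀ j, C j) (e : (A i).Ext) :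
    F.addOf i b e rfl rfl rfl = F.add ⟨i, b, e⟩ := by
  simp [addOf]

end Premodel

variable {S : ∀ i, Signature.{u, v, w} (C i)} [LT ι]

namespace Premodel

variable {F : Premodel (piSignature S).toExtensions P}

/-- The objects are variables tied to updates by equations, so the equations can be substituted
away. Each place of use only has to supply three squares in the product category. -/
theorem IsNatural.addOf (hF : F.IsNatural) (i : ι) {b b' : ∀ j, C j}
    (φ : ∀ j, j ≠ i → (b j ⟶ b' j)) (e : (S i).Ext) {x y z x' y' z' : ∀ j, C j}
    {hz : z = update b i ((S i).quo e)} {hx : x = update b i ((S i).sub e)}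
    {hy : y = update b i ((S i).mid e)} {hz' : z' = update b' i ((S i).quo e)}
    {hx' : x' = update b' i ((S i).sub e)} {hy' : y' = update b' i ((S i).mid e)}
    {fz : z ⟶ z'} {fx : x ⟶ x'} {fy : y ⟶ y'}
    (wz : fz ≫ eqToHom hz' = eqToHom hz ≫ updateHom i φ (𝟙 _))
    (wx : fx ≫ eqToHom hx' = eqToHom hx ≫ updateHom i φ (𝟙 _))
    (wy : fy ≫ eqToHom hy' = eqToHom hy ≫ updateHom i φ (𝟙 _)) :
    (F.functor.map fz ⊗ₘ F.functor.map fx) ≫ F.addOf i b' e hz' hx' hy' =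
      F.addOf i b e hz hx hy ≫ F.functor.map fy := by
  subst hz hx hy hz' hx' hy'
  simp only [eqToHom_refl, Category.comp_id, Category.id_comp] at wz wx wy
  subst wz wx wy
  simp only [addOf_rfl]
  exact hF i b b' φ e

/-- The discarded value of the basis point is irrelevant. -/
theorem IsNatural.addOf_eq (hF : F.IsNatural) {i : ι} {b : ∀ j, C j} (b' : ∀ j, C j)
    {e : (S i).Ext} {x y z : ∀ j, C j}
    {hz : z = update b i ((S i).quo e)} {hx : x = update b i ((S i).sub e)}
    {hy : y = update b i ((S i).mid e)} (hz' : z = update b' i ((S i).quo e))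
    (hx' : x = update b' i ((S i).sub e)) (hy' : y = update b' i ((S i).mid e)) :
    F.addOf i b e hz hx hy = F.addOf i b' e hz' hx' hy' := by
  have h : ∀ j, j ≠ i → b j = b' j := fun j hj => by
    have := congrFun (hz.symm.trans hz') j
    rwa [update_of_ne hj, update_of_ne hj] at this
  have := hF.addOf i (fun j hj => eqToHom (h j hj)) e (hz := hz) (hx := hx) (hy := hy)
    (hz' := hz') (hx' := hx') (hy' := hy') (fz := 𝟙 _) (fx := 𝟙 _) (fy := 𝟙 _)
  simp only [← eqToHom_refl _ rfl, updateHom_eqToHom, eqToHom_trans, forall_true_left] at this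
  simpa using this.symm

variable [SymmetricCategory P]

/-- The interchange law for arbitrary presentations of the nine objects and arbitrary base points.
Base points may be changed by `addOf_eq`, so the same law serves for iterated updates in either
order and for tuples built with `Fin.cons`. -/
theorem IsNatural.interchange (hF : F.IsNatural) {i j : ι} {h : i ≠ j}
    (hij : F.Interchange i j h) (b : ∀ k, C k) {e : (S i).Ext} {e' : (S j).Ext}
    {ozz ozx ozy oxz oxx oxy oyz oyx oyy : ∀ k, C k}
    (hzz : ozz = update (update b i ((S i).quo e)) j ((S j).quo e'))
    (hzx : ozx = update (update b i ((S i).quo e)) j ((S j).sub e'))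
    (hzy : ozy = update (update b i ((S i).quo e)) j ((S j).mid e'))
    (hxz : oxz = update (update b i ((S i).sub e)) j ((S j).quo e'))
    (hxx : oxx = update (update b i ((S i).sub e)) j ((S j).sub e'))
    (hxy : oxy = update (update b i ((S i).sub e)) j ((S j).mid e'))
    (hyz : oyz = update (update b i ((S i).mid e)) j ((S j).quo e'))
    (hyx : oyx = update (update b i ((S i).mid e)) j ((S j).sub e'))
    (hyy : oyy = update (update b i ((S i).mid e)) j ((S j).mid e'))
    {bz bx by' cz cx cy : ∀ k, C k}
    {h₁ : ozz = update bz i ((S i).quo e)} {h₂ : oxz = update bz i ((S i).sub e)}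
    {h₃ : oyz = update bz i ((S i).mid e)} {h₄ : ozx = update bx i ((S i).quo e)}
    {h₅ : oxx = update bx i ((S i).sub e)} {h₆ : oyx = update bx i ((S i).mid e)}
    {h₇ : ozy = update by' i ((S i).quo e)} {h₈ : oxy = update by' i ((S i).sub e)}
    {h₉ : oyy = update by' i ((S i).mid e)}
    {k₁ : ozz = update cz j ((S j).quo e')} {k₂ : ozx = update cz j ((S j).sub e')}
    {k₃ : ozy = update cz j ((S j).mid e')} {k₄ : oxz = update cx j ((S j).quo e')}
    {k₅ : oxx = update cx j ((S j).sub e')} {k₆ : oxy = update cx j ((S j).mid e')}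
    {k₇ : oyz = update cy j ((S j).quo e')} {k₈ : oyx = update cy j ((S j).sub e')}
    {k₉ : oyy = update cy j ((S j).mid e')} :
    (F.addOf i bz e h₁ h₂ h₃ ⊗ₘ F.addOf i bx e h₄ h₅ h₆) ≫ F.addOf j cy e' k₇ k₈ k₉ =
      tensorμ _ _ _ _ ≫ (F.addOf j cz e' k₁ k₂ k₃ ⊗ₘ F.addOf j cx e' k₄ k₅ k₆) ≫
        F.addOf i by' e h₇ h₈ h₉ := by
  subst hzz hzx hzy hxz hxx hxy hyz hyx hyy
  rw [hF.addOf_eq (update b j ((S j).quo e')) (update_comm h _ _ _) (update_comm h _ _ _)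
      (update_comm h _ _ _) (hz := h₁),
    hF.addOf_eq (update b j ((S j).sub e')) (update_comm h _ _ _) (update_comm h _ _ _)
      (update_comm h _ _ _) (hz := h₄),
    hF.addOf_eq (update b j ((S j).mid e')) (update_comm h _ _ _) (update_comm h _ _ _)
      (update_comm h _ _ _) (hz := h₇),
    hF.addOf_eq (update b i ((S i).quo e)) rfl rfl rfl (hz := k₁),
    hF.addOf_eq (update b i ((S i).sub e)) rfl rfl rfl (hz := k₄),
    hF.addOf_eq (update b i ((S i).mid e)) rfl rfl rfl (hz := k₇),
    addOf_rfl, addOf_rfl, addOf_rfl]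
  exact hij b e e'

/-- The interchange law does not depend on the order of the variables. -/
theorem IsNatural.interchange_symm (hF : F.IsNatural) {i j : ι} {h : i ≠ j}
    (hij : F.Interchange i j h) : F.Interchange j i h.symm := fun b e e' => by
  have := hF.interchange hij b (e := e') (e' := e)
    (update_comm h.symm _ _ _) (update_comm h.symm _ _ _) (update_comm h.symm _ _ _)
    (update_comm h.symm _ _ _) (update_comm h.symm _ _ _) (update_comm h.symm _ _ _)
    (update_comm h.symm _ _ _) (update_comm h.symm _ _ _) (update_comm h.symm _ _ _)
    (bz := update b j ((S j).quo e)) (bx := update b j ((S j).sub e))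
    (by' := update b j ((S j).mid e)) (cz := update b i ((S i).quo e'))
    (cx := update b i ((S i).sub e')) (cy := update b i ((S i).mid e'))
    (h₁ := rfl) (h₂ := rfl) (h₃ := rfl) (h₄ := rfl) (h₅ := rfl) (h₆ := rfl) (h₇ := rfl)
    (h₈ := rfl) (h₉ := rfl)
    (k₁ := update_comm h.symm _ _ _) (k₂ := update_comm h.symm _ _ _)
    (k₃ := update_comm h.symm _ _ _) (k₄ := update_comm h.symm _ _ _)
    (k₅ := update_comm h.symm _ _ _) (k₆ := update_comm h.symm _ _ _)
    (k₇ := update_comm h.symm _ _ _) (k₈ := update_comm h.symm _ _ _)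
    (k₉ := update_comm h.symm _ _ _)
  rw [addOf_rfl, addOf_rfl, addOf_rfl] at this
  exact ((congrArg (tensorμ _ _ _ _ ≫ ·) this).trans (tensorμ_tensorμ_assoc _ _ _ _ _)).symm

end Premodel

end AddOf

end MultiDeterminant

end

noncomputable section

namespace MultiDeterminant

open Functor.LaxMonoidal Function

/-! ### Splitting off the first variable of a finite product. -/

section ConsHom

variable {n : ℕ} {C : Fin (n + 1) → Type u}

theorem update_zero_eq_cons (b : ∀ i, C i) (x : C 0) :
    update b 0 x = Fin.cons x (Fin.tail b) :=
  funext (Fin.cases (by simp) fun k => by simp [Fin.tail])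

theorem update_succ_eq_cons (b : ∀ i, C i) (j : Fin n) (x : C j.succ) :
    update b j.succ x = Fin.cons (b 0) (update (Fin.tail b) j x) :=
  funext (Fin.cases (by simp [update_of_ne (Fin.succ_ne_zero j).symm]) fun k => by
    by_cases h : k = j
    · subst h; simp
    · have : k.succ ≠ j.succ := fun h' => h (Fin.succ_injective _ h')
      simp [h, this, Fin.tail])

variable [∀ i, Category.{v} (C i)]

/-- A morphism of a product category given by its first component and the other ones. -/
def consHom {x y : ∀ i, C i} (f : x 0 ⟶ y 0) (g : ∀ k : Fin n, x k.succ ⟶ y k.succ) : x ⟶ y :=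
  Fin.cases f g

theorem hom_ext_cons {x y : ∀ i, C i} {f g : x ⟶ y} (h₀ : f 0 = g 0)
    (h : ∀ k : Fin n, f k.succ = g k.succ) : f = g :=
  funext (Fin.cases h₀ h)

/-- The inclusion of the other variables, the first one being fixed. -/
abbrev consFunctor (c : C 0) : (∀ k : Fin n, C k.succ) ⥤ ∀ i, C i where
  obj b := Fin.cons c b
  map f := consHom (x := Fin.cons c _) (y := Fin.cons c _) (𝟙 c) f
  map_id _ := hom_ext_cons rfl fun _ => rfl
  map_comp _ _ := hom_ext_cons (Category.comp_id (𝟙 c)).symm fun _ => rfl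

/-- Updating a tuple and prepending an entry agree only propositionally. This square and its
companion `updateHom_succ_comp` carry the resulting transports through morphisms; both are checked
componentwise. -/
theorem updateHom_zero_comp {b b' : ∀ i, C i} (φ : ∀ j, j ≠ 0 → (b j ⟶ b' j)) {x y : C 0}
    (f : x ⟶ y) :
    updateHom 0 φ f ≫ eqToHom (update_zero_eq_cons b' y) =
      eqToHom (update_zero_eq_cons b x) ≫
        consHom (x := Fin.cons x (Fin.tail b)) (y := Fin.cons y (Fin.tail b')) f
          fun k => φ k.succ (Fin.succ_ne_zero k) := by
  refine hom_ext_cons ?_ fun k => ?_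
  · rw [Pi.comp_apply, Pi.comp_apply, updateHom_self, Functor.eqToHom_proj, Functor.eqToHom_proj]
    refine Eq.trans ?_ (congrArg (eqToHom _ ≫ ·) (Category.comp_id f))
    simp only [Category.assoc, eqToHom_trans]
    rfl
  · rw [Pi.comp_apply, Pi.comp_apply, updateHom_of_ne _ _ _ (Fin.succ_ne_zero k),
      Functor.eqToHom_proj, Functor.eqToHom_proj]
    refine Eq.trans ?_ (congrArg (eqToHom _ ≫ ·) (Category.comp_id (φ k.succ _)))
    simp only [Category.assoc, eqToHom_trans]
    rfl

theorem updateHom_succ_comp (j : Fin n) {b b' : ∀ i, C i} (φ : ∀ k, k ≠ j.succ → (b k ⟶ b' k))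
    {x y : C j.succ} (f : x ⟶ y) :
    updateHom j.succ φ f ≫ eqToHom (update_succ_eq_cons b' j y) =
      eqToHom (update_succ_eq_cons b j x) ≫
        consHom (x := Fin.cons (b 0) (update (Fin.tail b) j x))
          (y := Fin.cons (b' 0) (update (Fin.tail b') j y)) (φ 0 (Fin.succ_ne_zero j).symm)
          (updateHom j (b := Fin.tail b) (b' := Fin.tail b')
            (fun k hk => φ k.succ fun h => hk (Fin.succ_injective _ h)) f) := by
  refine hom_ext_cons ?_ fun k => ?_
  · rw [Pi.comp_apply, Pi.comp_apply, updateHom_of_ne _ _ _ (Fin.succ_ne_zero j).symm,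
      Functor.eqToHom_proj, Functor.eqToHom_proj]
    refine Eq.trans ?_ (congrArg (eqToHom _ ≫ ·) (Category.comp_id (φ 0 _)))
    simp only [Category.assoc, eqToHom_trans]
    rfl
  · rw [Pi.comp_apply, Pi.comp_apply, Functor.eqToHom_proj, Functor.eqToHom_proj]
    by_cases hk : k = j
    · subst hk
      refine Eq.trans ?_ (congrArg (eqToHom _ ≫ ·) (updateHom_self k (b := Fin.tail b)
        (b' := Fin.tail b') (fun l hl => φ l.succ fun h => hl (Fin.succ_injective _ h)) f).symm)
      rw [updateHom_self, Category.assoc, Category.assoc, eqToHom_trans]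
      exact (eqToHom_trans_assoc _ _ _).symm
    · refine Eq.trans ?_ (congrArg (eqToHom _ ≫ ·) (updateHom_of_ne j (b := Fin.tail b)
        (b' := Fin.tail b') (fun k hk => φ k.succ fun h => hk (Fin.succ_injective _ h)) f hk).symm)
      rw [updateHom_of_ne _ _ _ (fun h => hk (Fin.succ_injective _ h)), Category.assoc,
        Category.assoc, eqToHom_trans]
      exact (eqToHom_trans_assoc _ _ _).symm

end ConsHom

section Tail

variable {n : ℕ} {C : Fin (n + 1) → Type u} [∀ i, Category.{v} (C i)]
variable (S : ∀ i, Signature.{u, v, w} (C i))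
variable {P : Type u'} [Category.{v'} P] [MonoidalCategory P] [SymmetricCategory P]

/-- The signature of the variables other than the first one. -/
abbrev tailSignature : Signature (∀ k : Fin n, C k.succ) := piSignature fun k => S k.succ

variable {S}

namespace Model

theorem isNatural {n : ℕ} {C : Fin n → Type u} [∀ i, Category.{v} (C i)]
    {S : ∀ i, Signature.{u, v, w} (C i)} (F : Model (piSignature S) P) :
    F.toPremodel.IsNatural :=
  ((Premodel.satisfies_pi_iff _).1 F.satisfies).2.1

/-- The signature imposes the law only for `i < j`; the other order follows from `interchange_symm`.
-/
theorem interchange {n : ℕ} {C : Fin n → Type u} [∀ i, Category.{v} (C i)]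
    {S : ∀ i, Signature.{u, v, w} (C i)} (F : Model (piSignature S) P) (i j : Fin n) (h : i ≠ j) :
    F.toPremodel.Interchange i j h := by
  rcases lt_or_gt_of_ne h with hij | hij
  · exact ((Premodel.satisfies_pi_iff _).1 F.satisfies).2.2 i j hij h
  · exact F.isNatural.interchange_symm
      (((Premodel.satisfies_pi_iff _).1 F.satisfies).2.2 j i hij h.symm)

theorem satisfies_slice {n : ℕ} {C : Fin n → Type u} [∀ i, Category.{v} (C i)]
    {S : ∀ i, Signature.{u, v, w} (C i)} (F : Model (piSignature S) P) (i : Fin n)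
    (b : ∀ j, C j) : Premodel.Satisfies (S i) (F.toPremodel.atSlice i b) :=
  ((Premodel.satisfies_pi_iff _).1 F.satisfies).1 i b

end Model

section

variable {ι : Type} [DecidableEq ι] {C : ι → Type u} [∀ i, Category.{v} (C i)]
variable {A : ∀ i, Extensions.{u, w} (C i)}
variable {P : Type u'} [Category.{v'} P] [MonoidalCategory P]

theorem Premodel.Hom.addOf {F G : Premodel (piExtensions A) P} (φ : F.Hom G) (i : ι)
    (b : ∀ j, C j) (e : (A i).Ext) {x y z : ∀ j, C j}
    (hz : z = update b i ((A i).quo e)) (hx : x = update b i ((A i).sub e))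
    (hy : y = update b i ((A i).mid e)) :
    F.addOf i b e hz hx hy ≫ φ.app y = (φ.app z ⊗ₘ φ.app x) ≫ G.addOf i b e hz hx hy := by
  subst hz hx hy
  rw [addOf_rfl, addOf_rfl]
  exact φ.add _

end

end Tail

end MultiDeterminant

end

noncomputable section

namespace MultiDeterminant

open Functor.LaxMonoidal Function

/-! ### Models in several variables as models in the first one. -/

section Curry

variable {n : ℕ} {C : Fin (n + 1) → Type u} [∀ i, Category.{v} (C i)]
variable {S : ∀ i, Signature.{u, v, w} (C i)}
variable {P : Type u'} [Category.{v'} P] [MonoidalCategory P] [SymmetricCategory P]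

/-- The restriction of a premodel in several variables to a fixed value of the first one. -/
abbrev Premodel.cons (F : Premodel (piSignature S).toExtensions P) (c : C 0) :
    Premodel (tailSignature S).toExtensions P where
  functor := consFunctor c ⋙ F.functor
  add e := F.addOf e.1.succ (Fin.cons c e.2.1) e.2.2 (Fin.cons_update _ _ _ _)
    (Fin.cons_update _ _ _ _) (Fin.cons_update _ _ _ _)

omit [SymmetricCategory P] in
theorem Premodel.cons_addOf (F : Premodel (piSignature S).toExtensions P) (c : C 0)
    (j : Fin n) (b : ∀ k : Fin n, C k.succ) (e : (S j.succ).Ext) {x y z : ∀ k : Fin n, C k.succ}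
    (hz : z = update b j ((S j.succ).quo e)) (hx : x = update b j ((S j.succ).sub e))
    (hy : y = update b j ((S j.succ).mid e)) :
    (F.cons c).addOf (A := fun k => (S k.succ).toExtensions) j b e hz hx hy =
      F.addOf j.succ (Fin.cons c b) e
        ((congrArg (Fin.cons c) hz).trans (Fin.cons_update _ _ _ _))
        ((congrArg (Fin.cons c) hx).trans (Fin.cons_update _ _ _ _))
        ((congrArg (Fin.cons c) hy).trans (Fin.cons_update _ _ _ _)) := by
  subst hz hx hy
  exact addOf_rfl _ _ _ _

theorem isIso_map_eqToHom {D E : Type*} [Category* D] [Category* E] (F : D ⥤ E) {x y : D}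
    (h : x = y) : IsIso (F.map (eqToHom h)) :=
  inferInstance

theorem eqToHom_square {D : Type*} [Category* D] {x x' y y' : D} {f : x ⟶ y} {g : x' ⟶ y'}
    {hx : x = x'} {hy : y = y'} (h : f ≫ eqToHom hy = eqToHom hx ≫ g) :
    g ≫ eqToHom hy.symm = eqToHom hx.symm ≫ f := by
  subst hx hy
  simpa using h.symm

omit [SymmetricCategory P] in
theorem Premodel.addOf_eqToHom {ι : Type} [DecidableEq ι] {C : ι → Type u}
    [∀ i, Category.{v} (C i)] {A : ∀ i, Extensions.{u, w} (C i)}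
    (F : Premodel (piExtensions A) P) (i : ι) (b : ∀ j, C j) (e : (A i).Ext) {x y z : ∀ j, C j}
    (hz : z = update b i ((A i).quo e)) (hx : x = update b i ((A i).sub e))
    (hy : y = update b i ((A i).mid e)) :
    F.addOf i b e hz hx hy ≫ F.functor.map (eqToHom hy) =
      (F.functor.map (eqToHom hz) ⊗ₘ F.functor.map (eqToHom hx)) ≫ F.add ⟨i, b, e⟩ := by
  subst hz hx hy
  simp [addOf_rfl]

omit [∀ i, Category.{v} (C i)] in
theorem cons_update_update (c : C 0) (b : ∀ k : Fin n, C k.succ) (i j : Fin n) (x : C i.succ)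
    (y : C j.succ) : (Fin.cons c (update (update b i x) j y) : ∀ k, C k) =
      update (update (Fin.cons c b) i.succ x) j.succ y := by
  rw [Fin.cons_update, Fin.cons_update]

omit [∀ i, Category.{v} (C i)] in
theorem cons_eq_update_update (c c₀ : C 0) (b : ∀ k : Fin n, C k.succ) (j : Fin n)
    (y : C j.succ) : (Fin.cons c (update b j y) : ∀ k, C k) =
      update (update (Fin.cons c₀ b) 0 c) j.succ y := by
  rw [Fin.cons_update, Fin.update_cons_zero]

namespace Model

theorem cons_eqToHom_updateHom (c c' : C 0) (g : c ⟶ c') (j : Fin n)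
    {b b' : ∀ k : Fin n, C k.succ} (φ : ∀ k, k ≠ j → (b k ⟶ b' k)) {x y : C j.succ} (f : x ⟶ y) :
    consHom (x := Fin.cons c (update b j x)) (y := Fin.cons c' (update b' j y)) g
        (updateHom j φ f) ≫ eqToHom (Fin.cons_update c' b' j y) =
      eqToHom (Fin.cons_update c b j x) ≫
        updateHom j.succ (b := Fin.cons c b) (b' := Fin.cons c' b')
          (Fin.cases (fun _ => g) fun k hk => φ k fun h => hk (congrArg _ h)) f := by
  exact eqToHom_square (updateHom_succ_comp j (b := Fin.cons c b) (b' := Fin.cons c' b')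
    (Fin.cases (fun _ => g) fun k hk => φ k fun h => hk (congrArg _ h)) f)

theorem cons_eqToHom_updateHom_zero (c c' c₀ c₀' : C 0) (f : c ⟶ c')
    {b b' : ∀ k : Fin n, C k.succ} (φ : ∀ k, b k ⟶ b' k)
    (ψ : ∀ k, k ≠ 0 → ((Fin.cons c₀ b : ∀ i, C i) k ⟶ (Fin.cons c₀' b' : ∀ i, C i) k))
    (h : ∀ k : Fin n, ψ k.succ (Fin.succ_ne_zero k) = φ k) :
    consHom (x := Fin.cons c b) (y := Fin.cons c' b') f φ ≫
        eqToHom (Fin.update_cons_zero c₀' b' c').symm =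
      eqToHom (Fin.update_cons_zero c₀ b c).symm ≫
        updateHom 0 (b := Fin.cons c₀ b) (b' := Fin.cons c₀' b') ψ f := by
  obtain rfl : (fun k => ψ k.succ (Fin.succ_ne_zero k)) = φ := funext h
  exact eqToHom_square (updateHom_zero_comp (b := Fin.cons c₀ b) (b' := Fin.cons c₀' b') ψ f)

/-- Each slice of the restricted premodel is isomorphic, by transport along `Fin.cons_update`, to a
slice of `F` at a successor index. Naturality and interchange are those of `F` in the
presentation-free form. -/
theorem satisfies_cons (F : Model (piSignature S) P) (c : C 0) :
    Premodel.Satisfies (tailSignature S) (F.toPremodel.cons c) := by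
  refine (Premodel.satisfies_pi_iff _).2 ⟨fun j b => ?_, fun j b b' φ e => ?_,
    fun i j hij h b e e' => ?_⟩
  · refine (F.satisfies_slice j.succ (Fin.cons c b)).of_hom'
      { app := fun x => F.functor.map (eqToHom (Fin.cons_update c b j x))
        naturality := fun f => ?_
        add := fun e => ?_ } fun _ => ?_
    · refine (F.functor.map_comp _ _).symm.trans (Eq.trans ?_ (F.functor.map_comp _ _))
      refine congrArg _ ((cons_eqToHom_updateHom c c (𝟙 c) j _ f).trans ?_)
      refine congrArg (_ ≫ updateHom j.succ · f) ?_
      funext k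
      exact Fin.cases rfl (fun _ => rfl) k
    · exact F.toPremodel.addOf_eqToHom j.succ (Fin.cons c b) e _ _ _
    · exact isIso_map_eqToHom F.functor _
  · exact F.isNatural.addOf j.succ _ e (cons_eqToHom_updateHom c c (𝟙 c) j φ _)
      (cons_eqToHom_updateHom c c (𝟙 c) j φ _) (cons_eqToHom_updateHom c c (𝟙 c) j φ _)
  · have hs : ∀ t, (F.toPremodel.cons c).addSwap h b e t = F.addOf i.succ _ e _ _ _ := fun t =>
      F.toPremodel.cons_addOf c i (update b j t) e (update_comm h _ _ _) (update_comm h _ _ _)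
        (update_comm h _ _ _)
    refine (congrArg₂ (fun s t => (s ⊗ₘ t) ≫ _) (hs _) (hs _)).trans
      (Eq.trans ?_ (congrArg (_ ≫ _ ≫ ·) (hs _).symm))
    exact F.isNatural.interchange
      (F.interchange i.succ j.succ fun h' => h (Fin.succ_injective _ h')) (Fin.cons c b)
      (e := e) (e' := e') (cons_update_update c b i j _ _) (cons_update_update c b i j _ _)
      (cons_update_update c b i j _ _) (cons_update_update c b i j _ _)
      (cons_update_update c b i j _ _) (cons_update_update c b i j _ _)
      (cons_update_update c b i j _ _) (cons_update_update c b i j _ _)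
      (cons_update_update c b i j _ _)
      (k₁ := Fin.cons_update _ _ _ _) (k₂ := Fin.cons_update _ _ _ _)
      (k₃ := Fin.cons_update _ _ _ _) (k₄ := Fin.cons_update _ _ _ _)
      (k₅ := Fin.cons_update _ _ _ _) (k₆ := Fin.cons_update _ _ _ _)
      (k₇ := Fin.cons_update _ _ _ _) (k₈ := Fin.cons_update _ _ _ _)
      (k₉ := Fin.cons_update _ _ _ _)

/-- Models in several variables as models in the first one. -/
abbrev curryPremodel (F : Model (piSignature S) P) :
    Premodel (S 0).toExtensions (Model (tailSignature S) P) where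
  functor :=
    { obj := fun c => ⟨F.toPremodel.cons c, F.satisfies_cons c⟩
      map := fun {c c'} f =>
        { app := fun b => F.functor.map (consHom (x := Fin.cons c b) (y := Fin.cons c' b) f
            fun _ => 𝟙 _)
          naturality := fun {x y} g => by
            refine (F.functor.map_comp _ _).symm.trans (Eq.trans ?_ (F.functor.map_comp _ _))
            refine congrArg _ (hom_ext_cons ?_ fun k => ?_)
            · exact (Category.id_comp f).trans (Category.comp_id f).symm
            · exact (Category.comp_id (g k)).trans (Category.id_comp (g k)).symm
          add := fun e => by
            have h : ∀ x, consHom (x := Fin.cons c (update e.2.1 e.1 x))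
                (y := Fin.cons c' (update e.2.1 e.1 x)) f (fun _ => 𝟙 _) =
                  consHom (x := Fin.cons c (update e.2.1 e.1 x))
                    (y := Fin.cons c' (update e.2.1 e.1 x)) f
                    (updateHom e.1 (fun k _ => 𝟙 (e.2.1 k)) (𝟙 x)) := fun x =>
              congrArg (consHom (x := Fin.cons c (update e.2.1 e.1 x))
                (y := Fin.cons c' (update e.2.1 e.1 x)) f) ((slice e.1 e.2.1).map_id x).symm
            rw [h, h, h]
            exact (F.isNatural.addOf e.1.succ _ e.2.2
              (cons_eqToHom_updateHom c c' f e.1 _ _) (cons_eqToHom_updateHom c c' f e.1 _ _)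
              (cons_eqToHom_updateHom c c' f e.1 _ _)).symm }
      map_id := fun c => hom_ext fun b => by
        refine Eq.trans (congrArg _ ?_) (F.functor.map_id _)
        exact hom_ext_cons rfl fun _ => rfl
      map_comp := fun f g => hom_ext fun b => by
        refine Eq.trans (congrArg _ ?_) (F.functor.map_comp _ _)
        exact hom_ext_cons rfl fun _ => (Category.comp_id _).symm }
  add e :=
    { app := fun b => F.addOf 0 (Fin.cons ((S 0).mid e) b) e
        (Fin.update_cons_zero ((S 0).mid e) b _).symm
        (Fin.update_cons_zero ((S 0).mid e) b _).symm
        (Fin.update_cons_zero ((S 0).mid e) b _).symm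
      naturality := fun {b b'} g => by
        exact F.isNatural.addOf 0 (b := Fin.cons ((S 0).mid e) b)
          (b' := Fin.cons ((S 0).mid e) b') (Fin.cases (fun h => (h rfl).elim) fun k _ => g k) e
          (cons_eqToHom_updateHom_zero _ _ _ _ _ g _ fun _ => rfl)
          (cons_eqToHom_updateHom_zero _ _ _ _ _ g _ fun _ => rfl)
          (cons_eqToHom_updateHom_zero _ _ _ _ _ g _ fun _ => rfl)
      -- That the addition in the first variable is a morphism of models in the other variables is
      -- the interchange law between the indices `0` and `e'.1.succ`.
      add := fun e' => by
        exact (Category.assoc _ _ _).trans (F.isNatural.interchange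
          (F.interchange 0 e'.1.succ (Fin.succ_ne_zero _).symm)
          (Fin.cons ((S 0).mid e) e'.2.1) (e := e) (e' := e'.2.2)
          (cons_eq_update_update _ _ _ _ _) (cons_eq_update_update _ _ _ _ _)
          (cons_eq_update_update _ _ _ _ _) (cons_eq_update_update _ _ _ _ _)
          (cons_eq_update_update _ _ _ _ _) (cons_eq_update_update _ _ _ _ _)
          (cons_eq_update_update _ _ _ _ _) (cons_eq_update_update _ _ _ _ _)
          (cons_eq_update_update _ _ _ _ _)
          (k₁ := Fin.cons_update _ _ _ _) (k₂ := Fin.cons_update _ _ _ _)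
          (k₃ := Fin.cons_update _ _ _ _) (k₄ := Fin.cons_update _ _ _ _)
          (k₅ := Fin.cons_update _ _ _ _) (k₆ := Fin.cons_update _ _ _ _)
          (k₇ := Fin.cons_update _ _ _ _) (k₈ := Fin.cons_update _ _ _ _)
          (k₉ := Fin.cons_update _ _ _ _)).symm }

/-- Models in several variables as models in the first one. -/
abbrev curry : Model (piSignature S) P ⥤ Model (S 0) (Model (tailSignature S) P) where
  obj F := ⟨curryPremodel F, Premodel.satisfies_of_post (ev _ P) ev_jointly_faithful fun b =>
    -- A slice of `F` in the first variable needs a base point, hence an object of `C 0`; if there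
    -- is none the laws are vacuous.
    Premodel.Satisfies.of_nonempty fun ⟨c₀⟩ => by
      refine (F.satisfies_slice 0 (Fin.cons c₀ b)).of_hom'
        { app := fun c => F.functor.map (eqToHom (Fin.update_cons_zero c₀ b c).symm)
          naturality := fun f => ?_
          add := fun e => ?_ } fun _ => ?_
      · refine (F.functor.map_comp _ _).symm.trans (Eq.trans ?_ (F.functor.map_comp _ _))
        exact congrArg _ (cons_eqToHom_updateHom_zero _ _ _ _ f (fun _ => 𝟙 _) _ fun _ => rfl)
      · refine (congrArg (· ≫ F.functor.map (eqToHom _)) ((Category.id_comp _).trans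
          (F.isNatural.addOf_eq (b := Fin.cons ((S 0).mid e) b) (Fin.cons c₀ b) (e := e)
            (hy := (Fin.update_cons_zero ((S 0).mid e) b _).symm)
            (Fin.update_cons_zero c₀ b _).symm (Fin.update_cons_zero c₀ b _).symm
            (Fin.update_cons_zero c₀ b _).symm))).trans ?_
        exact F.toPremodel.addOf_eqToHom 0 (Fin.cons c₀ b) e _ _ _
      · exact isIso_map_eqToHom F.functor _⟩
  map φ :=
    { app := fun c =>
        { app := fun b => app φ (Fin.cons c b)
          naturality := fun g => naturality φ _
          add := fun e => Premodel.Hom.addOf φ e.1.succ (Fin.cons c e.2.1) e.2.2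
            (Fin.cons_update _ _ _ _) (Fin.cons_update _ _ _ _) (Fin.cons_update _ _ _ _) }
      naturality := fun f => hom_ext fun b => naturality φ _
      add := fun e => hom_ext fun b =>
        Premodel.Hom.addOf φ 0 (Fin.cons ((S 0).mid e) b) e (Fin.update_cons_zero _ _ _).symm
          (Fin.update_cons_zero _ _ _).symm (Fin.update_cons_zero _ _ _).symm }
  map_id _ := hom_ext fun _ => hom_ext fun _ => rfl
  map_comp _ _ := hom_ext fun _ => hom_ext fun _ => rfl

end Model

end Curry

end MultiDeterminant

end

noncomputable section

namespace MultiDeterminant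

open Functor.LaxMonoidal Function

/-- Isolates the middle square in the functoriality of `uncurryFunctor`, where a change of the first
variable moves past a change of the others. -/
theorem comp_comp_comp_comp {D : Type*} [Category* D] {x y z z' t s : D} (a : x ⟶ y) {b : y ⟶ z}
    {c : z ⟶ t} {b' : y ⟶ z'} {c' : z' ⟶ t} (d : t ⟶ s) (h : b ≫ c = b' ≫ c') :
    (a ≫ b) ≫ c ≫ d = (a ≫ b') ≫ c' ≫ d := by
  rw [Category.assoc, reassoc_of% h, Category.assoc]

/-! ### The model in several variables assembled from a model with values in models. -/

section Uncurry

variable {n : ℕ} {C : Fin (n + 1) → Type u} [∀ i, Category.{v} (C i)]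
variable {S : ∀ i, Signature.{u, v, w} (C i)}
variable {P : Type u'} [Category.{v'} P] [MonoidalCategory P] [SymmetricCategory P]

namespace Model

variable (G : Model (S 0) (Model (tailSignature S) P))

/-- The functor of several variables underlying a model in the first variable with values in models
in the other ones. -/
def uncurryFunctor : (∀ i, C i) ⥤ P where
  obj b := (G.functor.obj (b 0)).functor.obj (Fin.tail b)
  map {b b'} f := (G.functor.obj (b 0)).functor.map (X := Fin.tail b) (Y := Fin.tail b')
    (fun k => f k.succ) ≫ app (G.functor.map (f 0)) (Fin.tail b')
  map_id b := by
    change (G.functor.obj (b 0)).functor.map (𝟙 (Fin.tail b)) ≫ app (G.functor.map (𝟙 (b 0))) _ = _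
    rw [(G.functor.obj (b 0)).functor.map_id, G.functor.map_id]
    exact Category.id_comp _
  map_comp {b b' b''} f g := by
    have h := (G.functor.obj (b 0)).functor.map_comp (X := Fin.tail b) (Y := Fin.tail b')
      (Z := Fin.tail b'') (fun k => f k.succ) (fun k => g k.succ)
    have h' := congrArg (app · (Fin.tail b'')) (G.functor.map_comp (f 0) (g 0))
    exact (congrArg₂ (· ≫ ·) h h').trans (comp_comp_comp_comp _ _
      (naturality (G.functor.map (f 0)) (x := Fin.tail b') (y := Fin.tail b'') fun k => g k.succ))

theorem uncurryFunctor_map_consHom_id {c : C 0} {b b' : ∀ k : Fin n, C k.succ} (g : b ⟶ b') :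
    G.uncurryFunctor.map (consHom (x := Fin.cons c b) (y := Fin.cons c b') (𝟙 c) g) =
      (G.functor.obj c).functor.map g := by
  refine (congrArg (fun h => _ ≫ app h b') (G.functor.map_id c)).trans ?_
  exact Category.comp_id _

theorem uncurryFunctor_map_consHom {c c' : C 0} {b : ∀ k : Fin n, C k.succ} (f : c ⟶ c') :
    G.uncurryFunctor.map (consHom (x := Fin.cons c b) (y := Fin.cons c' b) f fun _ => 𝟙 _) =
      app (G.functor.map f) b := by
  refine (congrArg (· ≫ app (G.functor.map f) b) ((G.functor.obj c).functor.map_id b)).trans ?_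
  exact Category.id_comp _

/-- The addition in the first variable, transported along equalities of objects. -/
def uncurryAddZero (e : (S 0).Ext) (b : ∀ k : Fin n, C k.succ) {x y z : ∀ i, C i}
    (hz : z = Fin.cons ((S 0).quo e) b) (hx : x = Fin.cons ((S 0).sub e) b)
    (hy : y = Fin.cons ((S 0).mid e) b) :
    G.uncurryFunctor.obj z ⊗ G.uncurryFunctor.obj x ⟶ G.uncurryFunctor.obj y :=
  (G.uncurryFunctor.map (eqToHom hz) ⊗ₘ G.uncurryFunctor.map (eqToHom hx)) ≫
    app (G.add e) b ≫ G.uncurryFunctor.map (X := Fin.cons ((S 0).mid e) b) (eqToHom hy.symm)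

/-- The addition in the other variables, transported along equalities of objects. -/
def uncurryAddSucc (c : C 0) (e : (tailSignature S).Ext) {x y z : ∀ i, C i}
    (hz : z = Fin.cons c ((tailSignature S).quo e)) (hx : x = Fin.cons c ((tailSignature S).sub e))
    (hy : y = Fin.cons c ((tailSignature S).mid e)) :
    G.uncurryFunctor.obj z ⊗ G.uncurryFunctor.obj x ⟶ G.uncurryFunctor.obj y :=
  (G.uncurryFunctor.map (eqToHom hz) ⊗ₘ G.uncurryFunctor.map (eqToHom hx)) ≫
    (G.functor.obj c).add e ≫
      G.uncurryFunctor.map (X := Fin.cons c ((tailSignature S).mid e)) (eqToHom hy.symm)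

theorem uncurryAddZero_rfl (e : (S 0).Ext) (b : ∀ k : Fin n, C k.succ) :
    G.uncurryAddZero e b rfl rfl rfl = app (G.add e) b := by
  dsimp only [uncurryAddZero, eqToHom_refl]
  rw [G.uncurryFunctor.map_id, G.uncurryFunctor.map_id, G.uncurryFunctor.map_id, id_tensorHom_id]
  exact (Category.id_comp _).trans (Category.comp_id _)

theorem uncurryAddSucc_rfl (c : C 0) (e : (tailSignature S).Ext) :
    G.uncurryAddSucc c e rfl rfl rfl = (G.functor.obj c).add e := by
  dsimp only [uncurryAddSucc, eqToHom_refl]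
  rw [G.uncurryFunctor.map_id, G.uncurryFunctor.map_id, G.uncurryFunctor.map_id, id_tensorHom_id]
  exact (Category.id_comp _).trans (Category.comp_id _)

/-- The premodel of several variables underlying a model in the first variable with values in
models in the other ones. -/
abbrev uncurryPremodel : Premodel (piSignature S).toExtensions P where
  functor := G.uncurryFunctor
  add e := Fin.cases (motive := fun i => ∀ (b : ∀ j, C j) (e : (S i).Ext),
      G.uncurryFunctor.obj (update b i ((S i).quo e)) ⊗
        G.uncurryFunctor.obj (update b i ((S i).sub e)) ⟶
          G.uncurryFunctor.obj (update b i ((S i).mid e)))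
    (fun b e => G.uncurryAddZero e (Fin.tail b) (update_zero_eq_cons _ _)
      (update_zero_eq_cons _ _) (update_zero_eq_cons _ _))
    (fun j b e => G.uncurryAddSucc (b 0) ⟨j, Fin.tail b, e⟩ (update_succ_eq_cons _ _ _)
      (update_succ_eq_cons _ _ _) (update_succ_eq_cons _ _ _)) e.1 e.2.1 e.2.2

theorem uncurryPremodel_addOf_zero (b : ∀ i, C i) (e : (S 0).Ext) {x y z : ∀ j, C j}
    (hz : z = update b 0 ((S 0).quo e)) (hx : x = update b 0 ((S 0).sub e))
    (hy : y = update b 0 ((S 0).mid e)) :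
    G.uncurryPremodel.addOf 0 b e hz hx hy = G.uncurryAddZero e (Fin.tail b)
      (hz.trans (update_zero_eq_cons _ _)) (hx.trans (update_zero_eq_cons _ _))
      (hy.trans (update_zero_eq_cons _ _)) := by
  subst hz hx hy
  exact Premodel.addOf_rfl _ _ _ _

theorem uncurryPremodel_addOf_succ (j : Fin n) (b : ∀ i, C i) (e : (S j.succ).Ext)
    {x y z : ∀ j, C j} (hz : z = update b j.succ ((S j.succ).quo e))
    (hx : x = update b j.succ ((S j.succ).sub e)) (hy : y = update b j.succ ((S j.succ).mid e)) :
    G.uncurryPremodel.addOf j.succ b e hz hx hy = G.uncurryAddSucc (b 0) ⟨j, Fin.tail b, e⟩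
      (hz.trans (update_succ_eq_cons _ _ _)) (hx.trans (update_succ_eq_cons _ _ _))
      (hy.trans (update_succ_eq_cons _ _ _)) := by
  subst hz hx hy
  exact Premodel.addOf_rfl _ _ _ _

/-- After the transports are removed this is the naturality of `G.add e`, which is a morphism of
models in the other variables. -/
theorem uncurryAddZero_natural (e : (S 0).Ext) {b b' : ∀ k : Fin n, C k.succ} (φ : b ⟶ b')
    {x y z x' y' z' : ∀ i, C i}
    {hz : z = Fin.cons ((S 0).quo e) b} {hx : x = Fin.cons ((S 0).sub e) b}
    {hy : y = Fin.cons ((S 0).mid e) b} {hz' : z' = Fin.cons ((S 0).quo e) b'}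
    {hx' : x' = Fin.cons ((S 0).sub e) b'} {hy' : y' = Fin.cons ((S 0).mid e) b'}
    {fz : z ⟶ z'} {fx : x ⟶ x'} {fy : y ⟶ y'}
    (wz : fz ≫ eqToHom hz' = eqToHom hz ≫ consHom (x := Fin.cons ((S 0).quo e) b)
      (y := Fin.cons ((S 0).quo e) b') (𝟙 _) φ)
    (wx : fx ≫ eqToHom hx' = eqToHom hx ≫ consHom (x := Fin.cons ((S 0).sub e) b)
      (y := Fin.cons ((S 0).sub e) b') (𝟙 _) φ)
    (wy : fy ≫ eqToHom hy' = eqToHom hy ≫ consHom (x := Fin.cons ((S 0).mid e) b)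
      (y := Fin.cons ((S 0).mid e) b') (𝟙 _) φ) :
    (G.uncurryFunctor.map fz ⊗ₘ G.uncurryFunctor.map fx) ≫ G.uncurryAddZero e b' hz' hx' hy' =
      G.uncurryAddZero e b hz hx hy ≫ G.uncurryFunctor.map fy := by
  subst hz hx hy hz' hx' hy'
  simp only [eqToHom_refl, Category.comp_id, Category.id_comp] at wz wx wy
  subst wz wx wy
  rw [uncurryAddZero_rfl, uncurryAddZero_rfl]
  exact (congrArg₂ (fun s t => (s ⊗ₘ t) ≫ _) (G.uncurryFunctor_map_consHom_id φ)
    (G.uncurryFunctor_map_consHom_id φ)).trans ((naturality (G.add e) φ).trans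
      (congrArg (_ ≫ ·) (G.uncurryFunctor_map_consHom_id φ).symm))

/-- Combines two facts: the model `G.functor.obj c` has additions natural in its variables, and the
morphism `G.functor.map f` is compatible with additions. -/
theorem uncurryAddSucc_natural {c c' : C 0} (f : c ⟶ c') (j : Fin n) (e : (S j.succ).Ext)
    {b b' : ∀ k : Fin n, C k.succ} (φ : ∀ k, k ≠ j → (b k ⟶ b' k))
    {x y z x' y' z' : ∀ i, C i}
    {hz : z = Fin.cons c (update b j ((S j.succ).quo e))}
    {hx : x = Fin.cons c (update b j ((S j.succ).sub e))}
    {hy : y = Fin.cons c (update b j ((S j.succ).mid e))}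
    {hz' : z' = Fin.cons c' (update b' j ((S j.succ).quo e))}
    {hx' : x' = Fin.cons c' (update b' j ((S j.succ).sub e))}
    {hy' : y' = Fin.cons c' (update b' j ((S j.succ).mid e))}
    {fz : z ⟶ z'} {fx : x ⟶ x'} {fy : y ⟶ y'}
    (wz : fz ≫ eqToHom hz' = eqToHom hz ≫ consHom (x := Fin.cons c (update b j _))
      (y := Fin.cons c' (update b' j _)) f (updateHom j φ (𝟙 ((S j.succ).quo e))))
    (wx : fx ≫ eqToHom hx' = eqToHom hx ≫ consHom (x := Fin.cons c (update b j _))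
      (y := Fin.cons c' (update b' j _)) f (updateHom j φ (𝟙 ((S j.succ).sub e))))
    (wy : fy ≫ eqToHom hy' = eqToHom hy ≫ consHom (x := Fin.cons c (update b j _))
      (y := Fin.cons c' (update b' j _)) f (updateHom j φ (𝟙 ((S j.succ).mid e)))) :
    (G.uncurryFunctor.map fz ⊗ₘ G.uncurryFunctor.map fx) ≫
        G.uncurryAddSucc c' ⟨j, b', e⟩ hz' hx' hy' =
      G.uncurryAddSucc c ⟨j, b, e⟩ hz hx hy ≫ G.uncurryFunctor.map fy := by
  subst hz hx hy hz' hx' hy'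
  simp only [eqToHom_refl, Category.comp_id, Category.id_comp] at wz wx wy
  subst wz wx wy
  rw [uncurryAddSucc_rfl, uncurryAddSucc_rfl]
  have h := (G.functor.obj c).isNatural j b b' φ e
  have h' := add_app (G.functor.map f) (⟨j, b', e⟩ : (tailSignature S).Ext)
  refine (congrArg (· ≫ _) (tensorHom_comp_tensorHom _ _ _ _).symm).trans ?_
  refine (Category.assoc _ _ _).trans ?_
  refine (congrArg (_ ≫ ·) h'.symm).trans ?_
  exact (Category.assoc _ _ _).symm.trans ((congrArg (· ≫ _) h).trans (Category.assoc _ _ _))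

theorem uncurryAddZero_eqToHom (e : (S 0).Ext) (b : ∀ k : Fin n, C k.succ) {x y z : ∀ i, C i}
    (hz : z = Fin.cons ((S 0).quo e) b) (hx : x = Fin.cons ((S 0).sub e) b)
    (hy : y = Fin.cons ((S 0).mid e) b) :
    G.uncurryAddZero e b hz hx hy ≫ G.uncurryFunctor.map (eqToHom hy) =
      (G.uncurryFunctor.map (eqToHom hz) ⊗ₘ G.uncurryFunctor.map (eqToHom hx)) ≫
        app (G.add e) b := by
  subst hz hx hy
  rw [uncurryAddZero_rfl]
  dsimp only [eqToHom_refl]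
  rw [G.uncurryFunctor.map_id, G.uncurryFunctor.map_id, G.uncurryFunctor.map_id, id_tensorHom_id]
  exact (Category.comp_id _).trans (Category.id_comp _).symm

theorem uncurryAddSucc_eqToHom (c : C 0) (e : (tailSignature S).Ext) {x y z : ∀ i, C i}
    (hz : z = Fin.cons c ((tailSignature S).quo e)) (hx : x = Fin.cons c ((tailSignature S).sub e))
    (hy : y = Fin.cons c ((tailSignature S).mid e)) :
    G.uncurryAddSucc c e hz hx hy ≫ G.uncurryFunctor.map (eqToHom hy) =
      (G.uncurryFunctor.map (eqToHom hz) ⊗ₘ G.uncurryFunctor.map (eqToHom hx)) ≫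
        (G.functor.obj c).add e := by
  subst hz hx hy
  rw [uncurryAddSucc_rfl]
  dsimp only [eqToHom_refl]
  rw [G.uncurryFunctor.map_id, G.uncurryFunctor.map_id, G.uncurryFunctor.map_id, id_tensorHom_id]
  exact (Category.comp_id _).trans (Category.id_comp _).symm

theorem uncurryAddZero_congr (e : (S 0).Ext) {b b' : ∀ k : Fin n, C k.succ} (h : b = b')
    {x y z : ∀ i, C i}
    (hz : z = Fin.cons ((S 0).quo e) b) (hx : x = Fin.cons ((S 0).sub e) b)
    (hy : y = Fin.cons ((S 0).mid e) b) :
    G.uncurryAddZero e b hz hx hy = G.uncurryAddZero e b' (h ▸ hz) (h ▸ hx) (h ▸ hy) := by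
  subst h
  rfl

theorem uncurryAddSucc_congr {c c' : C 0} (hc : c = c') (j : Fin n) (e : (S j.succ).Ext)
    {b b' : ∀ k : Fin n, C k.succ} (h : b = b') {x y z : ∀ i, C i}
    (hz : z = Fin.cons c (update b j ((S j.succ).quo e)))
    (hx : x = Fin.cons c (update b j ((S j.succ).sub e)))
    (hy : y = Fin.cons c (update b j ((S j.succ).mid e))) :
    G.uncurryAddSucc c ⟨j, b, e⟩ hz hx hy =
      G.uncurryAddSucc c' ⟨j, b', e⟩ (hc ▸ h ▸ hz) (hc ▸ h ▸ hx) (hc ▸ h ▸ hy) := by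
  subst h hc
  rfl

theorem uncurryAddSucc_addOf (c : C 0) (j : Fin n) (e : (S j.succ).Ext)
    (b : ∀ k : Fin n, C k.succ) {x y z : ∀ k : Fin n, C k.succ}
    (hz : z = update b j ((S j.succ).quo e)) (hx : x = update b j ((S j.succ).sub e))
    (hy : y = update b j ((S j.succ).mid e)) :
    G.uncurryAddSucc c ⟨j, b, e⟩ (congrArg (Fin.cons c) hz) (congrArg (Fin.cons c) hx)
        (congrArg (Fin.cons c) hy) =
      (G.functor.obj c).addOf (A := fun k => (S k.succ).toExtensions) j b e hz hx hy := by
  subst hz hx hy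
  rw [Premodel.addOf_rfl]
  exact G.uncurryAddSucc_rfl c ⟨j, b, e⟩

/-- This is the compatibility of the morphism `G.add e` with additions. Its source is a pointwise
sum of models, which is where the exchange comes from. -/
theorem uncurryAddZero_interchange (e : (S 0).Ext) (e' : (tailSignature S).Ext)
    {ozz ozx ozy oxz oxx oxy oyz oyx oyy : ∀ k, C k}
    (hzz : ozz = Fin.cons ((S 0).quo e) ((tailSignature S).quo e'))
    (hzx : ozx = Fin.cons ((S 0).quo e) ((tailSignature S).sub e'))
    (hzy : ozy = Fin.cons ((S 0).quo e) ((tailSignature S).mid e'))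
    (hxz : oxz = Fin.cons ((S 0).sub e) ((tailSignature S).quo e'))
    (hxx : oxx = Fin.cons ((S 0).sub e) ((tailSignature S).sub e'))
    (hxy : oxy = Fin.cons ((S 0).sub e) ((tailSignature S).mid e'))
    (hyz : oyz = Fin.cons ((S 0).mid e) ((tailSignature S).quo e'))
    (hyx : oyx = Fin.cons ((S 0).mid e) ((tailSignature S).sub e'))
    (hyy : oyy = Fin.cons ((S 0).mid e) ((tailSignature S).mid e')) :
    (G.uncurryAddZero e _ hzz hxz hyz ⊗ₘ G.uncurryAddZero e _ hzx hxx hyx) ≫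
        G.uncurryAddSucc _ e' hyz hyx hyy =
      tensorμ _ _ _ _ ≫ (G.uncurryAddSucc _ e' hzz hzx hzy ⊗ₘ G.uncurryAddSucc _ e' hxz hxx hxy) ≫
        G.uncurryAddZero e _ hzy hxy hyy := by
  subst hzz hzx hzy hxz hxx hxy hyz hyx hyy
  rw [uncurryAddZero_rfl, uncurryAddZero_rfl, uncurryAddZero_rfl, uncurryAddSucc_rfl,
    uncurryAddSucc_rfl, uncurryAddSucc_rfl]
  exact (add_app (G.add e) e').symm.trans (Category.assoc _ _ _)

theorem uncurryAddSucc_interchange (c : C 0) {i j : Fin n} (h : i ≠ j)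
    (b : ∀ k : Fin n, C k.succ) (e : (S i.succ).Ext) (e' : (S j.succ).Ext)
    {ozz ozx ozy oxz oxx oxy oyz oyx oyy : ∀ k, C k}
    (hzz : ozz = Fin.cons c (update (update b i ((S i.succ).quo e)) j ((S j.succ).quo e')))
    (hzx : ozx = Fin.cons c (update (update b i ((S i.succ).quo e)) j ((S j.succ).sub e')))
    (hzy : ozy = Fin.cons c (update (update b i ((S i.succ).quo e)) j ((S j.succ).mid e')))
    (hxz : oxz = Fin.cons c (update (update b i ((S i.succ).sub e)) j ((S j.succ).quo e')))
    (hxx : oxx = Fin.cons c (update (update b i ((S i.succ).sub e)) j ((S j.succ).sub e')))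
    (hxy : oxy = Fin.cons c (update (update b i ((S i.succ).sub e)) j ((S j.succ).mid e')))
    (hyz : oyz = Fin.cons c (update (update b i ((S i.succ).mid e)) j ((S j.succ).quo e')))
    (hyx : oyx = Fin.cons c (update (update b i ((S i.succ).mid e)) j ((S j.succ).sub e')))
    (hyy : oyy = Fin.cons c (update (update b i ((S i.succ).mid e)) j ((S j.succ).mid e'))) :
    (G.uncurryAddSucc c ⟨i, update b j _, e⟩
          (hzz.trans (congrArg _ (update_comm h _ _ _)))
          (hxz.trans (congrArg _ (update_comm h _ _ _)))
          (hyz.trans (congrArg _ (update_comm h _ _ _))) ⊗ₘ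
        G.uncurryAddSucc c ⟨i, update b j _, e⟩
          (hzx.trans (congrArg _ (update_comm h _ _ _)))
          (hxx.trans (congrArg _ (update_comm h _ _ _)))
          (hyx.trans (congrArg _ (update_comm h _ _ _)))) ≫
        G.uncurryAddSucc c ⟨j, update b i _, e'⟩ hyz hyx hyy =
      tensorμ _ _ _ _ ≫
        (G.uncurryAddSucc c ⟨j, update b i _, e'⟩ hzz hzx hzy ⊗ₘ
          G.uncurryAddSucc c ⟨j, update b i _, e'⟩ hxz hxx hxy) ≫
        G.uncurryAddSucc c ⟨i, update b j _, e⟩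
          (hzy.trans (congrArg _ (update_comm h _ _ _)))
          (hxy.trans (congrArg _ (update_comm h _ _ _)))
          (hyy.trans (congrArg _ (update_comm h _ _ _))) := by
  subst hzz hzx hzy hxz hxx hxy hyz hyx hyy
  have hj : ∀ x, G.uncurryAddSucc c ⟨j, update b i x, e'⟩ rfl rfl rfl =
      (G.functor.obj c).addOf (A := fun k => (S k.succ).toExtensions) j (update b i x) e' rfl rfl
        rfl := fun x => G.uncurryAddSucc_addOf c j e' _ rfl rfl rfl
  have hi : ∀ t, G.uncurryAddSucc c ⟨i, update b j t, e⟩ (congrArg _ (update_comm h _ _ _))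
      (congrArg _ (update_comm h _ _ _)) (congrArg _ (update_comm h _ _ _)) =
      (G.functor.obj c).addOf (A := fun k => (S k.succ).toExtensions) i (update b j t) e
        (update_comm h _ _ _) (update_comm h _ _ _) (update_comm h _ _ _) :=
    fun t => G.uncurryAddSucc_addOf c i e _ _ _ _
  refine (congrArg₂ (· ≫ ·) (congrArg₂ (· ⊗ₘ ·) (hi _) (hi _)) (hj _)).trans (Eq.trans ?_
    (congrArg (tensorμ _ _ _ _ ≫ ·)
      (congrArg₂ (· ≫ ·) (congrArg₂ (· ⊗ₘ ·) (hj _) (hj _)) (hi _))).symm)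
  exact (G.functor.obj c).isNatural.interchange ((G.functor.obj c).interchange i j h) b
    rfl rfl rfl rfl rfl rfl rfl rfl rfl

omit [∀ i, Category.{v} (C i)] in
theorem tail_update_succ (b : ∀ i, C i) (j : Fin n) (x : C j.succ) :
    Fin.tail (update b j.succ x) = update (Fin.tail b) j x :=
  Fin.tail_update_succ _ _ _

/-- Laws of the first variable come from `G` after evaluation at the other variables, laws of the
others from the values of `G`. Mixed interchange holds because `G.add e` is a morphism of models. -/
theorem satisfies_uncurry : Premodel.Satisfies (piSignature S) G.uncurryPremodel := by
  refine (Premodel.satisfies_pi_iff _).2 ⟨Fin.cases (fun b => ?_) (fun j b => ?_),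
    Fin.cases (fun b b' φ e => ?_) (fun j b b' φ e => ?_),
    -- The law is only required for increasing pairs of indices, so the second index is always a
    -- successor and just two cases remain.
    Fin.cases (Fin.cases (fun hij => (lt_irrefl _ hij).elim) (fun j _ h b e e' => ?_))
      fun i => Fin.cases (fun hij => (Fin.not_lt_zero _ hij).elim) (fun j _ h b e e' => ?_)⟩
  · refine (G.satisfies.post (ev (tailSignature S) P (Fin.tail b))).of_hom'
      { app := fun c => G.uncurryFunctor.map (eqToHom (update_zero_eq_cons b c))
        naturality := fun f => ?_
        add := fun e => ?_ } fun _ => ?_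
    · refine (G.uncurryFunctor.map_comp _ _).symm.trans ?_
      refine (congrArg _ (updateHom_zero_comp _ f)).trans ?_
      exact (G.uncurryFunctor.map_comp _ _).trans
        (congrArg (_ ≫ ·) (G.uncurryFunctor_map_consHom f))
    · exact (G.uncurryAddZero_eqToHom e (Fin.tail b) _ _ _).trans
        (congrArg (_ ≫ ·) (Category.id_comp _).symm)
    · exact isIso_map_eqToHom G.uncurryFunctor _
  · refine ((G.functor.obj (b 0)).satisfies_slice j (Fin.tail b)).of_hom'
      { app := fun x => G.uncurryFunctor.map (eqToHom (update_succ_eq_cons b j x))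
        naturality := fun f => ?_
        add := fun e => ?_ } fun _ => ?_
    · refine (G.uncurryFunctor.map_comp _ _).symm.trans ?_
      refine (congrArg _ (updateHom_succ_comp j _ f)).trans ?_
      exact (G.uncurryFunctor.map_comp _ _).trans
        (congrArg (_ ≫ ·) (G.uncurryFunctor_map_consHom_id _))
    · exact G.uncurryAddSucc_eqToHom (b 0) ⟨j, Fin.tail b, e⟩ _ _ _
    · exact isIso_map_eqToHom G.uncurryFunctor _
  · exact G.uncurryAddZero_natural e (b := Fin.tail b) (b' := Fin.tail b')
      (fun k => φ k.succ (Fin.succ_ne_zero k)) (updateHom_zero_comp φ _) (updateHom_zero_comp φ _)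
      (updateHom_zero_comp φ _)
  · exact G.uncurryAddSucc_natural (φ 0 (Fin.succ_ne_zero j).symm) j e (b := Fin.tail b)
      (b' := Fin.tail b') (fun k hk => φ k.succ fun h => hk (Fin.succ_injective _ h))
      (updateHom_succ_comp j φ _) (updateHom_succ_comp j φ _) (updateHom_succ_comp j φ _)
  · have hw : ∀ x t, update (update b 0 x) j.succ t =
        Fin.cons x (update (Fin.tail b) j t) := fun x t => by
      rw [update_zero_eq_cons, Fin.cons_update]
    have hj : ∀ x, G.uncurryPremodel.add ⟨j.succ, update b 0 x, e'⟩ =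
        G.uncurryAddSucc x ⟨j, Fin.tail b, e'⟩ (hw _ _) (hw _ _) (hw _ _) := fun x =>
      G.uncurryAddSucc_congr (c := update b 0 x 0) (update_self 0 x b) j e'
        (Fin.tail_update_zero b x) (update_succ_eq_cons (update b 0 x) j _)
        (update_succ_eq_cons (update b 0 x) j _) (update_succ_eq_cons (update b 0 x) j _)
    have hi : ∀ t, G.uncurryPremodel.addSwap h b e t =
        G.uncurryAddZero e (update (Fin.tail b) j t) (hw _ _) (hw _ _) (hw _ _) := fun t =>
      (G.uncurryPremodel_addOf_zero (update b j.succ t) e (update_comm h _ _ _)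
        (update_comm h _ _ _) (update_comm h _ _ _)).trans
        (G.uncurryAddZero_congr e (tail_update_succ b j t) _ _ _)
    refine (congrArg₂ (· ≫ ·) (congrArg₂ (· ⊗ₘ ·) (hi _) (hi _)) (hj _)).trans (Eq.trans ?_
      (congrArg (tensorμ _ _ _ _ ≫ ·)
        (congrArg₂ (· ≫ ·) (congrArg₂ (· ⊗ₘ ·) (hj _) (hj _)) (hi _))).symm)
    exact G.uncurryAddZero_interchange e ⟨j, Fin.tail b, e'⟩ _ _ _ _ _ _ _ _ _
  · have hne : i ≠ j := fun h' => h (congrArg _ h')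
    have hw : ∀ x t, update (update b i.succ x) j.succ t =
        Fin.cons (b 0) (update (update (Fin.tail b) i x) j t) := fun x t =>
      (congrArg (update · j.succ t) (update_succ_eq_cons b i x)).trans
        (Fin.cons_update _ _ _ _).symm
    have hj : ∀ x, G.uncurryPremodel.add ⟨j.succ, update b i.succ x, e'⟩ =
        G.uncurryAddSucc (b 0) ⟨j, update (Fin.tail b) i x, e'⟩ (hw _ _) (hw _ _) (hw _ _) :=
      fun x => G.uncurryAddSucc_congr (c := update b i.succ x 0)
        (update_of_ne (Fin.succ_ne_zero i).symm x b) j e' (tail_update_succ b i x)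
        (update_succ_eq_cons (update b i.succ x) j _) (update_succ_eq_cons (update b i.succ x) j _)
        (update_succ_eq_cons (update b i.succ x) j _)
    have hi : ∀ t, G.uncurryPremodel.addSwap h b e t =
        G.uncurryAddSucc (b 0) ⟨i, update (Fin.tail b) j t, e⟩
          ((hw _ _).trans (congrArg _ (update_comm hne _ _ _)))
          ((hw _ _).trans (congrArg _ (update_comm hne _ _ _)))
          ((hw _ _).trans (congrArg _ (update_comm hne _ _ _))) := fun t =>
      (G.uncurryPremodel_addOf_succ i (update b j.succ t) e (update_comm h _ _ _)
        (update_comm h _ _ _) (update_comm h _ _ _)).trans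
        (G.uncurryAddSucc_congr (update_of_ne (Fin.succ_ne_zero j).symm _ _) i e
          (tail_update_succ b j t) _ _ _)
    refine (congrArg₂ (· ≫ ·) (congrArg₂ (· ⊗ₘ ·) (hi _) (hi _)) (hj _)).trans (Eq.trans ?_
      (congrArg (tensorμ _ _ _ _ ≫ ·)
        (congrArg₂ (· ≫ ·) (congrArg₂ (· ⊗ₘ ·) (hj _) (hj _)) (hi _))).symm)
    exact G.uncurryAddSucc_interchange (b 0) hne (Fin.tail b) e e' _ _ _ _ _ _ _ _ _

end Model

end Uncurry

end MultiDeterminant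

end

noncomputable section

namespace MultiDeterminant

open Functor.LaxMonoidal Function

/-! ### Currying is an equivalence. -/

section Uncurry

variable {n : ℕ} {C : Fin (n + 1) → Type u} [∀ i, Category.{v} (C i)]
variable {S : ∀ i, Signature.{u, v, w} (C i)}
variable {P : Type u'} [Category.{v'} P] [MonoidalCategory P] [SymmetricCategory P]

namespace Model

/-- The components of a morphism of models with values in models. -/
abbrev app₂ {G G' : Model (S 0) (Model (tailSignature S) P)} (φ : G ⟶ G') (c : C 0)
    (b : ∀ k : Fin n, C k.succ) :
    (G.functor.obj c).functor.obj b ⟶ (G'.functor.obj c).functor.obj b :=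
  app (app φ c) b

theorem uncurryAddZero_app {G G' : Model (S 0) (Model (tailSignature S) P)} (φ : G ⟶ G')
    (e : (S 0).Ext) (b : ∀ k : Fin n, C k.succ) {x y z : ∀ i, C i}
    (hz : z = Fin.cons ((S 0).quo e) b) (hx : x = Fin.cons ((S 0).sub e) b)
    (hy : y = Fin.cons ((S 0).mid e) b) :
    G.uncurryAddZero e b hz hx hy ≫ app₂ φ (y 0) (Fin.tail y) =
      (app₂ φ (z 0) (Fin.tail z) ⊗ₘ app₂ φ (x 0) (Fin.tail x)) ≫
        G'.uncurryAddZero e b hz hx hy := by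
  subst hz hx hy
  rw [uncurryAddZero_rfl, uncurryAddZero_rfl]
  exact congrArg (app · b) (add_app φ e)

theorem uncurryAddSucc_app {G G' : Model (S 0) (Model (tailSignature S) P)} (φ : G ⟶ G')
    (c : C 0) (e : (tailSignature S).Ext) {x y z : ∀ i, C i}
    (hz : z = Fin.cons c ((tailSignature S).quo e)) (hx : x = Fin.cons c ((tailSignature S).sub e))
    (hy : y = Fin.cons c ((tailSignature S).mid e)) :
    G.uncurryAddSucc c e hz hx hy ≫ app₂ φ (y 0) (Fin.tail y) =
      (app₂ φ (z 0) (Fin.tail z) ⊗ₘ app₂ φ (x 0) (Fin.tail x)) ≫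
        G'.uncurryAddSucc c e hz hx hy := by
  subst hz hx hy
  rw [uncurryAddSucc_rfl, uncurryAddSucc_rfl]
  exact add_app (app φ c) e

/-- Models in the first variable with values in models in the other ones as models in several
variables. -/
abbrev uncurry : Model (S 0) (Model (tailSignature S) P) ⥤ Model (piSignature S) P where
  obj G := ⟨G.uncurryPremodel, G.satisfies_uncurry⟩
  map {G G'} φ :=
    { app := fun b => app₂ φ (b 0) (Fin.tail b)
      naturality := fun {b b'} f => by
        refine (Category.assoc _ _ _).trans ?_
        refine (congrArg (_ ≫ ·) (congrArg (app · (Fin.tail b')) (naturality φ (f 0)))).trans ?_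
        refine (Category.assoc _ _ _).symm.trans ?_
        refine (congrArg (· ≫ _) (naturality (app φ (b 0)) (x := Fin.tail b) (y := Fin.tail b')
          fun k => f k.succ)).trans ?_
        exact Category.assoc _ _ _
      add := fun ⟨i, b, e⟩ => by
        revert b e
        refine Fin.cases (fun b e => ?_) (fun j b e => ?_) i
        · exact uncurryAddZero_app φ e (Fin.tail b) (update_zero_eq_cons b _)
            (update_zero_eq_cons b _) (update_zero_eq_cons b _)
        · exact uncurryAddSucc_app φ (b 0) ⟨j, Fin.tail b, e⟩ (update_succ_eq_cons b j _)
            (update_succ_eq_cons b j _) (update_succ_eq_cons b j _) }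
  map_id _ := hom_ext fun _ => rfl
  map_comp _ _ := hom_ext fun _ => rfl

instance : (uncurry (S := S) (P := P)).Faithful where
  map_injective h := hom_ext fun c => hom_ext fun b =>
    congrArg (fun χ => Premodel.Hom.app χ (Fin.cons c b)) h

/-- The two layers of structure are recovered by testing the given morphism on maps that change only
the first variable, or only the others, and on each kind of addition. -/
instance : (uncurry (S := S) (P := P)).Full where
  map_surjective {G G'} φ := by
    have hφ : ∀ (x y : ∀ i, C i) (f : x ⟶ y),
      G.uncurryFunctor.map f ≫ φ.app y = φ.app x ≫ G'.uncurryFunctor.map f := fun x y f =>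
        φ.naturality f
    have h₁ : ∀ (c : C 0) {b b' : ∀ k : Fin n, C k.succ} (g : b ⟶ b'),
        (G.functor.obj c).functor.map g ≫ φ.app (Fin.cons c b') =
          φ.app (Fin.cons c b) ≫ (G'.functor.obj c).functor.map g := fun c b b' g => by
      have := hφ (Fin.cons c b) (Fin.cons c b')
        (consHom (x := Fin.cons c b) (y := Fin.cons c b') (𝟙 c) g)
      rwa [uncurryFunctor_map_consHom_id, uncurryFunctor_map_consHom_id] at this
    have h₂ : ∀ {c c' : C 0} (f : c ⟶ c') (b : ∀ k : Fin n, C k.succ),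
        app (G.functor.map f) b ≫ φ.app (Fin.cons c' b) =
          φ.app (Fin.cons c b) ≫ app (G'.functor.map f) b := fun {c c'} f b => by
      have := hφ (Fin.cons c b) (Fin.cons c' b)
        (consHom (x := Fin.cons c b) (y := Fin.cons c' b) f fun _ => 𝟙 _)
      rwa [uncurryFunctor_map_consHom, uncurryFunctor_map_consHom] at this
    have h₃ : ∀ (e : (S 0).Ext) (b : ∀ k : Fin n, C k.succ),
        app (G.add e) b ≫ φ.app (Fin.cons _ b) =
          (φ.app (Fin.cons _ b) ⊗ₘ φ.app (Fin.cons _ b)) ≫ app (G'.add e) b := fun e b => by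
      have := Premodel.Hom.addOf φ 0 (Fin.cons ((S 0).mid e) b) e
        (Fin.update_cons_zero _ _ _).symm (Fin.update_cons_zero _ _ _).symm
        (Fin.update_cons_zero _ _ _).symm
      rw [uncurryPremodel_addOf_zero, uncurryPremodel_addOf_zero] at this
      exact (congrArg (· ≫ _) (G.uncurryAddZero_rfl e b).symm).trans
        (this.trans (congrArg (_ ≫ ·) (G'.uncurryAddZero_rfl e b)))
    have h₄ : ∀ (c : C 0) (e : (tailSignature S).Ext),
        (G.functor.obj c).add e ≫ φ.app (Fin.cons c _) =
          (φ.app (Fin.cons c _) ⊗ₘ φ.app (Fin.cons c _)) ≫ (G'.functor.obj c).add e := fun c e => by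
      have := Premodel.Hom.addOf φ e.1.succ (Fin.cons c e.2.1) e.2.2
        (Fin.cons_update _ _ _ _) (Fin.cons_update _ _ _ _) (Fin.cons_update _ _ _ _)
      rw [uncurryPremodel_addOf_succ, uncurryPremodel_addOf_succ] at this
      exact (congrArg (· ≫ _) (G.uncurryAddSucc_rfl c e).symm).trans
        (this.trans (congrArg (_ ≫ ·) (G'.uncurryAddSucc_rfl c e)))
    refine ⟨{ app := fun c =>
        { app := fun b => φ.app (Fin.cons c b)
          naturality := fun g => h₁ c g
          add := fun e => h₄ c e }
              naturality := fun f => hom_ext fun b => h₂ f b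
              add := fun e => hom_ext fun b => h₃ e b }, hom_ext fun b => ?_⟩
    obtain ⟨c, b, rfl⟩ : ∃ c b', b = Fin.cons c b' := ⟨b 0, Fin.tail b, (Fin.cons_self_tail b).symm⟩
    rfl

/-- A morphism of the product factors as a change of the other variables followed by a change of the
first one, up to the transport that reassembles a tuple. -/
theorem curry_functor_map (F : Model (piSignature S) P) {b b' : ∀ i, C i} (f : b ⟶ b') :
    (curry.obj F).uncurryFunctor.map f ≫ F.functor.map (eqToHom (Fin.cons_self_tail b')) =
      F.functor.map (eqToHom (Fin.cons_self_tail b)) ≫ F.functor.map f := by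
  refine (congrArg (· ≫ _) (F.functor.map_comp _ _).symm).trans ?_
  refine (F.functor.map_comp _ _).symm.trans (Eq.trans (congrArg _ ?_) (F.functor.map_comp _ _))
  refine hom_ext_cons ?_ fun k => ?_
  · refine (congrArg (_ ≫ ·) (Functor.eqToHom_proj (Fin.cons_self_tail b') 0)).trans
      (Eq.trans ?_ (congrArg (· ≫ f 0) (Functor.eqToHom_proj (Fin.cons_self_tail b) 0)).symm)
    exact (Category.comp_id _).trans ((Category.id_comp (f 0)).trans (Category.id_comp (f 0)).symm)
  · refine (congrArg (_ ≫ ·) (Functor.eqToHom_proj (Fin.cons_self_tail b') k.succ)).trans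
      (Eq.trans ?_ (congrArg (· ≫ f k.succ)
        (Functor.eqToHom_proj (Fin.cons_self_tail b) k.succ)).symm)
    exact (Category.comp_id _).trans
      ((Category.comp_id (f k.succ)).trans (Category.id_comp (f k.succ)).symm)

theorem curry_uncurryAddZero (F : Model (piSignature S) P) (e : (S 0).Ext)
    (b : ∀ k : Fin n, C k.succ) {x y z : ∀ i, C i}
    (hz : z = Fin.cons ((S 0).quo e) b) (hx : x = Fin.cons ((S 0).sub e) b)
    (hy : y = Fin.cons ((S 0).mid e) b) :
    (curry.obj F).uncurryAddZero e b hz hx hy = F.addOf 0 (Fin.cons ((S 0).mid e) b) e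
      ((Fin.cons_self_tail z).trans (hz.trans (Fin.update_cons_zero _ _ _).symm))
      ((Fin.cons_self_tail x).trans (hx.trans (Fin.update_cons_zero _ _ _).symm))
      ((Fin.cons_self_tail y).trans (hy.trans (Fin.update_cons_zero _ _ _).symm)) := by
  subst hz hx hy
  exact uncurryAddZero_rfl _ _ _

theorem curry_uncurryAddSucc (F : Model (piSignature S) P) (c : C 0) (j : Fin n)
    (b : ∀ k : Fin n, C k.succ) (e : (S j.succ).Ext) {x y z : ∀ i, C i}
    (hz : z = Fin.cons c (update b j ((S j.succ).quo e)))
    (hx : x = Fin.cons c (update b j ((S j.succ).sub e)))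
    (hy : y = Fin.cons c (update b j ((S j.succ).mid e))) :
    (curry.obj F).uncurryAddSucc c ⟨j, b, e⟩ hz hx hy = F.addOf j.succ (Fin.cons c b) e
      ((Fin.cons_self_tail z).trans (hz.trans (Fin.cons_update _ _ _ _)))
      ((Fin.cons_self_tail x).trans (hx.trans (Fin.cons_update _ _ _ _)))
      ((Fin.cons_self_tail y).trans (hy.trans (Fin.cons_update _ _ _ _))) := by
  subst hz hx hy
  exact uncurryAddSucc_rfl _ _ _

/-- Currying is inverse to uncurrying. -/
def curryUncurryIso : curry (S := S) (P := P) ⋙ uncurry ≅ 𝟭 _ :=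
  NatIso.ofComponents (fun F => isoMk
    (fun b => F.functor.mapIso (eqToIso (Fin.cons_self_tail b)))
    (fun f => F.curry_functor_map f)
    (fun ⟨i, b, e⟩ => by
      revert b e
      refine Fin.cases (fun b e => ?_) (fun j b e => ?_) i
      · exact (congrArg (· ≫ F.functor.map (eqToHom _)) ((F.curry_uncurryAddZero e (Fin.tail b)
          (update_zero_eq_cons b _) (update_zero_eq_cons b _) (update_zero_eq_cons b _)).trans
            (F.isNatural.addOf_eq b (Fin.cons_self_tail _) (Fin.cons_self_tail _)
              (Fin.cons_self_tail _)))).trans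
          (F.toPremodel.addOf_eqToHom 0 b e _ _ _)
      · exact (congrArg (· ≫ F.functor.map (eqToHom _)) ((F.curry_uncurryAddSucc (b 0) j
          (Fin.tail b) e (update_succ_eq_cons b j _) (update_succ_eq_cons b j _)
          (update_succ_eq_cons b j _)).trans
            (F.isNatural.addOf_eq b (Fin.cons_self_tail _) (Fin.cons_self_tail _)
              (Fin.cons_self_tail _)))).trans
          (F.toPremodel.addOf_eqToHom j.succ b e _ _ _)))
    fun φ => hom_ext fun b => (naturality φ _).symm

instance : (uncurry (S := S) (P := P)).EssSurj where
  mem_essImage F := ⟨_, ⟨curryUncurryIso.app F⟩⟩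

instance : (uncurry (S := S) (P := P)).IsEquivalence where

instance : (curry (S := S) (P := P)).IsEquivalence := by
  have : (curry (S := S) (P := P) ⋙ uncurry).IsEquivalence :=
    Functor.isEquivalence_of_iso curryUncurryIso.symm
  exact Functor.isEquivalence_of_comp_right curry uncurry

end Model

end Uncurry

end MultiDeterminant

end

noncomputable section

namespace MultiDeterminant

open Functor.LaxMonoidal Function

/-! ### Restriction in all variables compared with restriction in two steps. -/

section AddAlong

variable {ι : Type} [DecidableEq ι] {C : ι → Type u} [∀ i, Category.{v} (C i)]
variable {A : ∀ i, Extensions.{u, w} (C i)}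
variable {P : Type u'} [Category.{v'} P] [MonoidalCategory P]

namespace Premodel

variable (F : Premodel (piExtensions A) P)

/-- The addition in the variable `i`, composed with the images of morphisms. -/
def addAlong (i : ι) (b : ∀ j, C j) (e : (A i).Ext) {x y z : ∀ j, C j}
    (fz : z ⟶ update b i ((A i).quo e)) (fx : x ⟶ update b i ((A i).sub e))
    (fy : update b i ((A i).mid e) ⟶ y) :
    F.functor.obj z ⊗ F.functor.obj x ⟶ F.functor.obj y :=
  (F.functor.map fz ⊗ₘ F.functor.map fx) ≫ F.add ⟨i, b, e⟩ ≫ F.functor.map fy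

theorem comp_addAlong {i : ι} {b : ∀ j, C j} {e : (A i).Ext} {x y z x' y' z' : ∀ j, C j}
    {fz : z ⟶ update b i ((A i).quo e)} {fx : x ⟶ update b i ((A i).sub e)}
    {fy : update b i ((A i).mid e) ⟶ y} (g : z' ⟶ z) (g' : x' ⟶ x) (k : y ⟶ y') :
    (F.functor.map g ⊗ₘ F.functor.map g') ≫ F.addAlong i b e fz fx fy ≫ F.functor.map k =
      F.addAlong i b e (g ≫ fz) (g' ≫ fx) (fy ≫ k) := by
  simp [addAlong]

theorem comp_addAlong_left {i : ι} {b : ∀ j, C j} {e : (A i).Ext} {x y z x' z' : ∀ j, C j}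
    {fz : z ⟶ update b i ((A i).quo e)} {fx : x ⟶ update b i ((A i).sub e)}
    {fy : update b i ((A i).mid e) ⟶ y} (g : z' ⟶ z) (g' : x' ⟶ x) :
    (F.functor.map g ⊗ₘ F.functor.map g') ≫ F.addAlong i b e fz fx fy =
      F.addAlong i b e (g ≫ fz) (g' ≫ fx) fy := by
  simp [addAlong]

theorem addAlong_comp {i : ι} {b : ∀ j, C j} {e : (A i).Ext} {x y z y' : ∀ j, C j}
    {fz : z ⟶ update b i ((A i).quo e)} {fx : x ⟶ update b i ((A i).sub e)}
    {fy : update b i ((A i).mid e) ⟶ y} (k : y ⟶ y') :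
    F.addAlong i b e fz fx fy ≫ F.functor.map k = F.addAlong i b e fz fx (fy ≫ k) := by
  simp [addAlong]

/-- An equation between additions can be tested after transport along equalities of objects. -/
theorem add_comp_eq_of_addOf {F F' : Premodel (piExtensions A) P}
    (ψ : ∀ x, F.functor.obj x ⟶ F'.functor.obj x)
    {i : ι} {b : ∀ j, C j} {e : (A i).Ext} {x y z : ∀ j, C j}
    (hz : z = update b i ((A i).quo e)) (hx : x = update b i ((A i).sub e))
    (hy : y = update b i ((A i).mid e))
    (h : F.addOf i b e hz hx hy ≫ ψ y = (ψ z ⊗ₘ ψ x) ≫ F'.addOf i b e hz hx hy) :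
    F.add ⟨i, b, e⟩ ≫ ψ _ = (ψ _ ⊗ₘ ψ _) ≫ F'.add ⟨i, b, e⟩ := by
  subst hz hx hy
  rwa [addOf_rfl, addOf_rfl] at h

end Premodel

variable {S : ∀ i, Signature.{u, v, w} (C i)} [LT ι]

/-- Reduces an equality of additions taken at different base points to three equations between
morphisms of the product category, not involving `F`. -/
theorem Premodel.IsNatural.addAlong_eq [SymmetricCategory P]
    {F : Premodel (piSignature S).toExtensions P}
    (hF : F.IsNatural) {i : ι} {b b' : ∀ j, C j} {e : (S i).Ext}
    (h : ∀ x : C i, update b i x = update b' i x) {x y z : ∀ j, C j}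
    {fz : z ⟶ update b i ((S i).quo e)} {fx : x ⟶ update b i ((S i).sub e)}
    {fy : update b i ((S i).mid e) ⟶ y} {fz' : z ⟶ update b' i ((S i).quo e)}
    {fx' : x ⟶ update b' i ((S i).sub e)} {fy' : update b' i ((S i).mid e) ⟶ y}
    (wz : fz ≫ eqToHom (h _) = fz') (wx : fx ≫ eqToHom (h _) = fx')
    (wy : eqToHom (h _) ≫ fy' = fy) :
    F.addAlong i b e fz fx fy = F.addAlong i b' e fz' fx' fy' := by
  subst wz wx wy
  have h' : ∀ j, j ≠ i → b j = b' j := fun j hj => by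
    have := congrFun (h (b i)) j
    rwa [update_of_ne hj, update_of_ne hj] at this
  dsimp only [Premodel.addAlong]
  rw [hF.add_eq i h' h e]
  simp

end AddAlong

section PiMap

variable {ι : Type} [DecidableEq ι]
variable {C : ι → Type u} [∀ i, Category.{v} (C i)] {D : ι → Type u₁} [∀ i, Category.{v₁} (D i)]
variable {A : ∀ i, Extensions.{u, w} (C i)} {B : ∀ i, Extensions.{u₁, w₁} (D i)}

theorem pi_obj_update (κ : ∀ i, C i ⥤ D i) (i : ι) (b : ∀ j, C j) (x : C i) :
    (Functor.pi κ).obj (update b i x) = update ((Functor.pi κ).obj b) i ((κ i).obj x) := by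
  funext j
  by_cases h : j = i
  · subst h; simp
  · simp [h]

/-- The product of the restriction data in each variable. -/
abbrev piMap (m : ∀ i, (A i).Map (B i)) : (piExtensions A).Map (piExtensions B) where
  functor := Functor.pi fun i => (m i).functor
  ext e := ⟨e.1, (Functor.pi fun i => (m i).functor).obj e.2.1, (m e.1).ext e.2.2⟩
  quo e := eqToHom (pi_obj_update _ _ _ _) ≫ (slice _ _).map ((m e.1).quo e.2.2)
  sub e := eqToHom (pi_obj_update _ _ _ _) ≫ (slice _ _).map ((m e.1).sub e.2.2)
  mid e := (slice _ _).map ((m e.1).mid e.2.2) ≫ eqToHom (pi_obj_update _ _ _ _).symm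

end PiMap

theorem comp_eqToHom_comp_eqToHom {E : Type*} [Category* E] {x y y₁ y₂ z : E} (f : x ⟶ y)
    (p₁ : y = y₁) (q₁ : y₁ = z) (p₂ : y = y₂) (q₂ : y₂ = z) :
    (f ≫ eqToHom p₁) ≫ eqToHom q₁ = (f ≫ eqToHom p₂) ≫ eqToHom q₂ := by
  subst p₁ q₁ p₂
  rfl

namespace Model

variable {n : ℕ} {C : Fin (n + 1) → Type u} [∀ i, Category.{v} (C i)]
variable {D : Fin (n + 1) → Type u₁} [∀ i, Category.{v₁} (D i)]
variable {S : ∀ i, Signature.{u, v, w} (C i)} {S' : ∀ i, Signature.{u₁, v₁, w₁} (D i)}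
variable {P : Type u'} [Category.{v'} P] [MonoidalCategory P] [SymmetricCategory P]
variable {m : ∀ i, (S i).toExtensions.Map (S' i).toExtensions}
variable (h₀ : Preserves P (m 0))
variable (h : Preserves (S := tailSignature S) (S' := tailSignature S') P (piMap fun k => m k.succ))

theorem cons_pi_obj (κ : ∀ i, C i ⥤ D i) (z : ∀ i, C i) :
    Fin.cons ((κ 0).obj (z 0)) ((Functor.pi fun k : Fin n => κ k.succ).obj (Fin.tail z)) =
      (Functor.pi κ).obj z :=
  Fin.cons_self_tail ((Functor.pi κ).obj z)

section

variable (κ : ∀ i, C i ⥤ D i) (b : ∀ i, C i)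

/-- This and the next three lemmas supply the equations required by `addAlong_eq` in `pullCurryHom`:
for the inputs and the output of an addition, in the first variable and in a later one. -/
theorem consHom_comp_eqToHom {x : C 0} {y : D 0}
    (f : (κ 0).obj x ⟶ y) {z : ∀ i, C i}
    (h₁ : Fin.cons y ((Functor.pi fun k : Fin n => κ k.succ).obj (Fin.tail b)) =
      update ((Functor.pi κ).obj b) 0 y)
    (h₂ : Fin.cons ((κ 0).obj x) ((Functor.pi fun k : Fin n => κ k.succ).obj (Fin.tail b)) =
      (Functor.pi κ).obj z) (h₃ : z = update b 0 x) :
    consHom (x := Fin.cons ((κ 0).obj x) ((Functor.pi fun k : Fin n => κ k.succ).obj (Fin.tail b)))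
        (y := Fin.cons y ((Functor.pi fun k : Fin n => κ k.succ).obj (Fin.tail b))) f
        (fun _ => 𝟙 _) ≫ eqToHom h₁ =
      eqToHom h₂ ≫ (Functor.pi κ).map (eqToHom h₃) ≫ eqToHom (pi_obj_update _ _ _ _) ≫
        (slice 0 ((Functor.pi κ).obj b)).map f := by
  refine (eqToHom_square
    (updateHom_zero_comp (fun j _ => 𝟙 ((Functor.pi κ).obj b j)) f)).trans ?_
  rw [eqToHom_map]
  simp only [eqToHom_trans_assoc]
  exact (eqToHom_trans_assoc _ _ _).symm

theorem eqToHom_comp_consHom {x : C 0} {y : D 0}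
    (f : y ⟶ (κ 0).obj x) {z : ∀ i, C i}
    (h₁ : update ((Functor.pi κ).obj b) 0 y =
      Fin.cons y ((Functor.pi fun k : Fin n => κ k.succ).obj (Fin.tail b)))
    (h₂ : Fin.cons ((κ 0).obj x) ((Functor.pi fun k : Fin n => κ k.succ).obj (Fin.tail b)) =
      (Functor.pi κ).obj z) (h₃ : update b 0 x = z) :
    eqToHom h₁ ≫ consHom
        (x := Fin.cons y ((Functor.pi fun k : Fin n => κ k.succ).obj (Fin.tail b)))
        (y := Fin.cons ((κ 0).obj x) ((Functor.pi fun k : Fin n => κ k.succ).obj (Fin.tail b))) f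
        (fun _ => 𝟙 _) ≫ eqToHom h₂ =
      ((slice 0 ((Functor.pi κ).obj b)).map f ≫ eqToHom (pi_obj_update _ _ _ _).symm) ≫
        (Functor.pi κ).map (eqToHom h₃) := by
  refine (Category.assoc _ _ _).symm.trans ((congrArg (· ≫ eqToHom h₂)
    (updateHom_zero_comp (fun j _ => 𝟙 ((Functor.pi κ).obj b j)) f).symm).trans ?_)
  rw [eqToHom_map]
  exact comp_eqToHom_comp_eqToHom _ _ _ _ _

theorem consFunctor_map_comp_eqToHom {j : Fin n} {x : C j.succ} {y : D j.succ}
    (f : (κ j.succ).obj x ⟶ y) {z : ∀ i, C i}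
    (h₁ : Fin.cons ((κ 0).obj (b 0))
      (update ((Functor.pi fun k : Fin n => κ k.succ).obj (Fin.tail b)) j y) =
        update ((Functor.pi κ).obj b) j.succ y)
    (h₂ : Fin.cons ((κ 0).obj (b 0)) ((Functor.pi fun k : Fin n => κ k.succ).obj
      (update (Fin.tail b) j x)) = (Functor.pi κ).obj z) (h₃ : z = update b j.succ x) :
    (consFunctor ((κ 0).obj (b 0))).map (eqToHom (pi_obj_update _ _ _ _) ≫
        (slice j ((Functor.pi fun k : Fin n => κ k.succ).obj (Fin.tail b))).map f) ≫ eqToHom h₁ =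
      eqToHom h₂ ≫ (Functor.pi κ).map (eqToHom h₃) ≫ eqToHom (pi_obj_update _ _ _ _) ≫
        (slice j.succ ((Functor.pi κ).obj b)).map f := by
  refine (congrArg (· ≫ eqToHom h₁) ((consFunctor ((κ 0).obj (b 0))).map_comp _ _)).trans
    ((Category.assoc _ _ _).trans ((congrArg (_ ≫ ·) (eqToHom_square
    (updateHom_succ_comp j (fun k _ => 𝟙 ((Functor.pi κ).obj b k)) f))).trans ?_))
  rw [eqToHom_map, eqToHom_map]
  simp only [eqToHom_trans_assoc]
  exact (eqToHom_trans_assoc _ _ _).trans (eqToHom_trans_assoc _ _ _).symm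

theorem eqToHom_comp_consFunctor_map {j : Fin n} {x : C j.succ} {y : D j.succ}
    (f : y ⟶ (κ j.succ).obj x) {z : ∀ i, C i}
    (h₁ : update ((Functor.pi κ).obj b) j.succ y = Fin.cons ((κ 0).obj (b 0))
      (update ((Functor.pi fun k : Fin n => κ k.succ).obj (Fin.tail b)) j y))
    (h₂ : Fin.cons ((κ 0).obj (b 0)) ((Functor.pi fun k : Fin n => κ k.succ).obj
      (update (Fin.tail b) j x)) = (Functor.pi κ).obj z) (h₃ : update b j.succ x = z) :
    eqToHom h₁ ≫ (consFunctor ((κ 0).obj (b 0))).map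
        ((slice j ((Functor.pi fun k : Fin n => κ k.succ).obj (Fin.tail b))).map f ≫
          eqToHom (pi_obj_update _ _ _ _).symm) ≫ eqToHom h₂ =
      ((slice j.succ ((Functor.pi κ).obj b)).map f ≫ eqToHom (pi_obj_update _ _ _ _).symm) ≫
        (Functor.pi κ).map (eqToHom h₃) := by
  refine (congrArg (_ ≫ · ≫ eqToHom h₂)
    ((consFunctor ((κ 0).obj (b 0))).map_comp _ _)).trans ?_
  refine (congrArg (_ ≫ ·) (Category.assoc _ _ _)).trans ?_
  refine (Category.assoc _ _ _).symm.trans ((congrArg (· ≫ _)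
    (updateHom_succ_comp j (fun k _ => 𝟙 ((Functor.pi κ).obj b k)) f).symm).trans ?_)
  refine (congrArg (fun k => _ ≫ k ≫ eqToHom h₂) (eqToHom_map (consFunctor _) _)).trans ?_
  refine (congrArg (_ ≫ ·) (eqToHom_trans _ _)).trans ?_
  rw [eqToHom_map (Functor.pi κ)]
  exact comp_eqToHom_comp_eqToHom _ _ _ _ _

end

/-- Restriction in the first variable followed by restriction in the other ones, in curried form. -/
abbrev curryPull : Model (piSignature S') P ⥤ Model (S 0) (Model (tailSignature S) P) :=
  curry ⋙ pull (h₀.model (tailSignature S')) ⋙ post (S 0) (pull h)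

/-- The nested restrictions unfold to one addition of `F` surrounded by images of morphisms, which
functoriality merges. `curryPull_obj_add` does the same for the other variables. -/
theorem curryPull_add (F : Model (piSignature S') P) (e : (S 0).Ext) (b : ∀ k : Fin n, C k.succ) :
    app (((curryPull h₀ h).obj F).add e) b =
      F.addAlong 0 (Fin.cons ((S' 0).mid ((m 0).ext e))
          ((Functor.pi fun k : Fin n => (m k.succ).functor).obj b)) ((m 0).ext e)
        (consHom (x := Fin.cons _ _) (y := Fin.cons _ _) ((m 0).quo e) (fun _ => 𝟙 _) ≫
          eqToHom (Fin.update_cons_zero _ _ _).symm)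
        (consHom (x := Fin.cons _ _) (y := Fin.cons _ _) ((m 0).sub e) (fun _ => 𝟙 _) ≫
          eqToHom (Fin.update_cons_zero _ _ _).symm)
        (eqToHom (Fin.update_cons_zero _ _ _) ≫
          consHom (x := Fin.cons _ _) (y := Fin.cons _ _) ((m 0).mid e) (fun _ => 𝟙 _)) :=
  (Category.id_comp _).trans (F.toPremodel.comp_addAlong _ _ _)

theorem curryPull_obj_add (F : Model (piSignature S') P) (c : C 0) (e : (tailSignature S).Ext) :
    (((curryPull h₀ h).obj F).functor.obj c).add e =
      F.addAlong e.1.succ (Fin.cons ((m 0).functor.obj c)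
          ((Functor.pi fun k : Fin n => (m k.succ).functor).obj e.2.1)) ((m e.1.succ).ext e.2.2)
        ((consFunctor ((m 0).functor.obj c)).map ((piMap fun k : Fin n => m k.succ).quo e) ≫
          eqToHom (Fin.cons_update _ _ _ _))
        ((consFunctor ((m 0).functor.obj c)).map ((piMap fun k : Fin n => m k.succ).sub e) ≫
          eqToHom (Fin.cons_update _ _ _ _))
        (eqToHom (Fin.cons_update _ _ _ _).symm ≫
          (consFunctor ((m 0).functor.obj c)).map ((piMap fun k : Fin n => m k.succ).mid e)) :=
  F.toPremodel.comp_addAlong _ _ _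

omit [SymmetricCategory P] in
theorem pull_piMap_addOf {n : ℕ} {C : Fin n → Type u} [∀ i, Category.{v} (C i)]
    {D : Fin n → Type u₁} [∀ i, Category.{v₁} (D i)]
    {A : ∀ i, Extensions.{u, w} (C i)} {B : ∀ i, Extensions.{u₁, w₁} (D i)}
    (m : ∀ i, (A i).Map (B i)) (F : Premodel (piExtensions B) P) (i : Fin n) (b : ∀ i, C i)
    (e : (A i).Ext) {x y z : ∀ j, C j} (hz : z = update b i ((A i).quo e))
    (hx : x = update b i ((A i).sub e)) (hy : y = update b i ((A i).mid e)) :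
    (F.pull (piMap m)).addOf i b e hz hx hy =
      F.addAlong i ((Functor.pi fun i => (m i).functor).obj b) ((m i).ext e)
        ((Functor.pi fun i => (m i).functor).map (eqToHom hz) ≫ (piMap m).quo ⟨i, b, e⟩)
        ((Functor.pi fun i => (m i).functor).map (eqToHom hx) ≫ (piMap m).sub ⟨i, b, e⟩)
        ((piMap m).mid ⟨i, b, e⟩ ≫ (Functor.pi fun i => (m i).functor).map (eqToHom hy.symm)) :=
  F.comp_addAlong _ _ _

/-- The comparison of the restriction in all variables with the one in two steps. -/
abbrev pullCurryHom (F : Model (piSignature S') P) :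
    ((curryPull h₀ h ⋙ uncurry).obj F).toPremodel.Hom (F.toPremodel.pull (piMap m)) where
  app b := F.functor.map (eqToHom (cons_pi_obj (fun i => (m i).functor) b))
  naturality f := F.curry_functor_map ((Functor.pi fun i => (m i).functor).map f)
  add := fun ⟨i, b, e⟩ => by
    revert b e
    refine Fin.cases (fun b e => ?_) (fun j b e => ?_) i
    -- Presenting the objects with `Fin.cons` makes the uncurried addition equal to the curried one.
    -- Both sides then become a single addition of `F` along morphisms, and `addAlong_eq` compares
    -- them.
    · refine Premodel.add_comp_eq_of_addOf (F := ((curryPull h₀ h ⋙ uncurry).obj F).toPremodel)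
        (F' := F.toPremodel.pull (piMap m)) (fun (b : ∀ i, C i) => F.functor.map
        (eqToHom (cons_pi_obj (fun i => (m i).functor) b))) (update_zero_eq_cons b _).symm
        (update_zero_eq_cons b _).symm (update_zero_eq_cons b _).symm ?_
      refine (congrArg (· ≫ F.functor.map (eqToHom _))
        ((uncurryPremodel_addOf_zero _ b e _ _ _).trans
        ((uncurryAddZero_rfl _ e (Fin.tail b)).trans
          (curryPull_add h₀ h F e (Fin.tail b))))).trans ?_
      refine (F.toPremodel.addAlong_comp _).trans (Eq.trans ?_ ((congrArg (_ ≫ ·)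
        (pull_piMap_addOf m F.toPremodel 0 b e _ _ _)).trans
          (F.toPremodel.comp_addAlong_left _ _)).symm)
      refine F.isNatural.addAlong_eq (fun x => (Fin.update_cons_zero _ _ _).trans
        (update_zero_eq_cons ((Functor.pi fun i => (m i).functor).obj b) x).symm) ?_ ?_ ?_
      · exact (Category.assoc _ _ _).trans ((congrArg (_ ≫ ·) (eqToHom_trans _ _)).trans
          (consHom_comp_eqToHom (fun i => (m i).functor) b _ _ _ _))
      · exact (Category.assoc _ _ _).trans ((congrArg (_ ≫ ·) (eqToHom_trans _ _)).trans
          (consHom_comp_eqToHom (fun i => (m i).functor) b _ _ _ _))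
      · refine (congrArg (eqToHom _ ≫ ·) (eqToHom_comp_consHom (fun i => (m i).functor) b
          ((m 0).mid e) (z := Fin.cons ((S 0).mid e) (Fin.tail b)) (update_zero_eq_cons _ _)
          (cons_pi_obj (fun i => (m i).functor) (Fin.cons ((S 0).mid e) (Fin.tail b)))
          (update_zero_eq_cons b _)).symm).trans ?_
        exact (eqToHom_trans_assoc _ _ _).trans (Category.assoc _ _ _).symm
    · refine Premodel.add_comp_eq_of_addOf (F := ((curryPull h₀ h ⋙ uncurry).obj F).toPremodel)
        (F' := F.toPremodel.pull (piMap m)) (fun (b : ∀ i, C i) => F.functor.map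
        (eqToHom (cons_pi_obj (fun i => (m i).functor) b))) (update_succ_eq_cons b j _).symm
        (update_succ_eq_cons b j _).symm (update_succ_eq_cons b j _).symm ?_
      refine (congrArg (· ≫ F.functor.map (eqToHom _))
        ((uncurryPremodel_addOf_succ _ j b e _ _ _).trans
        ((uncurryAddSucc_rfl _ (b 0) ⟨j, Fin.tail b, e⟩).trans
          (curryPull_obj_add h₀ h F (b 0) ⟨j, Fin.tail b, e⟩)))).trans ?_
      refine (F.toPremodel.addAlong_comp _).trans (Eq.trans ?_ ((congrArg (_ ≫ ·)
        (pull_piMap_addOf m F.toPremodel j.succ b e _ _ _)).trans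
          (F.toPremodel.comp_addAlong_left _ _)).symm)
      refine F.isNatural.addAlong_eq (fun x => congrArg (update · j.succ x)
        (cons_pi_obj (fun i => (m i).functor) b)) ?_ ?_ ?_
      · exact (Category.assoc _ _ _).trans ((congrArg (_ ≫ ·) (eqToHom_trans _ _)).trans
          (consFunctor_map_comp_eqToHom (fun i => (m i).functor) b _ _ _ _))
      · exact (Category.assoc _ _ _).trans ((congrArg (_ ≫ ·) (eqToHom_trans _ _)).trans
          (consFunctor_map_comp_eqToHom (fun i => (m i).functor) b _ _ _ _))
      · refine (congrArg (eqToHom _ ≫ ·) (eqToHom_comp_consFunctor_map (fun i => (m i).functor) b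
          ((m j.succ).mid e) (z := Fin.cons (b 0) (update (Fin.tail b) j ((S j.succ).mid e)))
          (update_succ_eq_cons _ _ _)
          (cons_pi_obj (fun i => (m i).functor)
            (Fin.cons (b 0) (update (Fin.tail b) j ((S j.succ).mid e))))
          (update_succ_eq_cons b j _)).symm).trans ?_
        exact (eqToHom_trans_assoc _ _ _).trans (Category.assoc _ _ _).symm

end Model

end MultiDeterminant

end

noncomputable section

namespace MultiDeterminant

open Functor.LaxMonoidal Function

/-! ### Induction on the number of variables. -/

namespace Model

variable {P : Type u'} [Category.{v'} P] [MonoidalCategory P] [SymmetricCategory P]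

section Empty

variable {C : Fin 0 → Type u} [∀ i, Category.{v} (C i)]
variable {D : Fin 0 → Type u₁} [∀ i, Category.{v₁} (D i)]
variable {S : ∀ i, Signature.{u, v, w} (C i)} {S' : ∀ i, Signature.{u₁, v₁, w₁} (D i)}
variable {m : ∀ i, (S i).toExtensions.Map (S' i).toExtensions}

theorem satisfies_of_fin_zero (F : Premodel (piSignature S).toExtensions P) :
    Premodel.Satisfies (piSignature S) F :=
  (Premodel.satisfies_pi_iff _).2 ⟨fun i => i.elim0, fun i => i.elim0, fun i => i.elim0⟩

/-- An empty product has a single object and only its identity, and there are no extensions. A model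
is then just an object of `P`, whichever signatures are used. -/
theorem isEquivalence_pull_fin_zero
    (h : Preserves (S := piSignature S) (S' := piSignature S') P (piMap m)) :
    (pull h).IsEquivalence := by
  let b₀ : ∀ i, C i := fun i => i.elim0
  have hb : ∀ x, (Functor.pi fun i => (m i).functor).obj b₀ = x := fun x => Subsingleton.elim _ _
  exact
    { faithful := ⟨fun {F G φ ψ} hφ => hom_ext fun x => by
        obtain rfl := hb x
        exact congrArg (app · b₀) hφ⟩
      full := ⟨fun {F G} φ => ⟨{
        app := fun x => F.functor.map (eqToHom (hb x).symm) ≫ app φ b₀ ≫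
          G.functor.map (eqToHom (hb x))
        naturality := fun {x y} f => by
          obtain rfl := hb x
          obtain rfl := hb y
          obtain rfl : 𝟙 _ = f := funext fun i => i.elim0
          simp
        add := fun e => e.1.elim0 }, hom_ext fun x => by
          obtain rfl : b₀ = x := Subsingleton.elim _ _
          change F.functor.map (𝟙 _) ≫ app φ b₀ ≫ G.functor.map (𝟙 _) = app φ b₀
          simp⟩⟩
      essSurj := ⟨fun G => ⟨⟨⟨(Functor.const _).obj (G.functor.obj b₀), fun e => e.1.elim0⟩,
        satisfies_of_fin_zero _⟩, ⟨isoMk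
          (fun x => G.functor.mapIso (eqToIso (Subsingleton.elim b₀ x)))
          (fun {x y} f => by
            obtain rfl : b₀ = x := Subsingleton.elim _ _
            obtain rfl : b₀ = y := Subsingleton.elim _ _
            obtain rfl : 𝟙 _ = f := funext fun i => i.elim0
            simp) fun e => e.1.elim0⟩⟩⟩ }

end Empty

/-- Restriction in several variables is an equivalence if it is one in each variable. -/
theorem exists_isEquivalence_pull_piMap {n : ℕ} {C : Fin n → Type u} [∀ i, Category.{v} (C i)]
    {D : Fin n → Type u₁} [∀ i, Category.{v₁} (D i)]
    {S : ∀ i, Signature.{u, v, w} (C i)} {S' : ∀ i, Signature.{u₁, v₁, w₁} (D i)}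
    {m : ∀ i, (S i).toExtensions.Map (S' i).toExtensions} (hm : ∀ i, Preserves P (m i))
    (he : ∀ i, (pull (hm i)).IsEquivalence) :
    ∃ h : Preserves (S := piSignature S) (S' := piSignature S') P (piMap m),
      (pull h).IsEquivalence := by
  induction n with
  | zero => exact ⟨fun F => satisfies_of_fin_zero _, isEquivalence_pull_fin_zero _⟩
  | succ n ih =>
    obtain ⟨h, h'⟩ := ih (S := fun k => S k.succ) (S' := fun k => S' k.succ)
      (m := fun k => m k.succ) (fun k => hm k.succ) fun k => he k.succ
    have := he 0
    have hi : ∀ (F : Model (piSignature S') P) b,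
        IsIso ((pullCurryHom (hm 0) h F).app b) := fun F b => isIso_map_eqToHom F.functor _
    -- The laws for the joint restriction need no direct check: the two-step construction yields a
    -- model, and `pullCurryHom` is a componentwise isomorphism from it.
    have hp : Preserves (S := piSignature S) (S' := piSignature S') P (piMap m) := fun F =>
      ((curryPull (hm 0) h ⋙ uncurry).obj F).satisfies.of_hom (pullCurryHom (hm 0) h F) (hi F)
    have e : curryPull (hm 0) h ⋙ uncurry ≅ pull hp := NatIso.ofComponents
      (fun F => isoOfHom (F := (curryPull (hm 0) h ⋙ uncurry).obj F) (G := (pull hp).obj F)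
        (pullCurryHom (hm 0) h F) (hi F))
      fun φ => hom_ext fun b => (naturality φ _).symm
    -- With this instance all factors of `curryPull (hm 0) h ⋙ uncurry` are equivalences: currying,
    -- restriction of the first variable over the target of models, composition with the inductive
    -- equivalence, and uncurrying.
    have := isEquivalence_pull_model (hm 0) (tailSignature S')
    exact ⟨hp, Functor.isEquivalence_of_iso e⟩

end Model

end MultiDeterminant

end

noncomputable section

namespace MultiDeterminant

open Functor.LaxMonoidal Function

/-! ## Symmetric monoidal functors as models -/

section Mon

variable {V : Type w} [Category.{v} V] [MonoidalCategory V] [SymmetricCategory V]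

variable (V) in
/-- The sums of two objects as formal extensions. -/
abbrev monExtensions : Extensions.{w, w} V where
  Ext := V × V
  sub e := e.2
  mid e := e.1 ⊗ e.2
  quo e := e.1

/-- The laws of the constraints of a symmetric monoidal functor which do not involve units. -/
inductive MonLaw : ∀ {p q : Word V}, Expr (monExtensions V) p q → Expr (monExtensions V) p q → Prop
  | natural {x y x' y' : V} (f : x ⟶ x') (g : y ⟶ y') :
      MonLaw (.comp (.sum (.hom f) (.hom g)) (.add (A := monExtensions V) (x', y')))
        (.comp (.add (A := monExtensions V) (x, y)) (.hom (f ⊗ₘ g)))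
  | assoc (x y z : V) :
      MonLaw (.comp (.sum (.add (A := monExtensions V) (x, y)) (.id (.of z)))
          (.comp (.add (A := monExtensions V) (x ⊗ y, z)) (.hom (α_ x y z).hom)))
        (.comp (.assoc _ _ _) (.comp (.sum (.id (.of x)) (.add (A := monExtensions V) (y, z)))
          (.add (A := monExtensions V) (x, y ⊗ z))))
  | braid (x y : V) :
      MonLaw (.comp (.add (A := monExtensions V) (x, y)) (.hom (β_ x y).hom))
        (.comp (.braid _ _) (.add (A := monExtensions V) (y, x)))

variable (V) in
/-- The signature of symmetric monoidal functors, without units. -/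
abbrev monSignature : Signature V where
  toExtensions := monExtensions V
  Law := MonLaw

variable {P : Type u'} [Category.{v'} P] [MonoidalCategory P] [SymmetricCategory P]

theorem satisfies_mon_iff (F : Premodel (monExtensions V) P) :
    Premodel.Satisfies (monSignature V) F ↔
      (∀ {x y x' y' : V} (f : x ⟶ x') (g : y ⟶ y'),
        (F.functor.map f ⊗ₘ F.functor.map g) ≫ F.add (x', y') =
          F.add (x, y) ≫ F.functor.map (f ⊗ₘ g)) ∧
      (∀ x y z : V, F.add (x, y) ▷ F.functor.obj z ≫ F.add (x ⊗ y, z) ≫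
          F.functor.map (α_ x y z).hom =
        (α_ _ _ _).hom ≫ F.functor.obj x ◁ F.add (y, z) ≫ F.add (x, y ⊗ z)) ∧
      ∀ x y : V, F.add (x, y) ≫ F.functor.map (β_ x y).hom = (β_ _ _).hom ≫ F.add (y, x) := by
  constructor
  · refine fun hF => ⟨fun f g => hF _ _ (MonLaw.natural f g), fun x y z => ?_,
      fun x y => hF _ _ (MonLaw.braid x y)⟩
    have : (F.add (x, y) ⊗ₘ 𝟙 (F.functor.obj z)) ≫ F.add (x ⊗ y, z) ≫
        F.functor.map (α_ x y z).hom =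
      (α_ _ _ _).hom ≫ (𝟙 (F.functor.obj x) ⊗ₘ F.add (y, z)) ≫ F.add (x, y ⊗ z) :=
        hF _ _ (MonLaw.assoc x y z)
    rwa [tensorHom_id, id_tensorHom] at this
  · rintro ⟨h₁, h₂, h₃⟩ p q m m' h
    cases h with
    | natural f g => exact h₁ f g
    | assoc x y z =>
      change (F.add (x, y) ⊗ₘ 𝟙 (F.functor.obj z)) ≫ F.add (x ⊗ y, z) ≫
          F.functor.map (α_ x y z).hom =
        (α_ _ _ _).hom ≫ (𝟙 (F.functor.obj x) ⊗ₘ F.add (y, z)) ≫ F.add (x, y ⊗ z)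
      rw [tensorHom_id, id_tensorHom]
      exact h₂ x y z
    | braid x y => exact h₃ x y

/-- The model given by a symmetric monoidal functor. -/
abbrev Model.ofBraided (F : V ⥤ P) [F.LaxBraided] : Model (monSignature V) P where
  functor := F
  add e := μ F e.1 e.2
  satisfies := (satisfies_mon_iff _).2 ⟨fun f g => μ_natural _ f g,
    fun x y z => Functor.LaxMonoidal.associativity F x y z,
    fun x y => Functor.LaxBraided.braided x y⟩

instance [PicardGroupoid P] : IsGroupoid P := PicardGroupoid.isGroupoid

instance [PicardGroupoid P] (x : P) : (tensorLeft x).IsEquivalence :=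
  PicardGroupoid.translation_isEquivalence x

theorem whiskerLeft_injective [PicardGroupoid P] (x : P) {y z : P} {f g : y ⟶ z}
    (h : x ◁ f = x ◁ g) : f = g :=
  (tensorLeft x).map_injective h

namespace Model

variable (F : Model (monSignature V) P)

theorem mon_natural {x y x' y' : V} (f : x ⟶ x') (g : y ⟶ y') :
    (F.functor.map f ⊗ₘ F.functor.map g) ≫ F.add (x', y') =
      F.add (x, y) ≫ F.functor.map (f ⊗ₘ g) :=
  ((satisfies_mon_iff _).1 F.satisfies).1 f g

theorem mon_natural_left {x x' : V} (f : x ⟶ x') (y : V) :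
    F.functor.map f ▷ _ ≫ F.add (x', y) = F.add (x, y) ≫ F.functor.map (f ▷ y) := by
  simpa using F.mon_natural f (𝟙 y)

theorem mon_natural_right (x : V) {y y' : V} (g : y ⟶ y') :
    _ ◁ F.functor.map g ≫ F.add (x, y') = F.add (x, y) ≫ F.functor.map (x ◁ g) := by
  simpa using F.mon_natural (𝟙 x) g

theorem mon_assoc (x y z : V) : F.add (x, y) ▷ F.functor.obj z ≫ F.add (x ⊗ y, z) ≫
      F.functor.map (α_ x y z).hom =
    (α_ _ _ _).hom ≫ F.functor.obj x ◁ F.add (y, z) ≫ F.add (x, y ⊗ z) :=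
  ((satisfies_mon_iff _).1 F.satisfies).2.1 x y z

theorem mon_braid (x y : V) :
    F.add (x, y) ≫ F.functor.map (β_ x y).hom = (β_ _ _).hom ≫ F.add (y, x) :=
  ((satisfies_mon_iff _).1 F.satisfies).2.2 x y

variable [PicardGroupoid P]

/-- The unit constraint, which exists and is unique since translations of a Picard groupoid are
fully faithful. -/
def unitConstraint : 𝟙_ P ⟶ F.functor.obj (𝟙_ V) :=
  (tensorLeft (F.functor.obj (𝟙_ V))).preimage
    ((ρ_ _).hom ≫ inv (F.functor.map (ρ_ (𝟙_ V)).hom) ≫ inv (F.add (𝟙_ V, 𝟙_ V)))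

theorem whiskerLeft_unitConstraint :
    F.functor.obj (𝟙_ V) ◁ F.unitConstraint ≫ F.add (𝟙_ V, 𝟙_ V) ≫
      F.functor.map (ρ_ (𝟙_ V)).hom = (ρ_ _).hom := by
  have : F.functor.obj (𝟙_ V) ◁ F.unitConstraint = _ :=
    (tensorLeft (F.functor.obj (𝟙_ V))).map_preimage _
  rw [this]
  simp

/-- The unit constraint is defined by right unitality at the unit object alone. Adding
`F.functor.obj x` on the left and using associativity for `(x, 𝟙_ V, 𝟙_ V)` extends this to objects
`x ⊗ 𝟙_ V`. -/
theorem right_unitality_tensor (x : V) :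
    F.functor.obj (x ⊗ 𝟙_ V) ◁ F.unitConstraint ≫ F.add (x ⊗ 𝟙_ V, 𝟙_ V) ≫
      F.functor.map (ρ_ (x ⊗ 𝟙_ V)).hom = (ρ_ _).hom := by
  rw [← cancel_epi (F.add (x, 𝟙_ V) ▷ 𝟙_ P), ← whisker_exchange_assoc, rightUnitor_tensor_hom,
    F.functor.map_comp, reassoc_of% (F.mon_assoc x (𝟙_ V) (𝟙_ V)), ← mon_natural_right]
  have h := F.whiskerLeft_unitConstraint
  refine (associator_naturality_right_assoc (F.functor.obj x) (F.functor.obj (𝟙_ V))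
    F.unitConstraint _).trans ?_
  refine (congrArg ((α_ _ _ _).hom ≫ ·)
    ((MonoidalCategory.whiskerLeft_comp_assoc _ _ _ _).symm.trans
    ((MonoidalCategory.whiskerLeft_comp_assoc _ _ _ _).symm.trans (congrArg
      (fun t => F.functor.obj x ◁ t ≫ F.add (x, 𝟙_ V)) ((Category.assoc _ _ _).trans h))))).trans ?_
  refine (rightUnitor_tensor_hom_assoc _ _ _).symm.trans ?_
  exact (rightUnitor_naturality _).symm

/-- Every `x` is isomorphic to `x ⊗ 𝟙_ V` by the right unitor, and the preceding case is carried
along it by naturality. -/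
theorem right_unitality (x : V) :
    F.functor.obj x ◁ F.unitConstraint ≫ F.add (x, 𝟙_ V) ≫ F.functor.map (ρ_ x).hom =
      (ρ_ _).hom := by
  rw [← cancel_epi (F.functor.map (ρ_ x).hom ▷ 𝟙_ P), ← whisker_exchange_assoc,
    reassoc_of% (F.mon_natural_left (ρ_ x).hom (𝟙_ V)), ← F.functor.map_comp,
    rightUnitor_naturality, F.functor.map_comp, rightUnitor_naturality,
    ← F.right_unitality_tensor x]
  simp

theorem left_unitality (x : V) :
    F.unitConstraint ▷ F.functor.obj x ≫ F.add (𝟙_ V, x) ≫ F.functor.map (λ_ x).hom =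
      (λ_ _).hom := by
  rw [← braiding_rightUnitor, F.functor.map_comp, reassoc_of% (F.mon_braid (𝟙_ V) x),
    BraidedCategory.braiding_naturality_left_assoc, right_unitality, braiding_rightUnitor]

/-- The monoidal structure of the functor underlying a model with values in a Picard groupoid. -/
abbrev monoidal : F.functor.Monoidal :=
  Functor.CoreMonoidal.toMonoidal
    { εIso := asIso F.unitConstraint
      μIso := fun x y => asIso (F.add (x, y))
      μIso_hom_natural_left := fun f y => F.mon_natural_left f y
      μIso_hom_natural_right := fun x g => F.mon_natural_right x g
      associativity := fun x y z => F.mon_assoc x y z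
      left_unitality := fun x => (F.left_unitality x).symm
      right_unitality := fun x => (F.right_unitality x).symm }

/-- The symmetric monoidal structure of the functor underlying a model with values in a Picard
groupoid. -/
abbrev braided : F.functor.Braided where
  toMonoidal := F.monoidal
  braided x y := F.mon_braid x y

end Model

omit [SymmetricCategory V] in
/-- A transformation between symmetric monoidal functors to a Picard groupoid which is compatible
with sums is compatible with units. -/
theorem isMonoidal_of_tensor [PicardGroupoid P] {F G : V ⥤ P} [F.LaxMonoidal] [G.LaxMonoidal]
    (τ : F ⟶ G)
    (h : ∀ x y, μ F x y ≫ τ.app (x ⊗ y) = (τ.app x ⊗ₘ τ.app y) ≫ μ G x y) :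
    NatTrans.IsMonoidal τ where
  tensor := h
  unit := by
    -- Translation by `G.obj (𝟙_ V)` is faithful. After it, and after precomposition with `τ` at the
    -- unit, right unitality of `F` and `G` makes both sides equal to a right unitor followed by
    -- `τ`.
    apply whiskerLeft_injective (G.obj (𝟙_ V))
    rw [← cancel_mono (μ G _ _), ← cancel_mono (G.map (ρ_ (𝟙_ V)).hom), Category.assoc,
      Category.assoc, ← Functor.LaxMonoidal.right_unitality, ← cancel_epi (τ.app (𝟙_ V) ▷ 𝟙_ P),
      rightUnitor_naturality, MonoidalCategory.whiskerLeft_comp, Category.assoc,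
      ← whisker_exchange_assoc, ← MonoidalCategory.tensorHom_def_assoc, ← reassoc_of% h,
      ← τ.naturality, Functor.LaxMonoidal.right_unitality F]
    simp

end Mon

end MultiDeterminant

end

noncomputable section

namespace MultiDeterminant

open Functor.LaxMonoidal Function

/-! ## Determinant functors as models -/

section Det

variable {T : Type u} [Category.{v} T] [HasZeroObject T] [HasShift T ℤ] [Preadditive T]
  [∀ n : ℤ, (shiftFunctor T n).Additive] [Pretriangulated T]

variable (T) in
/-- The distinguished triangles as formal extensions. -/
abbrev detExtensions : Extensions (Core T) where
  Ext := {Δ : Triangle T // Δ ∈ distTriang T}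
  sub Δ := ⟨Δ.1.obj₁⟩
  mid Δ := ⟨Δ.1.obj₂⟩
  quo Δ := ⟨Δ.1.obj₃⟩

/-- The formal addition of a distinguished triangle. -/
abbrev Expr.triangle {x y z : T} {f : x ⟶ y} {g : y ⟶ z} {h : z ⟶ x⟦(1 : ℤ)⟧}
    (hΔ : Triangle.mk f g h ∈ distTriang T) :
    Expr (detExtensions T) (.sum (.of ⟨z⟩) (.of ⟨x⟩)) (.of ⟨y⟩) :=
  .add (A := detExtensions T) ⟨Triangle.mk f g h, hΔ⟩

/-- The axioms of determinant functors. -/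
inductive DetLaw : ∀ {p q : Word (Core T)}, Expr (detExtensions T) p q →
    Expr (detExtensions T) p q → Prop
  | natural (Δ Δ' : Triangle T) (hΔ : Δ ∈ distTriang T) (hΔ' : Δ' ∈ distTriang T) (e : Δ ≅ Δ') :
      DetLaw
        (.comp (.sum (.hom (⟨Triangle.π₃.mapIso e⟩ : (⟨Δ.obj₃⟩ : Core T) ⟶ ⟨Δ'.obj₃⟩))
            (.hom (⟨Triangle.π₁.mapIso e⟩ : (⟨Δ.obj₁⟩ : Core T) ⟶ ⟨Δ'.obj₁⟩)))
          (.add (A := detExtensions T) ⟨Δ', hΔ'⟩))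
        (.comp (.add (A := detExtensions T) ⟨Δ, hΔ⟩)
          (.hom (⟨Triangle.π₂.mapIso e⟩ : (⟨Δ.obj₂⟩ : Core T) ⟶ ⟨Δ'.obj₂⟩)))
  | commutativity (x y : T) :
      DetLaw
        (.comp (.braid (.of ⟨x⟩) (.of ⟨y⟩))
          (.triangle (binaryBiproductTriangle_distinguished x y)))
        (.triangle (biprod_inr_fst_distinguished x y))
  | octahedron {x y z z' x' y' : T} {f : x ⟶ y} {g : y ⟶ z} {k : x ⟶ z}
      (comm : f ≫ g = k)
      {p₁ : y ⟶ z'} {q₁ : z' ⟶ x⟦(1 : ℤ)⟧} (h₁ : Triangle.mk f p₁ q₁ ∈ distTriang T)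
      {p₃ : z ⟶ x'} {q₃ : x' ⟶ y⟦(1 : ℤ)⟧} (h₃ : Triangle.mk g p₃ q₃ ∈ distTriang T)
      {p₂ : z ⟶ y'} {q₂ : y' ⟶ x⟦(1 : ℤ)⟧} (h₂ : Triangle.mk k p₂ q₂ ∈ distTriang T)
      (O : Triangulated.Octahedron comm h₁ h₃ h₂) :
      DetLaw
        (.comp (.sum (.triangle O.mem) (.id (.of ⟨x⟩))) (.triangle h₂))
        (.comp (.assoc _ _ _)
          (.comp (.sum (.id (.of (⟨x'⟩ : Core T))) (.triangle h₁)) (.triangle h₃)))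

variable (T) in
/-- The signature of determinant functors. -/
abbrev detSignature : Signature (Core T) where
  toExtensions := detExtensions T
  Law := DetLaw

variable {P : Type u'} [Category.{v'} P] [MonoidalCategory P] [SymmetricCategory P]

/-- The premodel underlying additivity data. -/
abbrev Additivity.premodel {F : Core T ⥤ P} (a : Additivity F) : Premodel (detExtensions T) P where
  functor := F
  add Δ := a.add Δ.1 Δ.2

theorem Additivity.satisfies {F : Core T ⥤ P} (a : Additivity F) :
    Premodel.Satisfies (detSignature T) a.premodel := fun p q m m' h => by
  cases h with
  | natural Δ Δ' hΔ hΔ' e => exact a.naturality Δ Δ' hΔ hΔ' e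
  | commutativity x y => exact a.commutativity x y
  | octahedron comm h₁ h₃ h₂ O =>
    refine Eq.trans ?_ ((a.octahedron comm h₁ h₃ h₂ O).trans ?_)
    · exact congrArg (· ≫ a.add _ h₂) (tensorHom_id _ _)
    · exact congrArg (fun t => (α_ _ _ _).hom ≫ t ≫ a.add _ h₃) (id_tensorHom _ _).symm

/-- The additivity data of a premodel which satisfies the axioms of determinant functors. -/
abbrev Premodel.Satisfies.additivity {F : Premodel (detExtensions T) P}
    (h : Premodel.Satisfies (detSignature T) F) : Additivity F.functor where
  add Δ hΔ := F.add ⟨Δ, hΔ⟩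
  naturality Δ Δ' hΔ hΔ' e := h _ _ (DetLaw.natural Δ Δ' hΔ hΔ' e)
  commutativity x y := h _ _ (DetLaw.commutativity x y)
  octahedron comm _ _ h₁ _ _ h₃ _ _ h₂ O := by
    refine Eq.trans ?_ ((h _ _ (DetLaw.octahedron comm h₁ h₃ h₂ O)).trans ?_)
    · exact congrArg (· ≫ F.add ⟨_, h₂⟩) (tensorHom_id _ _).symm
    · exact congrArg (fun t => (α_ _ _ _).hom ≫ t ≫ F.add ⟨_, h₃⟩) (id_tensorHom _ _)

/-- The determinant functor given by a model. -/
abbrev Model.detFunctor (F : Model (detSignature T) P) : DetFunctor T P where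
  toFunctor := F.functor
  additivity := F.satisfies.additivity

variable {V : Type u₁} [Category.{v₁} V] [MonoidalCategory V] [SymmetricCategory V]

/-- A determinant functor turns distinguished triangles into sums. -/
abbrev detMap (det : DetFunctor T V) : (detExtensions T).Map (monExtensions V) where
  functor := det.toFunctor
  ext Δ := (det.toFunctor.obj ⟨Δ.1.obj₃⟩, det.toFunctor.obj ⟨Δ.1.obj₁⟩)
  quo _ := 𝟙 _
  sub _ := 𝟙 _
  mid Δ := det.additivity.add Δ.1 Δ.2

/-- The octahedron axiom for a composite with `det`: apply `F` to the axiom in `V`, then use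
naturality of the additions in each argument and their associativity. -/
theorem Model.mon_octahedron (F : Model (monSignature V) P) {x y z x' y' z' : V}
    {a₄ : x' ⊗ z' ⟶ y'} {a₂ : y' ⊗ x ⟶ z} {a₁ : z' ⊗ x ⟶ y} {a₃ : x' ⊗ y ⟶ z}
    (h : a₄ ▷ x ≫ a₂ = (α_ _ _ _).hom ≫ x' ◁ a₁ ≫ a₃) :
    (F.add (x', z') ≫ F.functor.map a₄) ▷ F.functor.obj x ≫ F.add (y', x) ≫ F.functor.map a₂ =
      (α_ _ _ _).hom ≫ F.functor.obj x' ◁ (F.add (z', x) ≫ F.functor.map a₁) ≫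
        F.add (x', y) ≫ F.functor.map a₃ := by
  have key := congrArg F.functor.map h
  have h₄ := F.mon_natural_left a₄ x
  have h₅ := F.mon_natural_right x' a₁
  have h₆ := F.mon_assoc x' z' x
  rw [F.functor.map_comp, F.functor.map_comp, F.functor.map_comp] at key
  dsimp only at *
  rw [comp_whiskerRight, MonoidalCategory.whiskerLeft_comp, Category.assoc, Category.assoc,
    reassoc_of% h₄, reassoc_of% h₅, key, reassoc_of% h₆]

/-- The composition of a determinant functor with a symmetric monoidal functor. -/
abbrev Model.compAdditivity (det : DetFunctor T V) (F : Model (monSignature V) P) :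
    Additivity (det.toFunctor ⋙ F.functor) where
  add Δ hΔ := F.add (det.toFunctor.obj ⟨Δ.obj₃⟩, det.toFunctor.obj ⟨Δ.obj₁⟩) ≫
    F.functor.map (det.additivity.add Δ hΔ)
  naturality Δ Δ' hΔ hΔ' e := by
    refine (Category.assoc _ _ _).symm.trans ((congrArg (· ≫ _) (F.mon_natural _ _)).trans ?_)
    refine (Category.assoc _ _ _).trans (Eq.trans ?_ (Category.assoc _ _ _).symm)
    refine congrArg (F.add _ ≫ ·) ?_
    refine (F.functor.map_comp _ _).symm.trans (Eq.trans ?_ (F.functor.map_comp _ _))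
    exact congrArg _ (det.additivity.naturality Δ Δ' hΔ hΔ' e)
  commutativity x y := by
    refine (Category.assoc _ _ _).symm.trans ((congrArg (· ≫ _) (F.mon_braid _ _).symm).trans ?_)
    refine (Category.assoc _ _ _).trans (congrArg (F.add _ ≫ ·) ?_)
    refine (F.functor.map_comp _ _).symm.trans ?_
    exact congrArg _ (det.additivity.commutativity x y)
  octahedron {x y z z' x' y' f g k} comm _ _ h₁ _ _ h₃ _ _ h₂ O := by
    exact F.mon_octahedron (det.additivity.octahedron comm h₁ h₃ h₂ O)

theorem preserves_detMap (det : DetFunctor T V) :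
    Preserves (S := detSignature T) (S' := monSignature V) P (detMap det) := fun F =>
  (F.compAdditivity det).satisfies.of_add_eq fun Δ => by
    refine (congrArg (· ≫ _)
      (congrArg₂ (· ⊗ₘ ·) (F.functor.map_id _) (F.functor.map_id _))).trans ?_
    refine (congrArg (· ≫ _) (id_tensorHom_id _ _)).trans (Category.id_comp _)

/-- The factorization given by a morphism from the restriction of a model along `det`. -/
abbrev DetFactorization.ofHom {W : Type w} [Category.{w} W] [MonoidalCategory W]
    [SymmetricCategory W] [PicardGroupoid P] {det : DetFunctor T W}
    {G : Model (monSignature W) P} {F : Model (detSignature T) P}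
    (φ : (Model.pull (preserves_detMap (P := P) det)).obj G ⟶ F) :
    DetFactorization det F.detFunctor where
  functor := G.functor
  braided := G.braided
  trans := { app := fun x => Model.app φ x, naturality := fun _ _ f => Model.naturality φ f }
  compatible Δ hΔ := by
    refine Eq.trans ?_ (Model.add_app φ ⟨Δ, hΔ⟩)
    refine (Category.assoc _ _ _).symm.trans (congrArg (· ≫ _) (Eq.symm ?_))
    refine (congrArg (· ≫ _)
      (congrArg₂ (· ⊗ₘ ·) (G.functor.map_id _) (G.functor.map_id _))).trans ?_
    exact (congrArg (· ≫ _) (id_tensorHom_id _ _)).trans (Category.id_comp _)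

/-! ### Universality as an equivalence between categories of models. -/

section Universal

variable {W : Type w} [Category.{w} W] [MonoidalCategory W] [SymmetricCategory W]
variable {Q : Type w} [Category.{w} Q] [MonoidalCategory Q] [SymmetricCategory Q]
  [PicardGroupoid Q]
variable {det : DetFunctor T W}

/-- A monoidal transformation between factorizations as a morphism of models. -/
abbrev DetFactorization.homOfIsMonoidal {D : DetFunctor T Q} (p : DetFactorization det D)
    (G : Model (monSignature W) Q)
    (β : p.functor ⟶ G.functor) (hβ : letI := G.monoidal; NatTrans.IsMonoidal β) :
    Model.ofBraided p.functor ⟶ G where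
  app x := β.app x
  naturality f := β.naturality f
  add e := hβ.tensor e.1 e.2

/-- Restriction along a universal determinant functor is an equivalence. -/
theorem IsUniversal.isEquivalence (h : IsUniversal det) :
    (Model.pull (preserves_detMap (P := Q) det)).IsEquivalence where
  faithful := ⟨fun {G G'} γ γ' hγ => by
    let R := Model.pull (preserves_detMap (P := Q) det)
    -- All comparisons start from the universal factorization `p` of the restriction of `G'`; both
    -- `(G, R.map γ)` and `(G', 𝟙)` are factorizations of the same determinant functor.
    obtain ⟨p, hp⟩ := h Q (R.obj G').detFunctor
    obtain ⟨β, ⟨hβ, hβ'⟩, -⟩ := hp (.ofHom (R.map γ))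
    obtain ⟨δ, -, hδ⟩ := hp (.ofHom (𝟙 (R.obj G')))
    -- For every such `ε`, the composite of `β` and `ε` is a monoidal comparison from `p` to `(G',
    -- 𝟙)`, hence is the unique one. Since `Q` is a groupoid, `β` can then be cancelled.
    have key : ∀ ε : G ⟶ G', R.map ε = R.map γ → ∀ x, β.app x ≫ Model.app ε x = δ.app x := by
      intro ε hε x
      let b := p.homOfIsMonoidal G β hβ ≫ ε
      let ε' : p.functor ⟶ G'.functor :=
        { app := fun x => Model.app b x, naturality := fun _ _ f => Model.naturality b f }
      refine congrArg (fun τ : p.functor ⟶ G'.functor => τ.app x) (hδ ε' ⟨?_, ?_⟩)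
      · let := G'.monoidal
        exact isMonoidal_of_tensor ε' fun x y => Model.add_app b (x, y)
      · refine Eq.trans ?_ hβ'
        ext x
        have := congrArg (Model.app · x) hε
        exact (Category.comp_id _).trans (congrArg (β.app _ ≫ ·) this)
    exact Model.hom_ext fun x => (cancel_epi (β.app x)).1
      ((key γ rfl x).trans (key γ' hγ.symm x).symm)⟩
  full := ⟨fun {G G'} φ => by
    let R := Model.pull (preserves_detMap (P := Q) det)
    obtain ⟨p, hp⟩ := h Q (R.obj G').detFunctor
    obtain ⟨β, ⟨hβ, hβ'⟩, -⟩ := hp (.ofHom φ)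
    obtain ⟨δ, ⟨hδ, hδ'⟩, -⟩ := hp (.ofHom (𝟙 (R.obj G')))
    have : IsIso (p.homOfIsMonoidal G β hβ) := Model.isIso_of_app _ fun x =>
      inferInstanceAs (IsIso (β.app x))
    -- The comparisons from `p` to `(G, φ)` and to `(G', 𝟙)` are invertible, and their quotient
    -- restricts to `φ`.
    refine ⟨inv (p.homOfIsMonoidal G β hβ) ≫ p.homOfIsMonoidal G' δ hδ,
      Model.hom_ext fun x => ?_⟩
    rw [← cancel_epi (Model.app (p.homOfIsMonoidal G β hβ) (det.toFunctor.obj x))]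
    have h₁ := congrArg (Model.app · (det.toFunctor.obj x)) (IsIso.hom_inv_id_assoc
      (p.homOfIsMonoidal G β hβ) (p.homOfIsMonoidal G' δ hδ))
    have h₂ := congrArg (NatTrans.app · x) (hβ'.trans hδ'.symm)
    exact h₁.trans ((Category.comp_id _).symm.trans h₂.symm)⟩
  essSurj := ⟨fun F => by
    obtain ⟨p, -⟩ := h Q F.detFunctor
    refine ⟨Model.ofBraided p.functor, ⟨Model.isoMk (fun x => asIso (p.trans.app x))
      (fun f => p.trans.naturality f) fun Δ => ?_⟩⟩
    refine Eq.trans ?_ (p.compatible Δ.1 Δ.2)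
    refine Eq.trans ?_ (Category.assoc _ _ _)
    refine congrArg (· ≫ _) ?_
    refine (congrArg (· ≫ _)
      (congrArg₂ (· ⊗ₘ ·) (p.functor.map_id _) (p.functor.map_id _))).trans ?_
    exact (congrArg (· ≫ _) (id_tensorHom_id _ _)).trans (Category.id_comp _)⟩

end Universal

end Det

end MultiDeterminant

end

noncomputable section

namespace MultiDeterminant

open Functor.LaxMonoidal Function

/-! ## Multi-determinant functors and multiexact functors as models -/

section MultiModels

variable {n : ℕ}
variable {P : Type u'} [Category.{v'} P] [MonoidalCategory P] [SymmetricCategory P]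

section MultiDet

variable {T : Fin n → Type u} [∀ i, Category.{v} (T i)]
  [∀ i, HasZeroObject (T i)] [∀ i, HasShift (T i) ℤ] [∀ i, Preadditive (T i)]
  [∀ i, ∀ n : ℤ, (shiftFunctor (T i) n).Additive] [∀ i, Pretriangulated (T i)]

/-- The model given by a multi-determinant functor. -/
abbrev MultiDet.model (D : MultiDet T P) : Model (piSignature fun i => detSignature (T i)) P where
  functor := D.toFunctor
  add e := (D.additivity e.1 e.2.1).add e.2.2.1 e.2.2.2
  satisfies := (Premodel.satisfies_pi_iff _).2
    ⟨fun i b => (D.additivity i b).satisfies,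
      fun i b b' φ Δ => D.triangle_function i b b' φ Δ.1 Δ.2,
      fun i j _ h b Δ Δ' => D.two_triangles i j h b Δ.1 Δ.2 Δ'.1 Δ'.2⟩

end MultiDet

section MultiExact

variable {V : Fin n → Type u} [∀ i, Category.{v} (V i)]
  [∀ i, MonoidalCategory (V i)] [∀ i, SymmetricCategory (V i)]

/-- `MultiExact` and `piSignature` put the exchange on opposite sides of the interchange law; the
involution converts one form into the other. -/
theorem tensorμ_comp_eq {a b c d e : P} {f : (a ⊗ c) ⊗ b ⊗ d ⟶ e} {g : (a ⊗ b) ⊗ c ⊗ d ⟶ e}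
    (h : f = tensorμ _ _ _ _ ≫ g) : g = tensorμ _ _ _ _ ≫ f := by
  rw [h, tensorμ_tensorμ_assoc]

/-- The model given by a multiexact functor. -/
abbrev MultiExact.model (d : MultiExact V P) :
    Model (piSignature fun i => monSignature (V i)) P where
  functor := d.toFunctor
  add e := d.sum e.1 e.2.1 e.2.2.1 e.2.2.2
  satisfies := (Premodel.satisfies_pi_iff _).2
    ⟨fun i b => (Model.ofBraided (slice i b ⋙ d.toFunctor)).satisfies,
      fun i b b' φ e => d.sum_natural i b b' φ e.1 e.2,
      fun i j _ h b e e' => tensorμ_comp_eq (d.interchange i j h b e.1 e.2 e'.1 e'.2)⟩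

/-- The multiexact functor given by a model with values in a Picard groupoid. -/
abbrev Model.multiExact [PicardGroupoid P]
    (F : Model (piSignature fun i => monSignature (V i)) P) : MultiExact V P where
  toFunctor := F.functor
  braided i b := Model.braided ⟨F.toPremodel.atSlice i b, F.satisfies_slice i b⟩
  sum_natural i b b' φ x y := F.isNatural i b b' φ (x, y)
  interchange i j h b x y s t := tensorμ_comp_eq (F.interchange i j h b (x, y) (s, t))

/-- A morphism between the models of multiexact functors is a 2-cell. -/
theorem isTwoCell_of_hom [PicardGroupoid P] {d g : MultiExact V P} (γ : d.model ⟶ g.model) :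
    IsTwoCell d g
      { app := fun x => Model.app γ x, naturality := fun _ _ f => Model.naturality γ f } :=
  fun i b => isMonoidal_of_tensor _ fun x y => Model.add_app γ ⟨i, b, (x, y)⟩

/-- A 2-cell as a morphism of models. -/
abbrev IsTwoCell.hom {d g : MultiExact V P} {γ : d.toFunctor ⟶ g.toFunctor}
    (hγ : IsTwoCell d g γ) : d.model ⟶ g.model where
  app x := γ.app x
  naturality f := γ.naturality f
  add e := (hγ e.1 e.2.1).tensor e.2.2.1 e.2.2.2

end MultiExact

section Factorization

variable {T : Fin n → Type u} [∀ i, Category.{v} (T i)]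
  [∀ i, HasZeroObject (T i)] [∀ i, HasShift (T i) ℤ] [∀ i, Preadditive (T i)]
  [∀ i, ∀ n : ℤ, (shiftFunctor (T i) n).Additive] [∀ i, Pretriangulated (T i)]
  {V : Fin n → Type w} [∀ i, Category.{w} (V i)]
  [∀ i, MonoidalCategory (V i)] [∀ i, SymmetricCategory (V i)]

/-- The two formulas differ by the images of identities that `detMap` inserts in the slices and by
how composites are grouped under `d`. -/
theorem compAdd_eq (det : ∀ i, DetFunctor (T i) (V i)) (d : MultiExact V P) (i : Fin n)
    (b : ∀ j, Core (T j)) (Δ : Triangle (T i)) (hΔ : Δ ∈ distTriang (T i)) :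
    compAdd det d i b Δ hΔ =
      (d.model.toPremodel.pull (piMap fun i => detMap (det i))).add ⟨i, b, ⟨Δ, hΔ⟩⟩ := by
  have key : ∀ x : Core (T i), (prodDetIso det d.toFunctor i b x).hom =
      d.toFunctor.map (eqToHom (pi_obj_update (fun i => (det i).toFunctor) i b x) ≫
        (slice i _).map (𝟙 _)) := fun x =>
    congrArg d.toFunctor.map (((congrArg (eqToHom _ ≫ ·)
      ((slice i _).map_id _)).trans (Category.comp_id _))).symm
  exact congrArg₂ (· ≫ ·) (congrArg₂ (· ⊗ₘ ·) (key _) (key _))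
    (congrArg (_ ≫ ·) (d.toFunctor.map_comp _ _).symm)

variable {det : ∀ i, DetFunctor (T i) (V i)}
  (h : Preserves (S := piSignature fun i => detSignature (T i))
    (S' := piSignature fun i => monSignature (V i)) P (piMap fun i => detMap (det i)))

/-- A morphism of multi-determinant functors as a morphism of models. -/
abbrev IsDetMorphism.hom {d : MultiExact V P} {D : MultiDet T P}
    {a : prodDet det ⋙ d.toFunctor ⟶ D.toFunctor} (ha : IsDetMorphism det d D a) :
    (Model.pull h).obj d.model ⟶ D.model where
  app x := a.app x
  naturality f := a.naturality f
  add e := (congrArg (· ≫ _) (compAdd_eq det d e.1 e.2.1 e.2.2.1 e.2.2.2).symm).trans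
    (ha e.1 e.2.1 e.2.2.1 e.2.2.2)

theorem isDetMorphism_of_hom {d : MultiExact V P} {D : MultiDet T P}
    (φ : (Model.pull h).obj d.model ⟶ D.model) :
    IsDetMorphism det d D
      { app := fun x => Model.app φ x, naturality := fun _ _ f => Model.naturality φ f } :=
  fun i b Δ hΔ => (congrArg (· ≫ _) (compAdd_eq det d i b Δ hΔ)).trans
    (Model.add_app φ ⟨i, b, ⟨Δ, hΔ⟩⟩)

end Factorization

end MultiModels

end MultiDeterminant

end

/-! ### Factorization of multi-determinant functors. -/

theorem theorem4p1 (n : ℕ)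
    (T : Fin (n + 1) → Type u) [∀ i, Category.{v} (T i)]
    [∀ i, HasZeroObject (T i)] [∀ i, HasShift (T i) ℤ] [∀ i, Preadditive (T i)]
    [∀ i, ∀ m : ℤ, (shiftFunctor (T i) m).Additive] [∀ i, Pretriangulated (T i)]
    [∀ i, IsTriangulated (T i)]
    (V : Fin (n + 1) → Type w) [∀ i, Category.{w} (V i)] [∀ i, MonoidalCategory (V i)]
    [∀ i, SymmetricCategory (V i)] [∀ i, MultiDeterminant.PicardGroupoid (V i)]
    (det : ∀ i, MultiDeterminant.DetFunctor (T i) (V i))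
    (hdet : ∀ i, MultiDeterminant.IsUniversal (det i))
    (P : Type w) [Category.{w} P] [MonoidalCategory P] [SymmetricCategory P]
    [MultiDeterminant.PicardGroupoid P]
    (D : MultiDeterminant.MultiDet T P) :
    ∃ (d : MultiDeterminant.MultiExact V P)
      (a : MultiDeterminant.prodDet det ⋙ d.toFunctor ⟶ D.toFunctor),
      MultiDeterminant.IsDetMorphism det d D a ∧
      ∀ (g : MultiDeterminant.MultiExact V P)
        (β : MultiDeterminant.prodDet det ⋙ g.toFunctor ⟶ D.toFunctor),
        MultiDeterminant.IsDetMorphism det g D β →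
        ∃! γ : d.toFunctor ⟶ g.toFunctor, MultiDeterminant.IsTwoCell d g γ ∧
          a = Functor.whiskerLeft (MultiDeterminant.prodDet det) γ ≫ β := by
  obtain ⟨h, _⟩ := MultiDeterminant.Model.exists_isEquivalence_pull_piMap (P := P)
    (fun i => MultiDeterminant.preserves_detMap (det i)) fun i => (hdet i).isEquivalence
  let R := MultiDeterminant.Model.pull h
  let F := R.objPreimage D.model
  let e : R.obj F ≅ D.model := R.objObjPreimageIso D.model
  -- The model of `F.multiExact` is `F` definitionally, so `e.hom` is directly a morphism out of its
  -- restriction.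
  refine ⟨F.multiExact, _, MultiDeterminant.isDetMorphism_of_hom h (d := F.multiExact) e.hom,
    fun g β hβ => ?_⟩
  -- Invertible because `P` is a groupoid. The condition on `γ` therefore prescribes its restriction
  -- as `e.hom ≫ inv (hβ.hom h)`, which has exactly one lift since `R` is fully faithful.
  have : IsIso (hβ.hom h) := MultiDeterminant.Model.isIso_of_app _ fun x =>
    inferInstanceAs (IsIso (β.app x))
  let γ : F ⟶ g.model := R.preimage (e.hom ≫ inv (hβ.hom h))
  have hγ : R.map γ ≫ hβ.hom h = e.hom := by
    rw [R.map_preimage, Category.assoc, IsIso.inv_hom_id, Category.comp_id]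
  refine ⟨_, ⟨MultiDeterminant.isTwoCell_of_hom (d := F.multiExact) (g := g) γ, ?_⟩, ?_⟩
  · ext x
    exact congrArg (MultiDeterminant.Model.app · x) hγ.symm
  · rintro δ ⟨hδ, hδ'⟩
    let δ' : F ⟶ g.model := hδ.hom
    -- Any competing 2-cell is a morphism of models with the same restriction as `γ`, so
    -- faithfulness of `R` identifies the two.
    have key : R.map δ' = R.map γ := (cancel_mono (hβ.hom h)).1 <| Eq.trans
      (MultiDeterminant.Model.hom_ext fun x => (congrArg (NatTrans.app · x) hδ').symm) hγ.symm
    ext x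
    exact congrArg (MultiDeterminant.Model.app · x) (R.map_injective key)
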